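/- **Fusion rule (I).** Let $q_1=e^{\epsilon_1},q_2=e^{\epsilon_2},q_3=e^{\epsilon_3}$ with $\epsilon_1+\epsilon_2+\epsilon_3=0$, so $q_1q_2q_3=1$, and assume that $q_1^Lq_2^Mq_3^N=1$ with $L,M,N\in\mathbb Z$ forces $L=M=N$; powers are $q_i^s:=e^{s\epsilon_i}$. Let $p\in\mathbb C$, $0<|p|<1$, $(x;p)_\infty=\prod_{k\ge0}(1-p^kx)$, $\theta_p(x)=(x;p)_\infty(px^{-1};p)_\infty$. Let $\vec c=(c_1,\dots,c_n)\in\{1,2,3\}^n$, $q_{\vec c}:=\prod_k q_{c_k}\neq1$, $q_{\vec c}^s:=\prod_kq_{c_k}^s$, and $u_1,\dots,u_n\in\mathbb C$. *Fock space.* Put $\kappa_s=\prod_{i=1}^3(q_i^s-1)$. Let $\mathcal H$ be the Fock space with vacuum $|0\rangle$ of the oscillators $a^{(k)}_{\pm s},b^{(k)}_{\pm s}$ ($1\le k\le n$, $s\ge1$), whose only nonzero commutators are $$[a^{(k)}_s,a^{(k)}_{-s}]=\tfrac{s}{\kappa_s}(q_{c_k}^{s/2}-q_{c_k}^{-s/2})(1-p^s),\qquad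 [b^{(k)}_s,b^{(k)}_{-s}]=\tfrac{s}{\kappa_s}(q_{c_k}^{s/2}-q_{c_k}^{-s/2})\tfrac{1-p^s}{p^s}.$$ For $q_i$ the parameter of the factor $k$ ($i=c_k$), with $A_s=\frac{1}{1-p^s}\frac{\kappa_s}{s}$, $B_s=\frac{p^s}{1-p^s}\frac{\kappa_s}{s}$ and all sums over $s\ge1$, set $$K_k^-(z)=\varphi_k(z)=\exp\Big(\sum B_sq_i^{s/4}b^{(k)}_{-s}z^{-s}\Big)\exp\Big(-\sum A_sq_i^{-s/4}a^{(k)}_{-s}z^s\Big),$$ $$K_k^+(z)=\exp\Big(-\sum B_sq_i^{-s/4}b^{(k)}_{s}z^{s}\Big)\exp\Big(\sum A_sq_i^{s/4}a^{(k)}_{s}z^{-s}\Big),$$ $$\eta_k(z)=\exp\Big(\sum \tfrac{B_sq_i^{s/4}b^{(k)}_{-s}z^{-s}}{q_i^{s/2}-q_i^{-s/2}}\Big)\exp\Big(\sum \tfrac{A_sq_i^{-s/4}a^{(k)}_{-s}z^{s}}{q_i^{s/2}-q_i^{-s/2}}\Big)\exp\Big(\sum \tfrac{B_sq_i^{-s/4}b^{(k)}_{s}z^{s}}{q_i^{-s}-1}\Big)\exp\Big(-\sum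 \tfrac{A_sq_i^{s/4}a^{(k)}_{s}z^{-s}}{q_i^{s}-1}\Big).$$ *Decoupled vertex operators.* Let $C_k=q_{c_k}^{1/2}$, $C=C_1\cdots C_n$, and $$\Lambda_j(z)=u_j\prod_{k<j}\varphi_k(C_1\cdots C_kz)\cdot\eta_j(C_1\cdots C_{j-1}z).$$ Write $K^-(z)=\prod_kK^-_k\big((C_{k+1}\cdots C_n)^{-1}z\big)=\exp(-\sum\tilde b_{-s}z^s)\exp(\sum\tilde b'_{-s}z^{-s})$ and $K^+(z)=\prod_kK_k^+\big((C_1\cdots C_{k-1})^{-1}z\big)=\exp(\sum\tilde b_sC^sz^{-s})\exp(-\sum\tilde b'_sC^{-s}z^s)$, where $\tilde b_{\pm s}$ is a combination of the $a^{(k)}_{\pm s}$ and $\tilde b'_{\pm s}$ one of the $b^{(k)}_{\pm s}$. Then $\widetilde\Lambda_j(z;p):=\alpha(z)\Lambda_j(z)\beta(z)$ with $$\alpha(z)=\exp\Big(-\sum\tfrac{\tilde b_{-s}z^s+\tilde b'_{-s}z^{-s}}{C^s-C^{-s}}\Big),\qquad \beta(z)=\exp\Big(\sum\tfrac{\tilde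 b_{s}z^{-s}+\tilde b'_{s}z^{s}}{C^s-C^{-s}}\Big).$$ *Currents.* With $q_3^{D_z}g(z)=g(q_3z)$, with $:\ :$ the normal ordering (creation operators to the left of annihilation operators), and with $$R_i(z)=\sum_{k\ge0}(-1)^kq_3^{k^2/2}q_{c_i}^{-k/2}\prod_{j=0}^{k-1}\frac{\theta_p(q_3^{j+1-k}q_{c_i})}{\theta_p(q_3^{j+1})}:\widetilde\Lambda_i(z)\widetilde\Lambda_i(q_3^{-1}z)\cdots\widetilde\Lambda_i(q_3^{-(k-1)}z):q_3^{-kD_z},$$ the currents $\widetilde T_m(z;p)$ of the decoupled elliptic corner VOA are defined by $:R_1(z)\cdots R_n(z):\,=\sum_{m\ge0}(-1)^m\widetilde T_m(z;p)q_3^{-mD_z}$. *Structure functions.* For $r\le m$ put $$F_k=(q_3^{rk/2}-q_3^{-rk/2})(q_{\vec c}^{k/2}q_3^{-mk/2}-q_{\vec c}^{-k/2}q_3^{mk/2})\frac{(q_1^{k/2}-q_1^{-k/2})(q_2^{k/2}-q_2^{-k/2})}{(q_{\vec c}^{k/2}-q_{\vec c}^{-k/2})(q_3^{k/2}-q_3^{-k/2})},$$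 $$f_{m,r}(x;p)=f_{r,m}(x;p)=\exp\Big(\sum_{k\ge1}\frac{x^k}{k}\frac{F_k}{1-p^k}\Big)\exp\Big(\sum_{k\ge1}\frac{x^{-k}}{k}\frac{p^kF_k}{1-p^k}\Big).$$ *Meaning of the product.* A product $f_{m,r}(x;p)\,\widetilde T_m(w;p)\widetilde T_r(z;p)$ is understood through its matrix elements between a vector of $\mathcal H$ and the dual of a monomial in the creation operators, by analytic continuation: insert $t^k$ into the terms with $x^{\pm k}$ in the exponents of $f_{m,r}$, and $t^N$ between the two currents on the intermediate states of total level $N$ (each $a^{(k)}_{-s}$ and $b^{(k)}_{-s}$ having level $s$). This gives a power series in $t$ with well-defined coefficients; the matrix element is the value at $t=1$ of its meromorphic continuation to $t\in\mathbb C$ (which is the plain sum where the series converges in a disc of radius greater than $1$). *Claim.* Let $1\le r\le m$, suppose $\theta_p(q_3^k)\ne0$ for $1\le k\le m+r$, and let $z\in\mathbb C\setminus\{0\}$. Then all matrix elements of $f_{m,r}\big(q_3^{\frac{m-r}2}\frac zw;p\big)\widetilde T_m(w;p)\widetilde T_r(z;p)$ are defined for all $w\ne q_3^{-r}z$ close to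 $q_3^{-r}z$ (how close may depend on the matrix element), and, for matrix elements, $$\lim_{w\to q_3^{-r}z}\theta_p\Big(q_3^{-r}\frac zw\Big)f_{m,r}\Big(q_3^{\frac{m-r}2}\frac zw;p\Big)\widetilde T_m(w;p)\widetilde T_r(z;p)=\frac{\theta_p(q_1^{-1})\theta_p(q_2^{-1})}{\theta_p(q_3)}\prod_{\ell=1}^{r-1}\frac{\theta_p(q_2q_3^{-\ell})\theta_p(q_1q_3^{-\ell})}{\theta_p(q_3^{-\ell-1})\theta_p(q_3^{-\ell})}\;\widetilde T_{m+r}(z;p).$$ -/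

import Mathlib

open scoped Topology

noncomputable section

namespace EllipticCorner

/-! ## Scalars

The parameters `q₁, q₂, q₃` are given through logarithms `ε 0, ε 1, ε 2`, so that all the complex
powers `q_i ^ s = exp (s ε_i)` occurring below are taken with one coherent branch. The colours
`1, 2, 3` are represented by the elements `0, 1, 2` of `Fin 3`. -/

/-- `q_i ^ s`. -/
def qPow (ε : Fin 3 → ℂ) (i : Fin 3) (s : ℂ) : ℂ := Complex.exp (s * ε i)

/-- `q_c ^ s` for `q_c = q_{c_1} ⋯ q_{c_n}`. -/
def qTot (ε : Fin 3 → ℂ) {n : ℕ} (c : Fin n → Fin 3) (s : ℂ) : ℂ := ∏ k, qPow ε (c k) s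

/-- `(x ; p)_∞ = ∏_{k ≥ 0} (1 - p^k x)`. -/
def qPoch (p x : ℂ) : ℂ := ∏' k : ℕ, (1 - p ^ k * x)

/-- `θ_p(x) = (x ; p)_∞ (p x⁻¹ ; p)_∞`. -/
def theta (p x : ℂ) : ℂ := qPoch p x * qPoch p (p * x⁻¹)

/-- `Θ(x ; q, p)_k` for `k ≥ 0`, the ratio `Γ(q^k x ; q, p) / Γ(x ; q, p)` of elliptic gamma
functions. -/
def thetaFactorial (p q x : ℂ) (k : ℕ) : ℂ := ∏ j ∈ Finset.range k, theta p (q ^ j * x)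

/-- `κ_r = (q₁^r - 1)(q₂^r - 1)(q₃^r - 1)`. -/
def kappa (ε : Fin 3 → ℂ) (r : ℕ+) : ℂ := ∏ i, (qPow ε i r - 1)

/-! ## The Fock space

The Fock space `H^{(c_1)} ⊗ ⋯ ⊗ H^{(c_n)}` is the polynomial ring in the creation operators
`a^{(k)}_{-r}`, `b^{(k)}_{-r}` (`1 ≤ k ≤ n`, `r ≥ 1`), the vacuum being `1`. -/

/-- Labels of the oscillators: `inl (k, r)` stands for the pair `a^{(k)}_{-r}, a^{(k)}_{r}` and
`inr (k, r)` for the pair `b^{(k)}_{-r}, b^{(k)}_{r}`, acting on the `k`-th tensor factor. -/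
abbrev Osc (n : ℕ) : Type := (Fin n × ℕ+) ⊕ (Fin n × ℕ+)

/-- The mode number `r` of an oscillator. -/
def Osc.level {n : ℕ} : Osc n → ℕ := Sum.elim (fun x => (x.2 : ℕ)) (fun x => (x.2 : ℕ))

/-- The Fock space. -/
abbrev Fock (n : ℕ) : Type := MvPolynomial (Osc n) ℂ

/-- The completion of the Fock space with respect to its grading by the total level. -/
abbrev FockHat (n : ℕ) : Type := MvPowerSeries (Osc n) ℂ

/-- The total level of a monomial in the creation operators. -/
def level {n : ℕ} (ν : Osc n →₀ ℕ) : ℕ := ν.sum fun o k => k * o.level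

/-- The commutators `[a^{(k)}_r, a^{(k)}_{-r}]` and `[b^{(k)}_r, b^{(k)}_{-r}]`, `r ≥ 1`, of the
elliptic Heisenberg algebra of colour `c_k`. -/
def comm (ε : Fin 3 → ℂ) (p : ℂ) {n : ℕ} (c : Fin n → Fin 3) : Osc n → ℂ
  | Sum.inl (k, r) =>
      r / kappa ε r * (qPow ε (c k) (r / 2) - qPow ε (c k) (-(r / 2))) * (1 - p ^ (r : ℕ))
  | Sum.inr (k, r) =>
      r / kappa ε r * (qPow ε (c k) (r / 2) - qPow ε (c k) (-(r / 2)))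
        * ((1 - p ^ (r : ℕ)) / p ^ (r : ℕ))

/-- The creation operator (`a^{(k)}_{-r}` or `b^{(k)}_{-r}`) labelled by `o`. -/
def creation {n : ℕ} (o : Osc n) : Fock n →ₗ[ℂ] Fock n :=
  LinearMap.mulLeft ℂ (MvPolynomial.X o)

/-- The annihilation operator (`a^{(k)}_r` or `b^{(k)}_r`) labelled by `o`. -/
def annihilation (ε : Fin 3 → ℂ) (p : ℂ) {n : ℕ} (c : Fin n → Fin 3) (o : Osc n) :
    Fock n →ₗ[ℂ] Fock n :=
  comm ε p c o • (MvPolynomial.pderiv o).toLinearMap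

/-- The Heisenberg relations. -/
theorem annihilation_creation (ε : Fin 3 → ℂ) (p : ℂ) {n : ℕ} (c : Fin n → Fin 3)
    (o o' : Osc n) (P : Fock n) :
    annihilation ε p c o (creation o' P) - creation o' (annihilation ε p c o P) =
      (if o = o' then comm ε p c o else 0) • P := by
  classical
  simp only [annihilation, creation, LinearMap.smul_apply, LinearMap.mulLeft_apply,
    Derivation.coeFn_coe, Derivation.leibniz, MvPolynomial.pderiv_X, Pi.single_apply, smul_eq_mul]
  rcases eq_or_ne o o' with h | h
  · subst h
    simp
  · simp [h, h.symm]

/-- `exp (∑_o x_o o_-)` applied to the vacuum, where `o_-` are the creation operators. -/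
def expCreation {n : ℕ} (x : Osc n → ℂ) : FockHat n :=
  fun μ => μ.prod fun o k => x o ^ k / (k.factorial : ℂ)

/-- The translation `P(X) ↦ P(X + d)`. By Taylor's formula it is the exponential of the derivation
`∑_o d_o ∂/∂X_o` of the polynomial ring, see `shift_eq_exp`. -/
def shift {n : ℕ} (d : Osc n → ℂ) : Fock n →ₐ[ℂ] Fock n :=
  MvPolynomial.aeval fun o => MvPolynomial.X o + MvPolynomial.C (d o)

theorem shift_eq_exp {n : ℕ} (d : Osc n → ℂ) (P : Fock n) :
    ∃ M₀ : ℕ, ∀ M, M₀ ≤ M → shift d P = ∑ N ∈ Finset.range M, ((N.factorial : ℂ)⁻¹) •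
      ((MvPolynomial.mkDerivation ℂ fun o => MvPolynomial.C (d o) :
        Derivation ℂ (Fock n) (Fock n)) : Fock n → Fock n)^[N] P := by
  set D : Derivation ℂ (Fock n) (Fock n) :=
    MvPolynomial.mkDerivation ℂ fun o => MvPolynomial.C (d o) with hD
  have hz : ∀ N, (D : Fock n → Fock n)^[N] 0 = 0 := fun N =>
    Function.iterate_fixed (map_zero D) N
  have hadd : ∀ N (P Q : Fock n), (D : Fock n → Fock n)^[N] (P + Q)
      = (D : Fock n → Fock n)^[N] P + (D : Fock n → Fock n)^[N] Q := fun N P Q =>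
    Function.Semiconj₂.iterate (map_add D) N P Q
  induction P using MvPolynomial.induction_on with
  | C a =>
    refine ⟨1, fun M hM => ?_⟩
    obtain ⟨M, rfl⟩ := Nat.exists_eq_add_of_le' hM
    have hDa : D (MvPolynomial.C a) = 0 := by
      simp [hD]
    rw [Finset.sum_range_succ']
    simp [shift, Function.iterate_succ_apply, hDa, hz]
  | add P Q hP hQ =>
    obtain ⟨A, hA⟩ := hP
    obtain ⟨B, hB⟩ := hQ
    refine ⟨max A B, fun M hM => ?_⟩
    rw [map_add, hA M (le_trans (le_max_left _ _) hM), hB M (le_trans (le_max_right _ _) hM),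
      ← Finset.sum_add_distrib]
    exact Finset.sum_congr rfl fun N _ => by rw [hadd, smul_add]
  | mul_X P o hP =>
    obtain ⟨A, hA⟩ := hP
    have key : ∀ N, (D : Fock n → Fock n)^[N + 1] (P * MvPolynomial.X o)
        = (D : Fock n → Fock n)^[N + 1] P * MvPolynomial.X o
          + ((N + 1 : ℕ) : ℂ) • ((D : Fock n → Fock n)^[N] P * MvPolynomial.C (d o)) := by
      have hX : D (MvPolynomial.X o) = MvPolynomial.C (d o) := by simp [hD]
      have hC : D (MvPolynomial.C (d o)) = 0 := by simp [hD]
      intro N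
      induction N with
      | zero =>
        simp only [zero_add, Function.iterate_one, Function.iterate_zero, id, D.leibniz, hX,
          smul_eq_mul, Nat.cast_one, one_smul]
        ring
      | succ N ih =>
        rw [Function.iterate_succ_apply', ih, map_add, D.leibniz, D.map_smul, D.leibniz, hX, hC,
          Function.iterate_succ_apply' (D : Fock n → Fock n) (N + 1),
          Function.iterate_succ_apply' (D : Fock n → Fock n) N]
        simp only [smul_eq_mul, Algebra.smul_def, mul_zero, zero_add]
        push_cast
        ring
    refine ⟨A + 1, fun M hM => ?_⟩
    obtain ⟨M, rfl⟩ : ∃ M', M = M' + 1 := ⟨M - 1, by omega⟩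
    have h1 := hA (M + 1) (by omega)
    have h2 := hA M (by omega)
    rw [Finset.sum_range_succ'] at h1
    rw [Finset.sum_range_succ', map_mul]
    have e1 : shift d (MvPolynomial.X o) = MvPolynomial.X o + MvPolynomial.C (d o) := by
      simp [shift]
    rw [e1, mul_add]
    nth_rewrite 1 [h1]
    rw [h2, add_mul, Finset.sum_mul, Finset.sum_mul]
    simp only [key, smul_add, Finset.sum_add_distrib, Function.iterate_zero, id]
    have e2 : ∀ N : ℕ, (((N + 1).factorial : ℂ)⁻¹) • (((N + 1 : ℕ) : ℂ) •
        ((D : Fock n → Fock n)^[N] P * MvPolynomial.C (d o)))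
        = ((N.factorial : ℂ)⁻¹ • (D : Fock n → Fock n)^[N] P) * MvPolynomial.C (d o) := by
      intro N
      rw [smul_smul, smul_mul_assoc]
      congr 1
      rw [Nat.factorial_succ]
      push_cast
      have : (N : ℂ) + 1 ≠ 0 := by exact_mod_cast Nat.succ_ne_zero N
      have : (N.factorial : ℂ) ≠ 0 := by exact_mod_cast N.factorial_ne_zero
      field_simp
    simp only [e2, smul_mul_assoc]
    abel

/-! ## Normally ordered exponentials

A pair `(x, y)` stands for the normally ordered exponential
`exp (∑_o x_o o_-) exp (∑_o y_o o_+)`, with `o_-`, `o_+` the creation and annihilation operators.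
Normally ordered products of such exponentials add the exponents. Hence the finite linear
combinations of normally ordered exponentials, multiplied with the *normally ordered* product,
form the monoid algebra `NOrd`. -/

/-- Exponents of normally ordered exponentials. -/
abbrev VSym (n : ℕ) : Type := (Osc n → ℂ) × (Osc n → ℂ)

/-- Finite linear combinations of normally ordered exponentials, with the normally ordered product
as multiplication. -/
abbrev NOrd (n : ℕ) : Type := AddMonoidAlgebra ℂ (VSym n)

/-- The action of `exp (∑_o x_o o_-) exp (∑_o y_o o_+)` on the Fock space. -/
def vertexOp (ε : Fin 3 → ℂ) (p : ℂ) {n : ℕ} (c : Fin n → Fin 3) (s : VSym n) (P : Fock n) :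
    FockHat n :=
  expCreation s.1 * ((shift (fun o => s.2 o * comm ε p c o) P : Fock n) : FockHat n)

/-- The operator on the Fock space defined by a combination of normally ordered exponentials. -/
def act (ε : Fin 3 → ℂ) (p : ℂ) {n : ℕ} (c : Fin n → Fin 3) (F : NOrd n) (P : Fock n) :
    FockHat n :=
  F.coeff.sum fun s x => x • vertexOp ε p c s P

/-! ## Horizontal Fock representations

The coefficients of the oscillators in the exponents of `φ^-`, `K^+` and `η`, for one tensor
factor of colour `i`. By definition `K^-(z)` is represented by `φ^-(z)`. -/

/-- `κ_r / (r (1 - p^r))`. -/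
def aNorm (ε : Fin 3 → ℂ) (p : ℂ) (r : ℕ+) : ℂ := 1 / (1 - p ^ (r : ℕ)) * (kappa ε r / r)

/-- `p^r κ_r / (r (1 - p^r))`. -/
def bNorm (ε : Fin 3 → ℂ) (p : ℂ) (r : ℕ+) : ℂ :=
  p ^ (r : ℕ) / (1 - p ^ (r : ℕ)) * (kappa ε r / r)

/-- Coefficient of `a_{-r}` in the exponent of `φ^-(z)` (that is, of `K^-(z)`). -/
def phiA (ε : Fin 3 → ℂ) (p : ℂ) (i : Fin 3) (z : ℂ) (r : ℕ+) : ℂ :=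
  -(aNorm ε p r * qPow ε i (-(r / 4)) * z ^ (r : ℕ))

/-- Coefficient of `b_{-r}` in the exponent of `φ^-(z)` (that is, of `K^-(z)`). -/
def phiB (ε : Fin 3 → ℂ) (p : ℂ) (i : Fin 3) (z : ℂ) (r : ℕ+) : ℂ :=
  bNorm ε p r * qPow ε i (r / 4) * z⁻¹ ^ (r : ℕ)

/-- Coefficient of `a_r` in the exponent of `K^+(z)`. -/
def kPlusA (ε : Fin 3 → ℂ) (p : ℂ) (i : Fin 3) (z : ℂ) (r : ℕ+) : ℂ :=
  aNorm ε p r * qPow ε i (r / 4) * z⁻¹ ^ (r : ℕ)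

/-- Coefficient of `b_r` in the exponent of `K^+(z)`. -/
def kPlusB (ε : Fin 3 → ℂ) (p : ℂ) (i : Fin 3) (z : ℂ) (r : ℕ+) : ℂ :=
  -(bNorm ε p r * qPow ε i (-(r / 4)) * z ^ (r : ℕ))

/-- Coefficient of `a_{-r}` in the exponent of `η(z)`. -/
def etaCreA (ε : Fin 3 → ℂ) (p : ℂ) (i : Fin 3) (z : ℂ) (r : ℕ+) : ℂ :=
  aNorm ε p r * (qPow ε i (-(r / 4)) / (qPow ε i (r / 2) - qPow ε i (-(r / 2)))) * z ^ (r : ℕ)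

/-- Coefficient of `b_{-r}` in the exponent of `η(z)`. -/
def etaCreB (ε : Fin 3 → ℂ) (p : ℂ) (i : Fin 3) (z : ℂ) (r : ℕ+) : ℂ :=
  bNorm ε p r * (qPow ε i (r / 4) / (qPow ε i (r / 2) - qPow ε i (-(r / 2)))) * z⁻¹ ^ (r : ℕ)

/-- Coefficient of `a_r` in the exponent of `η(z)`. -/
def etaAnnA (ε : Fin 3 → ℂ) (p : ℂ) (i : Fin 3) (z : ℂ) (r : ℕ+) : ℂ :=
  -(aNorm ε p r * (qPow ε i (r / 4) / (qPow ε i r - 1)) * z⁻¹ ^ (r : ℕ))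

/-- Coefficient of `b_r` in the exponent of `η(z)`. -/
def etaAnnB (ε : Fin 3 → ℂ) (p : ℂ) (i : Fin 3) (z : ℂ) (r : ℕ+) : ℂ :=
  bNorm ε p r * (qPow ε i (-(r / 4)) / (qPow ε i (-r) - 1)) * z ^ (r : ℕ)

/-! ## Vertex operators on the tensor product

On the `k`-th tensor factor the central element `C` acts by `q_{c_k}^{1/2}`. -/

/-- `C_1 ⋯ C_{k-1}`. -/
def cBefore (ε : Fin 3 → ℂ) {n : ℕ} (c : Fin n → Fin 3) (k : Fin n) : ℂ :=
  ∏ j ∈ Finset.univ.filter (fun j => j < k), qPow ε (c j) (1 / 2)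

/-- `C_{k+1} ⋯ C_n`. -/
def cAfter (ε : Fin 3 → ℂ) {n : ℕ} (c : Fin n → Fin 3) (k : Fin n) : ℂ :=
  ∏ j ∈ Finset.univ.filter (fun j => k < j), qPow ε (c j) (1 / 2)

/-- `Λ_j(z)`, up to the scalar `u_j`:
`φ^-(C_1 z) ⊗ ⋯ ⊗ φ^-(C_1 ⋯ C_{j-1} z) ⊗ η(C_1 ⋯ C_{j-1} z) ⊗ 1 ⊗ ⋯ ⊗ 1`. -/
def lambdaSym (ε : Fin 3 → ℂ) (p : ℂ) {n : ℕ} (c : Fin n → Fin 3) (j : Fin n) (z : ℂ) :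
    VSym n :=
  (Sum.elim
    (fun x =>
      if x.1 < j then phiA ε p (c x.1) (cBefore ε c x.1 * qPow ε (c x.1) (1 / 2) * z) x.2
      else if x.1 = j then etaCreA ε p (c j) (cBefore ε c j * z) x.2
      else 0)
    (fun x =>
      if x.1 < j then phiB ε p (c x.1) (cBefore ε c x.1 * qPow ε (c x.1) (1 / 2) * z) x.2
      else if x.1 = j then etaCreB ε p (c j) (cBefore ε c j * z) x.2
      else 0),
   Sum.elim
    (fun x => if x.1 = j then etaAnnA ε p (c j) (cBefore ε c j * z) x.2 else 0)
    (fun x => if x.1 = j then etaAnnB ε p (c j) (cBefore ε c j * z) x.2 else 0))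

/-- `α(z) = exp (-∑ b̃_{-r} z^r / (C^r - C^{-r})) exp (-∑ b̃'_{-r} z^{-r} / (C^r - C^{-r}))`, where
`K^-(z) = exp (-∑ b̃_{-r} z^r) exp (∑ b̃'_{-r} z^{-r})`, and `K^-(z)` is represented by
`⊗_k K^-((C_{k+1} ⋯ C_n)⁻¹ z)`. -/
def alphaSym (ε : Fin 3 → ℂ) (p : ℂ) {n : ℕ} (c : Fin n → Fin 3) (z : ℂ) : VSym n :=
  (Sum.elim
    (fun x => phiA ε p (c x.1) ((cAfter ε c x.1)⁻¹ * z) x.2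
      / (qTot ε c (x.2 / 2) - qTot ε c (-(x.2 / 2))))
    (fun x => -(phiB ε p (c x.1) ((cAfter ε c x.1)⁻¹ * z) x.2
      / (qTot ε c (x.2 / 2) - qTot ε c (-(x.2 / 2))))),
   0)

/-- `β(z) = exp (∑ b̃_r z^{-r} / (C^r - C^{-r})) exp (∑ b̃'_r z^r / (C^r - C^{-r}))`, where
`K^+(z) = exp (∑ b̃_r C^r z^{-r}) exp (-∑ b̃'_r C^{-r} z^r)`, and `K^+(z)` is represented by
`⊗_k K^+((C_1 ⋯ C_{k-1})⁻¹ z)`. -/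
def betaSym (ε : Fin 3 → ℂ) (p : ℂ) {n : ℕ} (c : Fin n → Fin 3) (z : ℂ) : VSym n :=
  (0,
   Sum.elim
    (fun x => qTot ε c (-(x.2 / 2)) * kPlusA ε p (c x.1) ((cBefore ε c x.1)⁻¹ * z) x.2
      / (qTot ε c (x.2 / 2) - qTot ε c (-(x.2 / 2))))
    (fun x => -(qTot ε c (x.2 / 2) * kPlusB ε p (c x.1) ((cBefore ε c x.1)⁻¹ * z) x.2
      / (qTot ε c (x.2 / 2) - qTot ε c (-(x.2 / 2))))))

/-- The decoupled elliptic vertex operator `Λ̃_j(z) = α(z) Λ_j(z) β(z)`. As `α` contains only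
creation operators and `β` only annihilation operators, this product is normally ordered. -/
def lambdaTilde (ε : Fin 3 → ℂ) (p : ℂ) {n : ℕ} (c : Fin n → Fin 3) (u : Fin n → ℂ) (j : Fin n)
    (z : ℂ) : NOrd n :=
  AddMonoidAlgebra.single (alphaSym ε p c z) 1 *
    AddMonoidAlgebra.single (lambdaSym ε p c j z) (u j) *
      AddMonoidAlgebra.single (betaSym ε p c z) 1

/-! ## The Miura transformation -/

/-- A normally ordered `q₃`-difference operator `∑_{k ≥ 0} F_k(z) q₃^{-k D_z}`. -/
abbrev DiffOp (n : ℕ) : Type := ℕ → ℂ → NOrd n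

/-- The normally ordered product of difference operators, where `q₃^{D_z} g(z) = g(q₃ z)`. -/
def DiffOp.comp (ε : Fin 3 → ℂ) {n : ℕ} (F G : DiffOp n) : DiffOp n := fun m z =>
  ∑ kl ∈ Finset.HasAntidiagonal.antidiagonal m, F kl.1 z * G kl.2 (qPow ε 2 (-(kl.1 : ℂ)) * z)

/-- The identity operator. -/
def DiffOp.id (n : ℕ) : DiffOp n := fun m _ => if m = 0 then 1 else 0

/-- The Miura factor `R_i(z)` with `Λ̃_i` in place of `Λ_i`. -/
def miuraFactor (ε : Fin 3 → ℂ) (p : ℂ) {n : ℕ} (c : Fin n → Fin 3) (u : Fin n → ℂ) (i : Fin n) :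
    DiffOp n := fun k z =>
  ((-1) ^ k * qPow ε 2 ((k : ℂ) ^ 2 / 2) * qPow ε (c i) (-(k / 2)) *
      (thetaFactorial p (qPow ε 2 1) (qPow ε 2 (1 - k) * qPow ε (c i) 1) k /
        thetaFactorial p (qPow ε 2 1) (qPow ε 2 1) k)) •
    ∏ j ∈ Finset.range k, lambdaTilde ε p c u i (qPow ε 2 (-(j : ℂ)) * z)

/-- `: R_1(z) R_2(z) ⋯ R_n(z) :`. -/
def miura (ε : Fin 3 → ℂ) (p : ℂ) {n : ℕ} (c : Fin n → Fin 3) (u : Fin n → ℂ) : DiffOp n :=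
  (List.ofFn (miuraFactor ε p c u)).foldr (DiffOp.comp ε) (DiffOp.id n)

/-- The current `T̃_m(z)` of the decoupled elliptic corner VOA, defined by
`: R_1(z) ⋯ R_n(z) : = ∑_m (-1)^m T̃_m(z) q₃^{-m D_z}`. -/
def current (ε : Fin 3 → ℂ) (p : ℂ) {n : ℕ} (c : Fin n → Fin 3) (u : Fin n → ℂ) (m : ℕ) (z : ℂ) :
    NOrd n :=
  ((-1 : ℂ) ^ m) • miura ε p c u m z

/-! ## Structure functions and operator products

The product `f_{m,r}(x) T̃_m(w) T̃_r(z)` is, as usual for vertex operators, understood through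
analytic continuation. Its expansion runs over the levels of the oscillators: one inserts
`t ^ N` (`N` the total level) between the two currents, and accordingly `t ^ k` in the `k`-th terms
of the exponents of `f`. This gives a power series in `t` whose coefficients are finite sums, and
the product is the value at `t = 1` of its meromorphic continuation. Wherever the original
expansions converge, this is their plain value (`HasContinuedSum.hasSum`). -/

/-- The exponent coefficients `(q₃^{rk/2} - q₃^{-rk/2})(q_c^{k/2} q₃^{-mk/2} - q_c^{-k/2} q₃^{mk/2})
(q₁^{k/2} - q₁^{-k/2})(q₂^{k/2} - q₂^{-k/2}) / ((q_c^{k/2} - q_c^{-k/2})(q₃^{k/2} - q₃^{-k/2}))`. -/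
def fCoeff (ε : Fin 3 → ℂ) {n : ℕ} (c : Fin n → Fin 3) (r m k : ℕ) : ℂ :=
  (qPow ε 2 (r * k / 2) - qPow ε 2 (-(r * k / 2))) *
    (qTot ε c (k / 2) * qPow ε 2 (-(m * k / 2)) - qTot ε c (-(k / 2)) * qPow ε 2 (m * k / 2)) *
    (((qPow ε 0 (k / 2) - qPow ε 0 (-(k / 2))) * (qPow ε 1 (k / 2) - qPow ε 1 (-(k / 2)))) /
      ((qTot ε c (k / 2) - qTot ε c (-(k / 2))) * (qPow ε 2 (k / 2) - qPow ε 2 (-(k / 2)))))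

/-- The expansion of `f_{m,r}(x ; p) = f_{r,m}(x ; p)` (defined by the same formula with the smaller
index in the first place), with `t ^ k` inserted in the terms `x ^ k` and `x ^ (-k)` of the
exponents. -/
def fSeries (ε : Fin 3 → ℂ) (p : ℂ) {n : ℕ} (c : Fin n → Fin 3) (m r : ℕ) (x : ℂ) :
    PowerSeries ℂ :=
  (PowerSeries.exp ℂ).subst (PowerSeries.mk fun k : ℕ =>
      if k = 0 then 0 else
        x ^ k / k * (1 / (1 - p ^ k)) * fCoeff ε c (min m r) (max m r) k) *
    (PowerSeries.exp ℂ).subst (PowerSeries.mk fun k : ℕ =>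
      if k = 0 then 0 else
        x⁻¹ ^ k / k * (p ^ k / (1 - p ^ k)) * fCoeff ε c (min m r) (max m r) k)

/-- The matrix element of the operator product `F G` between the Fock vector `v` and the dual basis
vector of the monomial `μ`, expanded over the levels of the intermediate states:
`∑_N t^N ⟨μ| F P_N G |v⟩` with `P_N` the projection onto level `N`. -/
def productSeries (ε : Fin 3 → ℂ) (p : ℂ) {n : ℕ} (c : Fin n → Fin 3) (F G : NOrd n)
    (μ : Osc n →₀ ℕ) (v : Fock n) : PowerSeries ℂ :=
  PowerSeries.mk fun N => ∑ᶠ ν ∈ {ν : Osc n →₀ ℕ | level ν = N},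
    MvPowerSeries.coeff μ (act ε p c F (MvPolynomial.monomial ν 1)) *
      MvPowerSeries.coeff ν (act ε p c G v)

/-- `s` is the value at `t = 1` of the meromorphic continuation to the complex plane of the power
series `A` in `t`. -/
def HasContinuedSum (A : PowerSeries ℂ) (s : ℂ) : Prop :=
  ∃ g : ℂ → ℂ, Meromorphic g ∧
    (∀ᶠ t in 𝓝 (0 : ℂ), HasSum (fun N : ℕ => PowerSeries.coeff N A * t ^ N) (g t)) ∧
    AnalyticAt ℂ g 1 ∧ g 1 = s

theorem HasContinuedSum.unique {A : PowerSeries ℂ} {s s' : ℂ} (h : HasContinuedSum A s)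
    (h' : HasContinuedSum A s') : s = s' := by
  obtain ⟨g, hg, hg0, hg1, rfl⟩ := h
  obtain ⟨g', hg', hg0', hg1', rfl⟩ := h'
  have hd : MeromorphicOn (fun t => g t - g' t) Set.univ := fun t _ => (hg t).sub (hg' t)
  have h0 : meromorphicOrderAt (fun t => g t - g' t) 0 = ⊤ := by
    rw [meromorphicOrderAt_eq_top_iff]
    refine Filter.Eventually.filter_mono nhdsWithin_le_nhds ?_
    filter_upwards [hg0, hg0'] with t a b
    rw [a.unique b, sub_self]
  have h1 : meromorphicOrderAt (fun t => g t - g' t) 1 = ⊤ := by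
    by_contra hne
    exact hd.meromorphicOrderAt_ne_top_of_isPreconnected isPreconnected_univ (Set.mem_univ _)
      (Set.mem_univ _) hne h0
  rw [meromorphicOrderAt_eq_top_iff] at h1
  have hc : Filter.Tendsto (fun t => g t - g' t) (𝓝[≠] 1) (𝓝 (g 1 - g' 1)) :=
    ((hg1.sub hg1').continuousAt.tendsto).mono_left nhdsWithin_le_nhds
  have hc0 : Filter.Tendsto (fun t => g t - g' t) (𝓝[≠] 1) (𝓝 0) :=
    tendsto_const_nhds.congr' (h1.mono fun t ht => ht.symm)
  exact sub_eq_zero.mp (tendsto_nhds_unique hc hc0)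

/-- Where the power series converges beyond `t = 1`, the continued value is its plain sum. -/
theorem HasContinuedSum.hasSum {A : PowerSeries ℂ} {s : ℂ} (h : HasContinuedSum A s) {ρ : ℝ}
    (hρ : 1 < ρ) (hA : Summable fun N : ℕ => ‖PowerSeries.coeff N A‖ * ρ ^ N) :
    HasSum (fun N : ℕ => PowerSeries.coeff N A) s := by
  obtain ⟨g, hg, hg0, hg1, rfl⟩ := h
  have hρ0 : 0 < ρ := lt_trans one_pos hρ
  have hb : ∀ (N : ℕ) (t : ℂ), t ∈ Metric.ball (0 : ℂ) ρ →
      ‖PowerSeries.coeff N A * t ^ N‖ ≤ ‖PowerSeries.coeff N A‖ * ρ ^ N := by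
    intro N t ht
    rw [norm_mul, norm_pow]
    have : ‖t‖ ≤ ρ := (mem_ball_zero_iff.mp ht).le
    gcongr
  set P : ℂ → ℂ := fun t => ∑' N : ℕ, PowerSeries.coeff N A * t ^ N with hP
  have hPd : DifferentiableOn ℂ P (Metric.ball 0 ρ) :=
    Complex.differentiableOn_tsum_of_summable_norm hA
      (fun N => (by fun_prop : Differentiable ℂ fun t : ℂ =>
        PowerSeries.coeff N A * t ^ N).differentiableOn) Metric.isOpen_ball hb
  have hPa : ∀ t ∈ Metric.ball (0 : ℂ) ρ, AnalyticAt ℂ P t := fun t ht =>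
    hPd.analyticAt (Metric.isOpen_ball.mem_nhds ht)
  have h1mem : (1 : ℂ) ∈ Metric.ball (0 : ℂ) ρ := by simpa using hρ
  have h0mem : (0 : ℂ) ∈ Metric.ball (0 : ℂ) ρ := by simpa using hρ0
  have hd : MeromorphicOn (fun t => g t - P t) (Metric.ball 0 ρ) := fun t ht =>
    (hg t).sub (hPa t ht).meromorphicAt
  have h0 : meromorphicOrderAt (fun t => g t - P t) 0 = ⊤ := by
    rw [meromorphicOrderAt_eq_top_iff]
    refine Filter.Eventually.filter_mono nhdsWithin_le_nhds ?_
    filter_upwards [hg0] with t a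
    simp only [hP]
    rw [a.tsum_eq, sub_self]
  have h1 : meromorphicOrderAt (fun t => g t - P t) 1 = ⊤ := by
    by_contra hne
    exact hd.meromorphicOrderAt_ne_top_of_isPreconnected
      (convex_ball (0 : ℂ) ρ).isPreconnected h1mem h0mem hne h0
  rw [meromorphicOrderAt_eq_top_iff] at h1
  have hc : Filter.Tendsto (fun t => g t - P t) (𝓝[≠] 1) (𝓝 (g 1 - P 1)) :=
    ((hg1.sub (hPa 1 h1mem)).continuousAt.tendsto).mono_left nhdsWithin_le_nhds
  have hc0 : Filter.Tendsto (fun t => g t - P t) (𝓝[≠] 1) (𝓝 0) :=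
    tendsto_const_nhds.congr' (h1.mono fun t ht => ht.symm)
  have he : g 1 = P 1 := sub_eq_zero.mp (tendsto_nhds_unique hc hc0)
  have hs : Summable fun N : ℕ => PowerSeries.coeff N A := by
    refine Summable.of_norm_bounded hA fun N => ?_
    simpa using hb N 1 h1mem
  have := hs.hasSum
  rw [he, hP]
  simpa using this

end EllipticCorner

end

open EllipticCorner

noncomputable section

namespace EllipticCorner

/-! ## Exponentials of formal power series -/

/-- `Z` is the exponential of `S` up to the constant term of `S`, expressed through the
differential equation `Z' = S' Z`. -/
def IsExp (S Z : PowerSeries ℂ) : Prop :=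
  PowerSeries.constantCoeff Z = 1 ∧
    PowerSeries.derivative ℂ Z = PowerSeries.derivative ℂ S * Z

theorem IsExp.one : IsExp 0 1 := by
  constructor <;> simp

theorem IsExp.mul {S S' Z Z' : PowerSeries ℂ} (h : IsExp S Z) (h' : IsExp S' Z') :
    IsExp (S + S') (Z * Z') := by
  refine ⟨by simp [h.1, h'.1], ?_⟩
  rw [Derivation.leibniz, h.2, h'.2, map_add]
  simp only [smul_eq_mul]
  ring

theorem IsExp.prod {ι : Type*} (s : Finset ι) {S Z : ι → PowerSeries ℂ}
    (h : ∀ i ∈ s, IsExp (S i) (Z i)) : IsExp (∑ i ∈ s, S i) (∏ i ∈ s, Z i) := by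
  classical
  induction s using Finset.induction_on with
  | empty => simpa using IsExp.one
  | insert a s ha ih =>
    rw [Finset.sum_insert ha, Finset.prod_insert ha]
    exact (h a (by simp)).mul (ih fun i hi => h i (by simp [hi]))

theorem IsExp.unique {S Z Z' : PowerSeries ℂ} (h : IsExp S Z) (h' : IsExp S Z') : Z = Z' := by
  have h0 : PowerSeries.constantCoeff Z ≠ 0 := by simp [h.1]
  have hZ : Z * Z⁻¹ = 1 := PowerSeries.mul_inv_cancel _ h0
  have h1 : Z' * Z⁻¹ = 1 := by
    apply PowerSeries.derivative.ext
    · rw [Derivation.leibniz, PowerSeries.derivative_inv', h.2, h'.2]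
      simp only [smul_eq_mul]
      rw [Derivation.map_one_eq_zero]
      linear_combination (-(Z' * Z⁻¹ * PowerSeries.derivative ℂ S)) * hZ
    · simp [h.1, h'.1]
  calc Z = Z * (Z' * Z⁻¹) := by rw [h1, mul_one]
    _ = Z' * (Z * Z⁻¹) := by ring
    _ = Z' := by rw [hZ, mul_one]

theorem IsExp.congr {S S' Z : PowerSeries ℂ} (h : IsExp S Z)
    (hS : ∀ N, 1 ≤ N → PowerSeries.coeff N S = PowerSeries.coeff N S') : IsExp S' Z := by
  refine ⟨h.1, ?_⟩
  rw [h.2]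
  congr 1
  ext N
  rw [PowerSeries.coeff_derivative, PowerSeries.coeff_derivative, hS _ (Nat.le_add_left 1 N)]

theorem isExp_subst {S : PowerSeries ℂ} (h : PowerSeries.constantCoeff S = 0) :
    IsExp S ((PowerSeries.exp ℂ).subst S) := by
  have hS : PowerSeries.HasSubst S := PowerSeries.HasSubst.of_constantCoeff_zero' h
  refine ⟨?_, ?_⟩
  · rw [← PowerSeries.coeff_zero_eq_constantCoeff_apply, PowerSeries.coeff_subst' hS,
      finsum_eq_single _ 0]
    · simp
    · intro d hd
      simp [h, hd]
  · rw [PowerSeries.derivative_subst hS, PowerSeries.derivative_exp, mul_comm]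

/-! ## Power series and meromorphic functions -/

/-- The power series `A` converges near `0` to the meromorphic function `g`. -/
def Continues (A : PowerSeries ℂ) (g : ℂ → ℂ) : Prop :=
  Meromorphic g ∧
    ∀ᶠ t in 𝓝 (0 : ℂ), HasSum (fun N : ℕ => PowerSeries.coeff N A * t ^ N) (g t)

theorem Continues.hasContinuedSum {A : PowerSeries ℂ} {g : ℂ → ℂ} (h : Continues A g)
    (h1 : AnalyticAt ℂ g 1) : HasContinuedSum A (g 1) :=
  ⟨g, h.1, h.2, h1, rfl⟩

theorem Continues.add {A B : PowerSeries ℂ} {f g : ℂ → ℂ} (hA : Continues A f)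
    (hB : Continues B g) : Continues (A + B) (fun t => f t + g t) := by
  refine ⟨hA.1.fun_add hB.1, ?_⟩
  filter_upwards [hA.2, hB.2] with t h1 h2
  simpa [add_mul] using h1.add h2

theorem Continues.zero : Continues 0 (fun _ => 0) :=
  ⟨fun _ => MeromorphicAt.const 0 _, by simp [hasSum_zero]⟩

theorem Continues.sum {ι : Type*} (s : Finset ι) {A : ι → PowerSeries ℂ} {g : ι → ℂ → ℂ}
    (h : ∀ i ∈ s, Continues (A i) (g i)) : Continues (∑ i ∈ s, A i) (fun t => ∑ i ∈ s, g i t) := by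
  classical
  induction s using Finset.induction_on with
  | empty => simpa using Continues.zero
  | insert a s ha ih =>
    simp only [Finset.sum_insert ha]
    exact (h a (by simp)).add (ih fun i hi => h i (by simp [hi]))

theorem Continues.mul {A B : PowerSeries ℂ} {f g : ℂ → ℂ} (hA : Continues A f)
    (hB : Continues B g) : Continues (A * B) (fun t => f t * g t) := by
  refine ⟨hA.1.fun_mul hB.1, ?_⟩
  filter_upwards [hA.2, hB.2] with t h1 h2
  have e : (fun N : ℕ => PowerSeries.coeff N (A * B) * t ^ N) = fun N =>
      ∑ kl ∈ Finset.HasAntidiagonal.antidiagonal N, (PowerSeries.coeff kl.1 A * t ^ kl.1) *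
        (PowerSeries.coeff kl.2 B * t ^ kl.2) := by
    funext N
    rw [PowerSeries.coeff_mul, Finset.sum_mul]
    refine Finset.sum_congr rfl fun kl hkl => ?_
    rw [← Finset.HasAntidiagonal.mem_antidiagonal.mp hkl, pow_add]
    ring
  rw [e, ← h1.tsum_eq, ← h2.tsum_eq]
  exact (tsum_mul_tsum_eq_tsum_sum_antidiagonal_of_summable_norm h1.summable.norm
    h2.summable.norm) ▸ (summable_norm_sum_mul_antidiagonal_of_summable_norm h1.summable.norm
    h2.summable.norm).of_norm.hasSum

theorem continues_of_analyticAt {g : ℂ → ℂ} (h : AnalyticAt ℂ g 0) :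
    ∃ A : PowerSeries ℂ,
      ∀ᶠ t in 𝓝 (0 : ℂ), HasSum (fun N : ℕ => PowerSeries.coeff N A * t ^ N) (g t) := by
  obtain ⟨P, hP⟩ := h
  refine ⟨PowerSeries.mk fun N => P.coeff N, ?_⟩
  filter_upwards [hasFPowerSeriesAt_iff.mp hP] with t ht
  simpa [mul_comm] using ht

theorem hasFPowerSeriesAt_of_hasSum {A : PowerSeries ℂ} {g : ℂ → ℂ}
    (h : ∀ᶠ t in 𝓝 (0 : ℂ), HasSum (fun N : ℕ => PowerSeries.coeff N A * t ^ N) (g t)) :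
    HasFPowerSeriesAt g (FormalMultilinearSeries.ofScalars ℂ fun N => PowerSeries.coeff N A) 0 := by
  rw [hasFPowerSeriesAt_iff]
  filter_upwards [h] with t ht
  simpa [FormalMultilinearSeries.coeff_ofScalars, mul_comm] using ht

theorem powerSeries_unique {A B : PowerSeries ℂ} {g : ℂ → ℂ}
    (hA : ∀ᶠ t in 𝓝 (0 : ℂ), HasSum (fun N : ℕ => PowerSeries.coeff N A * t ^ N) (g t))
    (hB : ∀ᶠ t in 𝓝 (0 : ℂ), HasSum (fun N : ℕ => PowerSeries.coeff N B * t ^ N) (g t)) :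
    A = B := by
  have h := (hasFPowerSeriesAt_of_hasSum hA).eq_formalMultilinearSeries
    (hasFPowerSeriesAt_of_hasSum hB)
  ext N
  simpa [FormalMultilinearSeries.coeff_ofScalars] using
    congrArg (fun P : FormalMultilinearSeries ℂ ℂ ℂ => P.coeff N) h

theorem Continues.polynomial (P : Polynomial ℂ) :
    Continues (P : PowerSeries ℂ) (fun t => P.eval t) := by
  refine ⟨fun t => (by fun_prop : Differentiable ℂ fun t => P.eval t).analyticAt t |>.meromorphicAt,
    Filter.Eventually.of_forall fun t => ?_⟩
  simp only [Polynomial.coeff_coe]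
  rw [Polynomial.eval_eq_sum]
  exact hasSum_sum_of_ne_finset_zero fun N hN => by
    rw [Polynomial.notMem_support_iff.mp hN, zero_mul]

theorem Continues.prod {ι : Type*} (s : Finset ι) {A : ι → PowerSeries ℂ} {g : ι → ℂ → ℂ}
    (h : ∀ i ∈ s, Continues (A i) (g i)) : Continues (∏ i ∈ s, A i) (fun t => ∏ i ∈ s, g i t) := by
  classical
  induction s using Finset.induction_on with
  | empty => simpa using Continues.polynomial 1
  | insert a s ha ih =>
    simp only [Finset.prod_insert ha]
    exact (h a (by simp)).mul (ih fun i hi => h i (by simp [hi]))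

/-- Quotients of convergent power series. -/
theorem Continues.div {A B D : PowerSeries ℂ} {f g : ℂ → ℂ} (hA : Continues A f)
    (hD : Continues D g) (hg : AnalyticAt ℂ g 0) (hg0 : g 0 ≠ 0) (h : B * D = A) :
    Continues B (fun t => f t / g t) := by
  obtain ⟨E, hE⟩ := continues_of_analyticAt (hg.inv hg0)
  have hE' : Continues E g⁻¹ := ⟨hD.1.inv, hE⟩
  have h1 : D * E = 1 := by
    refine powerSeries_unique (g := fun _ => 1) ?_ ?_
    · filter_upwards [(hD.mul hE').2, hg.continuousAt.eventually_ne hg0] with t h1 h2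
      simpa [h2] using h1
    · simpa using (Continues.polynomial 1).2
  have h2 : B = A * E := by rw [← h, mul_assoc, h1, mul_one]
  rw [h2]
  simpa [div_eq_mul_inv] using hA.mul hE'

/-! ## The `q`-Pochhammer symbol and the theta function -/

variable {p : ℂ}

theorem qPoch_multipliable (hp : ‖p‖ < 1) (x : ℂ) : Multipliable fun k : ℕ => 1 - p ^ k * x := by
  simp_rw [sub_eq_add_neg]
  refine multipliable_one_add_of_summable ?_
  simp only [norm_neg, norm_mul, norm_pow]
  exact (summable_geometric_of_lt_one (norm_nonneg _) hp).mul_right _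

theorem qPoch_eq (hp : ‖p‖ < 1) (x : ℂ) : qPoch p x = (1 - x) * qPoch p (p * x) := by
  unfold qPoch
  rw [tprod_eq_zero_mul' ?_]
  · simp only [pow_zero, one_mul, pow_succ, mul_assoc]
  · simpa only [pow_succ, mul_assoc] using qPoch_multipliable hp (p * x)

theorem qPoch_zero : qPoch p 0 = 1 := by simp [qPoch]

theorem qPoch_differentiable (hp : ‖p‖ < 1) : Differentiable ℂ (qPoch p) := by
  intro x
  have hU : IsOpen (Metric.ball (0 : ℂ) (‖x‖ + 1)) := Metric.isOpen_ball
  have h := Summable.hasProdLocallyUniformlyOn_nat_one_add (f := fun k y => -(p ^ k * y))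
    (u := fun k => ‖p‖ ^ k * (‖x‖ + 1)) hU
    ((summable_geometric_of_lt_one (norm_nonneg _) hp).mul_right _)
    (Filter.Eventually.of_forall fun k y hy => by
      rw [norm_neg, norm_mul, norm_pow]
      gcongr
      exact (mem_ball_zero_iff.mp hy).le) (fun k => by fun_prop)
  have h2 := h.differentiableOn (.of_forall fun _ ↦ by
    simpa [Finset.prod_fn] using DifferentiableOn.finsetProd (fun _ _ ↦ by fun_prop)) hU
  have h3 := h2.differentiableAt (hU.mem_nhds (by simp : x ∈ _))
  have e : qPoch p = fun y => ∏' k : ℕ, (1 + -(p ^ k * y)) := by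
    funext y
    simp only [qPoch, sub_eq_add_neg]
  rw [e]
  exact h3

theorem qPoch_ne_zero (hp : ‖p‖ < 1) {x : ℂ} (h : ∀ k : ℕ, p ^ k * x ≠ 1) : qPoch p x ≠ 0 := by
  unfold qPoch
  simp_rw [sub_eq_add_neg]
  refine tprod_one_add_ne_zero_of_summable (fun k => ?_) ?_
  · rw [← sub_eq_add_neg]
    exact sub_ne_zero.mpr (h k).symm
  · simp only [norm_neg, norm_mul, norm_pow]
    exact (summable_geometric_of_lt_one (norm_nonneg _) hp).mul_right _

theorem one_sub_pow_ne_zero (hp : ‖p‖ < 1) {N : ℕ} (hN : 1 ≤ N) : 1 - p ^ N ≠ 0 := by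
  intro h
  have h1 : ‖p ^ N‖ = 1 := by rw [← sub_eq_zero.mp h, norm_one]
  rw [norm_pow] at h1
  exact (pow_lt_one₀ (norm_nonneg p) hp (by omega)).ne h1

theorem theta_eq (hp : ‖p‖ < 1) (x : ℂ) :
    theta p x = (1 - x) * (qPoch p (p * x) * qPoch p (p * x⁻¹)) := by
  rw [theta, qPoch_eq hp x, mul_assoc]

theorem theta_one (hp : ‖p‖ < 1) : theta p 1 = 0 := by simp [theta_eq hp]

theorem theta_inv (hp : ‖p‖ < 1) {x : ℂ} (hx : x ≠ 0) : theta p x = -x * theta p x⁻¹ := by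
  rw [theta_eq hp, theta_eq hp, inv_inv]
  field_simp
  ring

theorem theta_continuousAt (hp : ‖p‖ < 1) {x : ℂ} (hx : x ≠ 0) : ContinuousAt (theta p) x := by
  have h := (qPoch_differentiable hp).continuous
  exact h.continuousAt.mul (h.continuousAt.comp (continuousAt_const.mul (continuousAt_inv₀ hx)))

theorem theta_eventually_ne_zero (hp : ‖p‖ < 1) : ∀ᶠ x in 𝓝[≠] (1 : ℂ), theta p x ≠ 0 := by
  have h := (qPoch_differentiable hp).continuous
  have hc : ContinuousAt (fun x : ℂ => qPoch p (p * x) * qPoch p (p * x⁻¹)) 1 :=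
    (h.comp (continuous_const.mul continuous_id)).continuousAt.mul
      (ContinuousAt.comp (g := qPoch p) h.continuousAt
        (continuousAt_const.mul (continuousAt_inv₀ one_ne_zero)))
  have h0 : qPoch p p ≠ 0 := qPoch_ne_zero hp fun k => by
    rw [← pow_succ]
    exact fun hk => one_sub_pow_ne_zero hp (Nat.le_add_left 1 k) (by rw [hk, sub_self])
  have h1 := hc.eventually_ne (by simpa using h0 : _ ≠ (0 : ℂ))
  filter_upwards [self_mem_nhdsWithin, h1.filter_mono nhdsWithin_le_nhds] with x hx hx1
  rw [theta_eq hp]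
  exact mul_ne_zero (sub_ne_zero.mpr fun h => hx h.symm) hx1

/-- The exponent of the power series of `t ↦ (a t ; p)_∞`. -/
def pochLog (p a : ℂ) : PowerSeries ℂ :=
  PowerSeries.mk fun N => -(a ^ N / (N * (1 - p ^ N)))

theorem exists_qPoch_series (hp : ‖p‖ < 1) (a : ℂ) :
    ∃ A : PowerSeries ℂ, IsExp (pochLog p a) A ∧ Continues A (fun t => qPoch p (a * t)) := by
  have hd : Differentiable ℂ fun t => qPoch p (a * t) :=
    (qPoch_differentiable hp).comp (differentiable_id.const_mul a)
  obtain ⟨A, hA⟩ := continues_of_analyticAt (hd.analyticAt 0)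
  have hAc : Continues A (fun t => qPoch p (a * t)) :=
    ⟨fun t => (hd.analyticAt t).meromorphicAt, hA⟩
  set S : PowerSeries ℂ := PowerSeries.mk fun N => if N = 0 then 0 else -(a ^ N / (N * (1 - p ^ N)))
    with hS
  have hY : IsExp S ((PowerSeries.exp ℂ).subst S) := isExp_subst (by simp [hS])
  set Y := (PowerSeries.exp ℂ).subst S
  have hlin : ∀ B : PowerSeries ℂ, ∀ N, PowerSeries.coeff (N + 1)
      ((1 - PowerSeries.C a * PowerSeries.X) * PowerSeries.rescale p B) =
      p ^ (N + 1) * PowerSeries.coeff (N + 1) B - a * (p ^ N * PowerSeries.coeff N B) := by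
    intro B N
    rw [sub_mul, one_mul, mul_assoc, map_sub, PowerSeries.coeff_C_mul, mul_comm PowerSeries.X,
      PowerSeries.coeff_succ_mul_X, PowerSeries.coeff_rescale, PowerSeries.coeff_rescale]
  -- the functional equations
  have hA1 : A = (1 - PowerSeries.C a * PowerSeries.X) * PowerSeries.rescale p A := by
    have hlinC : Continues (1 - PowerSeries.C a * PowerSeries.X) (fun t => 1 - a * t) := by
      have := Continues.polynomial (1 - Polynomial.C a * Polynomial.X)
      simpa using this
    have hresc : Continues (PowerSeries.rescale p A) (fun t => qPoch p (a * (p * t))) := by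
      have hd' : Differentiable ℂ fun t => qPoch p (a * (p * t)) :=
        hd.comp (differentiable_id.const_mul p)
      refine ⟨fun t => (hd'.analyticAt t).meromorphicAt, ?_⟩
      have ht : Filter.Tendsto (fun t : ℂ => p * t) (𝓝 0) (𝓝 0) := by
        simpa using (by fun_prop : Continuous fun t : ℂ => p * t).tendsto 0
      filter_upwards [ht.eventually hA] with t h
      simpa only [PowerSeries.coeff_rescale, mul_pow, mul_assoc, mul_left_comm, mul_comm] using h
    refine powerSeries_unique hA ?_
    filter_upwards [(hlinC.mul hresc).2] with t h
    rw [qPoch_eq hp]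
    convert h using 3
    ring
  have hY1 : Y = (1 - PowerSeries.C a * PowerSeries.X) * PowerSeries.rescale p Y := by
    have h1 : IsExp (PowerSeries.rescale p S) (PowerSeries.rescale p Y) := by
      refine ⟨?_, ?_⟩
      · rw [← PowerSeries.coeff_zero_eq_constantCoeff_apply, PowerSeries.coeff_rescale, pow_zero,
          one_mul, PowerSeries.coeff_zero_eq_constantCoeff_apply, hY.1]
      have hder : ∀ F : PowerSeries ℂ, PowerSeries.derivative ℂ (PowerSeries.rescale p F)
          = PowerSeries.C p * PowerSeries.rescale p (PowerSeries.derivative ℂ F) := by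
        intro F
        ext N
        simp only [PowerSeries.coeff_derivative, PowerSeries.coeff_rescale,
          PowerSeries.coeff_C_mul]
        ring
      rw [hder, hder, hY.2, map_mul, mul_assoc]
    have h2 : IsExp (PowerSeries.mk fun N => -(a ^ N / N))
        (1 - PowerSeries.C a * PowerSeries.X) := by
      refine ⟨by simp, ?_⟩
      have e0 : PowerSeries.derivative ℂ (1 - PowerSeries.C a * PowerSeries.X)
          = PowerSeries.C (-a) := by
        ext N
        rw [PowerSeries.coeff_derivative, map_sub, PowerSeries.coeff_C_mul, PowerSeries.coeff_one,
          PowerSeries.coeff_X, PowerSeries.coeff_C]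
        rcases N with _ | N <;> simp
      have e1 : PowerSeries.derivative ℂ (PowerSeries.mk fun N : ℕ => -(a ^ N / (N : ℂ)))
          = PowerSeries.mk fun N => -a ^ (N + 1) := by
        ext N
        rw [PowerSeries.coeff_derivative, PowerSeries.coeff_mk, PowerSeries.coeff_mk]
        have : (N : ℂ) + 1 ≠ 0 := by exact_mod_cast N.succ_ne_zero
        push_cast
        field_simp
      rw [e0, e1]
      ext N
      rw [mul_sub, mul_one, mul_left_comm, map_sub, PowerSeries.coeff_C_mul]
      rcases N with _ | N
      · simp
      · rw [PowerSeries.coeff_succ_mul_X, PowerSeries.coeff_mk, PowerSeries.coeff_mk,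
          PowerSeries.coeff_C]
        simp
        ring
    refine hY.unique ((h2.mul h1).congr fun N hN => ?_)
    have hN0 : N ≠ 0 := by omega
    have h3 : (N : ℂ) ≠ 0 := by exact_mod_cast hN0
    have h4 := one_sub_pow_ne_zero hp hN
    simp only [hS, map_add, PowerSeries.coeff_mk, PowerSeries.coeff_rescale, hN0, if_false]
    field_simp
    ring
  have hAY : A = Y := by
    have h0 : PowerSeries.coeff 0 A = 1 := by
      have := hA.self_of_nhds
      have h1 := this.unique (hasSum_single 0 fun N hN => by simp [hN])
      simpa [qPoch_zero] using h1.symm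
    have h0' : PowerSeries.coeff 0 Y = 1 := by simpa using hY.1
    ext N
    induction N with
    | zero => rw [h0, h0']
    | succ N ih =>
      have e1 := hlin A N
      have e2 := hlin Y N
      rw [← hA1] at e1
      rw [← hY1] at e2
      have h4 := one_sub_pow_ne_zero hp (Nat.le_add_left 1 N)
      apply mul_left_cancel₀ h4
      rw [ih] at e1
      linear_combination e1 - e2
  refine ⟨A, ?_, hAc⟩
  rw [hAY]
  refine hY.congr fun N hN => ?_
  have hN0 : N ≠ 0 := by omega
  simp only [hS, pochLog, PowerSeries.coeff_mk, hN0, if_false]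

/-- The power series of `t ↦ (a t ; p)_∞`. -/
def pochSeries (hp : ‖p‖ < 1) (a : ℂ) : PowerSeries ℂ := (exists_qPoch_series hp a).choose

/-- The deformation `(y t ; p)_∞ (p y⁻¹ t ; p)_∞` of the theta function. -/
def thetaDef (p y t : ℂ) : ℂ := qPoch p (y * t) * qPoch p (p * y⁻¹ * t)

/-- The power series of `thetaDef`. -/
def thetaSeries (hp : ‖p‖ < 1) (y : ℂ) : PowerSeries ℂ :=
  pochSeries hp y * pochSeries hp (p * y⁻¹)

theorem thetaSeries_isExp (hp : ‖p‖ < 1) (y : ℂ) :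
    IsExp (pochLog p y + pochLog p (p * y⁻¹)) (thetaSeries hp y) :=
  (exists_qPoch_series hp y).choose_spec.1.mul (exists_qPoch_series hp _).choose_spec.1

theorem thetaSeries_continues (hp : ‖p‖ < 1) (y : ℂ) :
    Continues (thetaSeries hp y) (thetaDef p y) :=
  (exists_qPoch_series hp y).choose_spec.2.mul (exists_qPoch_series hp _).choose_spec.2

theorem thetaDef_differentiable (hp : ‖p‖ < 1) (y : ℂ) : Differentiable ℂ (thetaDef p y) :=
  ((qPoch_differentiable hp).comp (differentiable_id.const_mul y)).mul
    ((qPoch_differentiable hp).comp (differentiable_id.const_mul _))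

theorem thetaDef_zero (y : ℂ) : thetaDef p y 0 = 1 := by simp [thetaDef, qPoch_zero]

theorem thetaDef_one (y : ℂ) : thetaDef p y 1 = theta p y := by simp [thetaDef, theta]

end EllipticCorner

end

noncomputable section

namespace EllipticCorner

/-! ## The grading by the level -/

variable {n : ℕ}

theorem Osc.level_pos (o : Osc n) : 0 < o.level := by
  rcases o with ⟨k, s⟩ | ⟨k, s⟩ <;> exact s.pos

theorem level_add (σ τ : Osc n →₀ ℕ) : level (σ + τ) = level σ + level τ :=
  Finsupp.sum_add_index' (by simp) (by intros; ring)

theorem level_single (o : Osc n) (k : ℕ) : level (Finsupp.single o k) = k * o.level := by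
  simp [level]

theorem finite_osc_level_le (N : ℕ) : {o : Osc n | o.level ≤ N}.Finite := by
  let f : (Fin n × Fin (N + 1)) ⊕ (Fin n × Fin (N + 1)) → Osc n :=
    Sum.map (fun x => (x.1, (x.2 : ℕ).succPNat)) (fun x => (x.1, (x.2 : ℕ).succPNat))
  refine (Set.finite_range f).subset ?_
  have key : ∀ s : ℕ+, (s : ℕ) ≤ N → ∃ i : Fin (N + 1), (i : ℕ).succPNat = s := by
    intro s hs
    have := s.pos
    refine ⟨⟨s - 1, by omega⟩, ?_⟩
    apply PNat.eq
    simp only [Nat.succPNat_coe]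
    omega
  rintro (⟨k, s⟩ | ⟨k, s⟩) h
  · obtain ⟨i, hi⟩ := key s h
    exact ⟨Sum.inl (k, i), by simp [f, hi]⟩
  · obtain ⟨i, hi⟩ := key s h
    exact ⟨Sum.inr (k, i), by simp [f, hi]⟩

theorem finite_level (N : ℕ) : {ν : Osc n →₀ ℕ | level ν = N}.Finite := by
  refine ((finite_osc_level_le (n := n) N).toFinset.finsupp
    fun _ => Finset.range (N + 1)).finite_toSet.subset ?_
  intro ν hν
  have hle : ∀ o ∈ ν.support, ν o * o.level ≤ N := fun o ho => by
    rw [← (show level ν = N from hν), level, Finsupp.sum]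
    exact Finset.single_le_sum (f := fun o => ν o * o.level) (fun _ _ => Nat.zero_le _) ho
  rw [Finset.mem_coe, Finset.mem_finsupp_iff]
  refine ⟨fun o ho => ?_, fun o _ => ?_⟩
  · rw [Set.Finite.mem_toFinset]
    have h1 : 1 ≤ ν o := Nat.one_le_iff_ne_zero.mpr (Finsupp.mem_support_iff.mp ho)
    exact le_trans (Nat.le_mul_of_pos_left _ h1) (hle o ho)
  · rw [Finset.mem_range, Nat.lt_succ_iff]
    by_cases ho : o ∈ ν.support
    · exact le_trans (Nat.le_mul_of_pos_right _ o.level_pos) (hle o ho)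
    · simp [Finsupp.notMem_support_iff.mp ho]

/-- The monomials of level `N`. -/
def levelFinset (n N : ℕ) : Finset (Osc n →₀ ℕ) := (finite_level N).toFinset

theorem mem_levelFinset {N : ℕ} {ν : Osc n →₀ ℕ} : ν ∈ levelFinset n N ↔ level ν = N := by
  simp [levelFinset]

/-- The power series with given coefficients. -/
def ofCoeff {R : Type*} [CommRing R] (f : (Osc n →₀ ℕ) → R) : MvPowerSeries (Osc n) R := f

@[simp]
theorem coeff_ofCoeff {R : Type*} [CommRing R] (f : (Osc n →₀ ℕ) → R) (ν : Osc n →₀ ℕ) :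
    MvPowerSeries.coeff ν (ofCoeff f) = f ν := rfl

/-- The specialisation `X_o ↦ t ^ (level o)`. -/
def levelSeries (f : FockHat n) : PowerSeries ℂ :=
  PowerSeries.mk fun N => ∑ᶠ ν ∈ {ν : Osc n →₀ ℕ | level ν = N}, MvPowerSeries.coeff ν f

theorem coeff_levelSeries (f : FockHat n) (N : ℕ) :
    PowerSeries.coeff N (levelSeries f) = ∑ ν ∈ levelFinset n N, MvPowerSeries.coeff ν f := by
  rw [levelSeries, PowerSeries.coeff_mk, finsum_mem_eq_finite_toFinset_sum _ (finite_level N)]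
  rfl

theorem levelSeries_add (f g : FockHat n) :
    levelSeries (f + g) = levelSeries f + levelSeries g := by
  ext N
  simp only [map_add, coeff_levelSeries, ← Finset.sum_add_distrib]

theorem levelSeries_smul (a : ℂ) (f : FockHat n) :
    levelSeries (a • f) = PowerSeries.C a * levelSeries f := by
  ext N
  simp only [PowerSeries.coeff_C_mul, coeff_levelSeries, Finset.mul_sum, map_smul, smul_eq_mul]

theorem levelSeries_mul (f g : FockHat n) :
    levelSeries (f * g) = levelSeries f * levelSeries g := by
  ext N
  rw [PowerSeries.coeff_mul, coeff_levelSeries]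
  simp only [MvPowerSeries.coeff_mul, coeff_levelSeries, Finset.sum_mul_sum,
    ← Finset.sum_product']
  rw [Finset.sum_sigma', Finset.sum_sigma']
  refine Finset.sum_bij' (fun a _ => ⟨(level a.2.1, level a.2.2), a.2⟩)
    (fun a _ => ⟨a.2.1 + a.2.2, a.2⟩) ?_ ?_ ?_ ?_ ?_
  · rintro ⟨ν, σ, τ⟩ h
    simp only [Finset.mem_sigma, mem_levelFinset, Finset.HasAntidiagonal.mem_antidiagonal,
      Finset.mem_product] at h ⊢
    rw [← level_add, h.2, h.1]
    simp
  · rintro ⟨⟨i, j⟩, σ, τ⟩ h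
    simp only [Finset.mem_sigma, mem_levelFinset, Finset.HasAntidiagonal.mem_antidiagonal,
      Finset.mem_product] at h ⊢
    rw [level_add, h.2.1, h.2.2, h.1]
    simp
  · rintro ⟨ν, σ, τ⟩ h
    simp only [Finset.mem_sigma, Finset.HasAntidiagonal.mem_antidiagonal] at h ⊢
    simp [h.2]
  · rintro ⟨⟨i, j⟩, σ, τ⟩ h
    simp only [Finset.mem_sigma, mem_levelFinset, Finset.mem_product] at h ⊢
    simp [h.2.1, h.2.2]
  · rintro ⟨ν, σ, τ⟩ h
    rfl

/-- The Euler operator of the grading. -/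
def euler (f : FockHat n) : FockHat n := ofCoeff fun ν => level ν * MvPowerSeries.coeff ν f

theorem X_mul_derivative_levelSeries (f : FockHat n) :
    PowerSeries.X * PowerSeries.derivative ℂ (levelSeries f) = levelSeries (euler f) := by
  ext N
  rw [coeff_levelSeries]
  have h : ∑ ν ∈ levelFinset n N, MvPowerSeries.coeff ν (euler f)
      = N * ∑ ν ∈ levelFinset n N, MvPowerSeries.coeff ν f := by
    rw [Finset.mul_sum]
    refine Finset.sum_congr rfl fun ν hν => ?_
    rw [euler, coeff_ofCoeff, mem_levelFinset.mp hν]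
  rw [h, mul_comm PowerSeries.X]
  rcases N with _ | N
  · simp
  · rw [PowerSeries.coeff_succ_mul_X, PowerSeries.coeff_derivative, coeff_levelSeries]
    push_cast
    ring

/-! ## Exponentials of linear forms -/

/-- `exp (∑_o x_o X_o)` with coefficients in an algebra. -/
def expGen {R : Type*} [CommRing R] [Algebra ℂ R] (x : Osc n → R) : MvPowerSeries (Osc n) R :=
  ofCoeff fun ν => ν.prod fun o k => ((k.factorial : ℂ)⁻¹) • x o ^ k

theorem expCreation_eq (x : Osc n → ℂ) : expCreation x = expGen x := by
  funext ν
  simp only [expCreation, expGen, smul_eq_mul, div_eq_inv_mul, ofCoeff]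

section expGen

variable {R : Type*} [CommRing R] [Algebra ℂ R]

theorem pderiv_expGen (x : Osc n → R) (o : Osc n) :
    MvPowerSeries.pderiv R o (expGen x) = MvPowerSeries.C (x o) * expGen x := by
  classical
  ext ν
  rw [MvPowerSeries.coeff_pderiv, MvPowerSeries.coeff_C_mul, expGen, coeff_ofCoeff, coeff_ofCoeff]
  rw [Finsupp.prod_of_support_subset (s := insert o ν.support) (ν + Finsupp.single o 1) ?_ _
    (by simp), Finsupp.prod_of_support_subset (s := insert o ν.support) ν
    (Finset.subset_insert _ _) _ (by simp),
    ← Finset.mul_prod_erase _ _ (Finset.mem_insert_self o _),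
    ← Finset.mul_prod_erase (insert o ν.support) (fun i => ((ν i).factorial : ℂ)⁻¹ • x i ^ ν i)
      (Finset.mem_insert_self o _), mul_right_comm, ← mul_assoc]
  · congr 1
    · simp only [Finsupp.add_apply, Finsupp.single_eq_same, Nat.factorial_succ]
      have e : ((ν o : R) + 1) = ((ν o : ℂ) + 1) • (1 : R) := by
        rw [add_smul, one_smul, Nat.cast_smul_eq_nsmul, nsmul_one]
      have h1 : (ν o : ℂ) + 1 ≠ 0 := by exact_mod_cast (ν o).succ_ne_zero
      rw [e, mul_smul_comm, mul_one, smul_smul, mul_smul_comm, pow_succ, mul_comm (x o)]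
      congr 1
      push_cast
      field_simp
    · refine Finset.prod_congr rfl fun i hi => ?_
      have : i ≠ o := Finset.ne_of_mem_erase hi
      simp [this.symm]
  · intro i hi
    rw [Finset.mem_insert, Finsupp.mem_support_iff]
    by_contra! h
    rw [Finsupp.mem_support_iff] at hi
    exact hi (by simp [h.1.symm, h.2])

theorem expGen_unique (x : Osc n → R) {f g : MvPowerSeries (Osc n) R}
    (h0 : MvPowerSeries.coeff 0 f = MvPowerSeries.coeff 0 g)
    (hf : ∀ o, MvPowerSeries.pderiv R o f = MvPowerSeries.C (x o) * f)
    (hg : ∀ o, MvPowerSeries.pderiv R o g = MvPowerSeries.C (x o) * g) :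
    f = g := by
  have hstep : ∀ ν o, MvPowerSeries.coeff ν f = MvPowerSeries.coeff ν g →
      MvPowerSeries.coeff (ν + Finsupp.single o 1) f
        = MvPowerSeries.coeff (ν + Finsupp.single o 1) g := by
    intro ν o h
    have h1 := congrArg (MvPowerSeries.coeff ν) (hf o)
    have h2 := congrArg (MvPowerSeries.coeff ν) (hg o)
    rw [MvPowerSeries.coeff_pderiv, MvPowerSeries.coeff_C_mul] at h1 h2
    rw [h, ← h2] at h1
    have e : ((ν o : R) + 1) = algebraMap ℂ R ((ν o : ℂ) + 1) := by simp
    have h3 : (ν o : ℂ) + 1 ≠ 0 := by exact_mod_cast (ν o).succ_ne_zero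
    have h4 : IsUnit ((ν o : R) + 1) := e ▸ (IsUnit.mk0 _ h3).map (algebraMap ℂ R)
    exact h4.mul_right_cancel h1
  ext ν
  induction ν using Finsupp.induction₂ with
  | zero => exact h0
  | add_single o k ν _ _ ih =>
    clear * - ih hstep
    induction k with
    | zero => simpa using ih
    | succ k ih' =>
      rw [Finsupp.single_add, ← add_assoc]
      exact hstep _ _ ih'

theorem coeff_zero_expGen (x : Osc n → R) : MvPowerSeries.coeff 0 (expGen x) = 1 := by
  simp [expGen]

theorem expGen_add (x y : Osc n → R) : expGen (x + y) = expGen x * expGen y := by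
  refine expGen_unique (x + y) ?_ (pderiv_expGen _) fun o => ?_
  · rw [coeff_zero_expGen, MvPowerSeries.coeff_mul]
    simp [coeff_zero_expGen]
  · rw [Derivation.leibniz, pderiv_expGen, pderiv_expGen, Pi.add_apply, map_add]
    simp only [smul_eq_mul]
    ring

end expGen

/-- The linear form `∑_o y_o X_o`. -/
def linForm (y : Osc n → ℂ) : FockHat n := ofCoeff fun ν =>
  open Classical in ∑ o ∈ ν.support, if ν = Finsupp.single o 1 then y o else 0

theorem coeff_linForm_single (y : Osc n → ℂ) (o : Osc n) :
    MvPowerSeries.coeff (Finsupp.single o 1) (linForm y) = y o := by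
  classical
  rw [linForm, coeff_ofCoeff, Finsupp.support_single _ one_ne_zero, Finset.sum_singleton,
    if_pos rfl]

theorem coeff_linForm_of_ne (y : Osc n → ℂ) {ν : Osc n →₀ ℕ}
    (h : ∀ o, ν ≠ Finsupp.single o 1) : MvPowerSeries.coeff ν (linForm y) = 0 := by
  classical
  rw [linForm, coeff_ofCoeff]
  exact Finset.sum_eq_zero fun o _ => if_neg (h o)

theorem euler_expGen (y : Osc n → ℂ) : euler (expGen y) = euler (linForm y) * expGen y := by
  classical
  ext ν
  rw [euler, coeff_ofCoeff, MvPowerSeries.coeff_mul]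
  have key : ∀ o ∈ ν.support, (ν o : ℂ) * MvPowerSeries.coeff ν (expGen y)
      = y o * MvPowerSeries.coeff (ν - Finsupp.single o 1) (expGen y) := by
    intro o ho
    have h1 := congrArg (MvPowerSeries.coeff (ν - Finsupp.single o 1)) (pderiv_expGen y o)
    have hle : Finsupp.single o 1 ≤ ν := by
      rw [Finsupp.single_le_iff]
      exact Nat.one_le_iff_ne_zero.mpr (Finsupp.mem_support_iff.mp ho)
    rw [MvPowerSeries.coeff_pderiv, MvPowerSeries.coeff_C_mul, tsub_add_cancel_of_le hle] at h1
    rw [← h1, mul_comm]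
    congr 1
    have h2 : 1 ≤ ν o := Nat.one_le_iff_ne_zero.mpr (Finsupp.mem_support_iff.mp ho)
    rw [Finsupp.tsub_apply, Finsupp.single_eq_same, Nat.cast_sub h2]
    simp
  have e : (level ν : ℂ) * MvPowerSeries.coeff ν (expGen y) = ∑ o ∈ ν.support,
      o.level * (y o * MvPowerSeries.coeff (ν - Finsupp.single o 1) (expGen y)) := by
    rw [level, Finsupp.sum, Nat.cast_sum, Finset.sum_mul]
    refine Finset.sum_congr rfl fun o ho => ?_
    rw [← key o ho]
    push_cast
    ring
  rw [e]
  refine Finset.sum_of_injOn (fun o => (Finsupp.single o 1, ν - Finsupp.single o 1)) ?_ ?_ ?_ ?_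
  · intro o _ o' _ h
    simpa [Finsupp.single_left_inj] using congrArg Prod.fst h
  · intro o ho
    have hle : Finsupp.single o 1 ≤ ν := by
      rw [Finsupp.single_le_iff]
      exact Nat.one_le_iff_ne_zero.mpr (Finsupp.mem_support_iff.mp ho)
    simpa using add_tsub_cancel_of_le hle
  · rintro ⟨σ, τ⟩ h h'
    rw [Finset.HasAntidiagonal.mem_antidiagonal] at h
    rw [euler, coeff_ofCoeff, coeff_linForm_of_ne, mul_zero, zero_mul]
    intro o ho
    refine h' ⟨o, ?_, ?_⟩
    · simp only at h ho
      simp [← h, ho]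
    · simp only at h ho
      simp [← h, ho]
  · intro o ho
    simp only [euler, coeff_ofCoeff, coeff_linForm_single, level_single, one_mul]
    ring

theorem isExp_levelSeries (y : Osc n → ℂ) :
    IsExp (levelSeries (linForm y)) (levelSeries (expGen y)) := by
  refine ⟨?_, ?_⟩
  · rw [← PowerSeries.coeff_zero_eq_constantCoeff_apply, coeff_levelSeries]
    have : levelFinset n 0 = {0} := by
      ext ν
      rw [mem_levelFinset, Finset.mem_singleton]
      refine ⟨fun h => ?_, fun h => by simp [h, level]⟩
      ext o
      rw [level, Finsupp.sum, Finset.sum_eq_zero_iff] at h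
      by_contra ho
      have := h o (Finsupp.mem_support_iff.mpr ho)
      exact (Nat.mul_ne_zero ho o.level_pos.ne') this
    rw [this, Finset.sum_singleton, coeff_zero_expGen]
  · apply mul_left_cancel₀ (PowerSeries.X_ne_zero (R := ℂ))
    rw [X_mul_derivative_levelSeries, euler_expGen, levelSeries_mul, ← mul_assoc,
      X_mul_derivative_levelSeries]

theorem coeff_levelSeries_linForm (y : Osc n → ℂ) (N : ℕ+) :
    PowerSeries.coeff N (levelSeries (linForm y))
      = ∑ k : Fin n, y (Sum.inl (k, N)) + ∑ k : Fin n, y (Sum.inr (k, N)) := by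
  classical
  rw [coeff_levelSeries]
  set f : Fin n ⊕ Fin n → Osc n := Sum.map (fun k => (k, N)) (fun k => (k, N)) with hf
  have hfinj : Function.Injective f := by
    rintro (a | a) (b | b) h <;> simp_all
  have hsurj : ∀ o : Osc n, o.level = N → ∃ a, f a = o := by
    rintro (⟨k, s⟩ | ⟨k, s⟩) h
    · exact ⟨Sum.inl k, by simp [hf, ← PNat.eq (show (s : ℕ) = N from h)]⟩
    · exact ⟨Sum.inr k, by simp [hf, ← PNat.eq (show (s : ℕ) = N from h)]⟩
  symm
  have e : ∑ k : Fin n, y (Sum.inl (k, N)) + ∑ k : Fin n, y (Sum.inr (k, N))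
      = ∑ a : Fin n ⊕ Fin n, y (f a) := by
    rw [Fintype.sum_sum_type]
    rfl
  rw [e]
  refine Finset.sum_of_injOn (fun a => Finsupp.single (f a) 1) ?_ ?_ ?_ ?_
  · intro a _ b _ h
    exact hfinj (by simpa [Finsupp.single_left_inj] using h)
  · intro a _
    rw [Finset.mem_coe, mem_levelFinset, level_single, one_mul]
    rcases a with a | a <;> rfl
  · intro ν hν h'
    refine coeff_linForm_of_ne _ fun o ho => h' ?_
    rw [mem_levelFinset, ho, level_single, one_mul] at hν
    obtain ⟨a, ha⟩ := hsurj o hν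
    exact ⟨a, by simp, by simp [ha, ho]⟩
  · intro a _
    rw [coeff_linForm_single]

end EllipticCorner

end

noncomputable section

namespace EllipticCorner

variable {n : ℕ}

/-! ## Products of two normally ordered exponentials -/

theorem coeff_mul_X (F : FockHat n) (o : Osc n) (ν : Osc n →₀ ℕ) :
    MvPowerSeries.coeff ν (F * MvPowerSeries.X o)
      = if Finsupp.single o 1 ≤ ν then MvPowerSeries.coeff (ν - Finsupp.single o 1) F else 0 := by
  rw [MvPowerSeries.X, MvPowerSeries.coeff_mul_monomial]
  simp

theorem levelSeries_mul_X (A : (Osc n →₀ ℕ) → ℂ) (F : FockHat n) (o : Osc n) :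
    levelSeries (ofCoeff fun ν => A ν * MvPowerSeries.coeff ν (F * MvPowerSeries.X o))
      = PowerSeries.X ^ o.level *
        levelSeries (ofCoeff fun ν => A (ν + Finsupp.single o 1) * MvPowerSeries.coeff ν F) := by
  ext N
  rw [PowerSeries.coeff_X_pow_mul', coeff_levelSeries]
  simp only [coeff_ofCoeff]
  split_ifs with hN
  · rw [coeff_levelSeries]
    symm
    refine Finset.sum_of_injOn (fun ν => ν + Finsupp.single o 1) ?_ ?_ ?_ ?_
    · exact fun a _ b _ h => add_right_cancel h
    · intro ν hν
      rw [Finset.mem_coe, mem_levelFinset] at hν ⊢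
      rw [level_add, level_single, hν]
      omega
    · intro ν hν h'
      rw [coeff_mul_X, if_neg, mul_zero]
      intro hle
      refine h' ⟨ν - Finsupp.single o 1, ?_, tsub_add_cancel_of_le hle⟩
      rw [Finset.mem_coe, mem_levelFinset]
      rw [mem_levelFinset] at hν
      have := level_add (ν - Finsupp.single o 1) (Finsupp.single o 1)
      rw [tsub_add_cancel_of_le hle, level_single] at this
      omega
    · intro ν _
      rw [coeff_ofCoeff, coeff_mul_X, if_pos le_add_self, add_tsub_cancel_right]
  · refine Finset.sum_eq_zero fun ν hν => ?_
    rw [coeff_mul_X, if_neg, mul_zero]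
    intro hle
    rw [mem_levelFinset] at hν
    have := level_add (ν - Finsupp.single o 1) (Finsupp.single o 1)
    rw [tsub_add_cancel_of_le hle, level_single] at this
    omega

theorem coeff_expGen_smul_shift (d x' : Osc n → ℂ) (ν : Osc n →₀ ℕ) :
    MvPowerSeries.coeff ν (expGen x') • shift d (MvPolynomial.monomial ν 1)
      = ∑ στ ∈ Finset.HasAntidiagonal.antidiagonal ν,
        MvPowerSeries.coeff στ.2 (expGen (d * x')) •
          MvPolynomial.monomial στ.1 (MvPowerSeries.coeff στ.1 (expGen x')) := by
  have h1 : MvPowerSeries.coeff ν (expGen x') • shift d (MvPolynomial.monomial ν 1)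
      = MvPowerSeries.coeff ν (expGen (R := Fock n) ((fun o => x' o • MvPolynomial.X o) +
          fun o => MvPolynomial.C (d o * x' o))) := by
    rw [expGen, expGen, coeff_ofCoeff, coeff_ofCoeff, shift, MvPolynomial.aeval_monomial]
    simp only [Finsupp.prod, map_one, one_mul, Pi.add_apply, smul_eq_mul]
    rw [MvPolynomial.smul_eq_C_mul, map_prod, ← Finset.prod_mul_distrib]
    refine Finset.prod_congr rfl fun o _ => ?_
    simp only [MvPolynomial.smul_eq_C_mul, map_mul, map_pow]
    rw [mul_assoc, ← mul_pow]
    congr 2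
    ring
  have h2 : ∀ τ, MvPowerSeries.coeff τ (expGen (R := Fock n)
      fun o => MvPolynomial.C (d o * x' o))
      = MvPolynomial.C (MvPowerSeries.coeff τ (expGen (d * x'))) := by
    intro τ
    simp only [expGen, coeff_ofCoeff, Finsupp.prod, map_prod, smul_eq_mul, map_mul, map_pow,
      MvPolynomial.smul_eq_C_mul, Pi.mul_apply]
  have h3 : ∀ σ, MvPowerSeries.coeff σ (expGen (R := Fock n)
      fun o => x' o • MvPolynomial.X o)
      = MvPolynomial.monomial σ (MvPowerSeries.coeff σ (expGen x')) := by
    intro σ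
    rw [MvPolynomial.monomial_eq]
    simp only [expGen, coeff_ofCoeff, Finsupp.prod, map_prod, smul_eq_mul, map_mul, map_pow,
      MvPolynomial.smul_eq_C_mul]
    rw [← Finset.prod_mul_distrib]
    refine Finset.prod_congr rfl fun o _ => ?_
    ring
  rw [h1, expGen_add, MvPowerSeries.coeff_mul]
  refine Finset.sum_congr rfl fun στ _ => ?_
  rw [h2, h3, MvPolynomial.smul_eq_C_mul, mul_comm]

/-- `∑_ν t ^ (level ν) ⟨μ| exp (x) shift_d X^ν ⟩ ⟨ν| f⟩`. -/
def pairing (x d : Osc n → ℂ) (μ : Osc n →₀ ℕ) (f : FockHat n) : PowerSeries ℂ :=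
  levelSeries (ofCoeff fun ν =>
    MvPowerSeries.coeff μ (expGen x * ((shift d (MvPolynomial.monomial ν 1) : Fock n) : FockHat n))
      * MvPowerSeries.coeff ν f)

theorem pairing_expGen (x d x' : Osc n → ℂ) (μ : Osc n →₀ ℕ) :
    ∃ P : Polynomial ℂ, pairing x d μ (expGen x') = levelSeries (expGen (d * x')) * P ∧
      P.eval 1 = MvPowerSeries.coeff μ (expGen (x + x')) := by
  classical
  set F : FockHat n := ofCoeff fun σ => if σ ≤ μ then
    MvPowerSeries.coeff (μ - σ) (expGen x) * MvPowerSeries.coeff σ (expGen x') else 0 with hF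
  have h1 : pairing x d μ (expGen x') = levelSeries (F * expGen (d * x')) := by
    rw [pairing]
    congr 1
    ext ν
    rw [coeff_ofCoeff, mul_comm, ← smul_eq_mul, ← map_smul, ← mul_smul_comm,
      ← MvPolynomial.coe_smul, coeff_expGen_smul_shift,
      ← MvPolynomial.coeToMvPowerSeries.ringHom_apply, map_sum, Finset.mul_sum, map_sum,
      MvPowerSeries.coeff_mul]
    refine Finset.sum_congr rfl fun στ _ => ?_
    rw [MvPolynomial.coeToMvPowerSeries.ringHom_apply, MvPolynomial.coe_smul, mul_smul_comm,
      map_smul, MvPolynomial.coe_monomial, MvPowerSeries.coeff_mul_monomial, hF, coeff_ofCoeff,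
      smul_eq_mul, mul_comm]
  refine ⟨∑ ρσ ∈ Finset.HasAntidiagonal.antidiagonal μ, Polynomial.monomial (level ρσ.2)
    (MvPowerSeries.coeff ρσ.1 (expGen x) * MvPowerSeries.coeff ρσ.2 (expGen x')), ?_, ?_⟩
  · rw [h1, levelSeries_mul, mul_comm]
    congr 1
    ext N
    rw [coeff_levelSeries, Polynomial.coeff_coe, Polynomial.finsetSum_coeff]
    simp only [Polynomial.coeff_monomial, hF, coeff_ofCoeff]
    rw [← Finset.sum_filter, ← Finset.sum_filter]
    refine Finset.sum_bij' (fun σ _ => (μ - σ, σ)) (fun ρσ _ => ρσ.2) ?_ ?_ ?_ ?_ ?_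
    · intro σ hσ
      rw [Finset.mem_filter, mem_levelFinset] at hσ
      simp [hσ.1, tsub_add_cancel_of_le hσ.2]
    · rintro ⟨ρ, σ⟩ h
      simp only [Finset.mem_filter, Finset.HasAntidiagonal.mem_antidiagonal] at h
      simp [mem_levelFinset, h.2, ← h.1]
    · intro σ _
      rfl
    · rintro ⟨ρ, σ⟩ h
      simp only [Finset.mem_filter, Finset.HasAntidiagonal.mem_antidiagonal] at h
      simp [← h.1]
    · intro σ _
      rfl
  · rw [Polynomial.eval_finsetSum, expGen_add, MvPowerSeries.coeff_mul]
    simp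

theorem pairing_add (x d : Osc n → ℂ) (μ : Osc n →₀ ℕ) (f g : FockHat n) :
    pairing x d μ (f + g) = pairing x d μ f + pairing x d μ g := by
  rw [pairing, pairing, pairing, ← levelSeries_add]
  congr 1
  ext ν
  simp [mul_add]

theorem pairing_smul (x d : Osc n → ℂ) (μ : Osc n →₀ ℕ) (a : ℂ) (f : FockHat n) :
    pairing x d μ (a • f) = PowerSeries.C a * pairing x d μ f := by
  rw [pairing, pairing, ← levelSeries_smul]
  congr 1
  ext ν
  simp only [coeff_ofCoeff, map_smul, smul_eq_mul]
  ring

theorem shift_X (d : Osc n → ℂ) (o : Osc n) :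
    shift d (MvPolynomial.X o) = MvPolynomial.X o + MvPolynomial.C (d o) := by
  simp [shift]

theorem pairing_mul_X (x d : Osc n → ℂ) (μ : Osc n →₀ ℕ) (f : FockHat n) (o : Osc n) :
    pairing x d μ (f * MvPowerSeries.X o) = PowerSeries.X ^ o.level *
      ((if Finsupp.single o 1 ≤ μ then pairing x d (μ - Finsupp.single o 1) f else 0) +
        PowerSeries.C (d o) * pairing x d μ f) := by
  rw [pairing, levelSeries_mul_X]
  congr 1
  have h : ∀ ν, MvPowerSeries.coeff μ (expGen x *
      ((shift d (MvPolynomial.monomial (ν + Finsupp.single o 1) 1) : Fock n) : FockHat n))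
      = (if Finsupp.single o 1 ≤ μ then MvPowerSeries.coeff (μ - Finsupp.single o 1)
          (expGen x * ((shift d (MvPolynomial.monomial ν 1) : Fock n) : FockHat n)) else 0) +
        d o * MvPowerSeries.coeff μ
          (expGen x * ((shift d (MvPolynomial.monomial ν 1) : Fock n) : FockHat n)) := by
    intro ν
    have e : (MvPolynomial.monomial (ν + Finsupp.single o 1) 1 : Fock n)
        = MvPolynomial.monomial ν 1 * MvPolynomial.X o := by
      rw [MvPolynomial.X, MvPolynomial.monomial_mul, one_mul]
    rw [e, map_mul (shift d), shift_X, MvPolynomial.coe_mul, MvPolynomial.coe_add, MvPolynomial.coe_X,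
      MvPolynomial.coe_C, mul_add, mul_add, map_add, ← mul_assoc, ← mul_assoc, coeff_mul_X,
      MvPowerSeries.coeff_mul_C, mul_comm (d o)]
  simp only [h]
  split_ifs
  · rw [pairing, pairing, ← levelSeries_smul, ← levelSeries_add]
    congr 1
    ext ν
    simp only [coeff_ofCoeff, map_add, map_smul, smul_eq_mul]
    ring
  · rw [pairing, ← levelSeries_smul, zero_add]
    congr 1
    ext ν
    simp only [coeff_ofCoeff, map_smul, smul_eq_mul]
    ring

theorem pairing_expGen_mul (x d x' : Osc n → ℂ) (Q : Fock n) (μ : Osc n →₀ ℕ) :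
    ∃ P : Polynomial ℂ,
      pairing x d μ (expGen x' * (Q : FockHat n)) = levelSeries (expGen (d * x')) * P ∧
      P.eval 1 = MvPowerSeries.coeff μ
        (expGen (x + x') * ((shift d Q : Fock n) : FockHat n)) := by
  induction Q using MvPolynomial.induction_on generalizing μ with
  | C a =>
    obtain ⟨P, h1, h2⟩ := pairing_expGen x d x' μ
    refine ⟨Polynomial.C a * P, ?_, ?_⟩
    · rw [MvPolynomial.coe_C, mul_comm, ← MvPowerSeries.smul_eq_C_mul, pairing_smul, h1,
        Polynomial.coe_mul, Polynomial.coe_C]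
      ring
    · have : shift d (MvPolynomial.C a) = MvPolynomial.C a := by simp [shift]
      rw [this, MvPolynomial.coe_C, MvPowerSeries.coeff_mul_C, Polynomial.eval_mul,
        Polynomial.eval_C, h2, mul_comm]
  | add Q Q' ih ih' =>
    obtain ⟨P, h1, h2⟩ := ih μ
    obtain ⟨P', h1', h2'⟩ := ih' μ
    refine ⟨P + P', ?_, ?_⟩
    · rw [MvPolynomial.coe_add, mul_add, pairing_add, h1, h1', Polynomial.coe_add, mul_add]
    · rw [map_add, MvPolynomial.coe_add, mul_add, map_add, Polynomial.eval_add, h2, h2']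
  | mul_X Q o ih =>
    obtain ⟨P, h1, h2⟩ := ih μ
    obtain ⟨P', h1', h2'⟩ := ih (μ - Finsupp.single o 1)
    refine ⟨Polynomial.X ^ o.level *
      ((if Finsupp.single o 1 ≤ μ then P' else 0) + Polynomial.C (d o) * P), ?_, ?_⟩
    · rw [MvPolynomial.coe_mul, MvPolynomial.coe_X, ← mul_assoc, pairing_mul_X, h1, h1']
      split_ifs <;> simp only [Polynomial.coe_mul, Polynomial.coe_add, Polynomial.coe_C,
        Polynomial.coe_pow, Polynomial.coe_X, Polynomial.coe_zero] <;> ring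
    · rw [map_mul (shift d), shift_X, MvPolynomial.coe_mul, MvPolynomial.coe_add,
        MvPolynomial.coe_X, MvPolynomial.coe_C, ← mul_assoc,
        mul_add _ (MvPowerSeries.X o) (MvPowerSeries.C (d o)), map_add, coeff_mul_X,
        MvPowerSeries.coeff_mul_C, ← h2, ← h2']
      split_ifs <;> simp [mul_comm]

theorem shift_shift (d d' : Osc n → ℂ) (Q : Fock n) :
    shift d (shift d' Q) = shift (d + d') Q := by
  have : (shift d).comp (shift d') = shift (d + d') := by
    refine MvPolynomial.algHom_ext fun o => ?_
    rw [AlgHom.comp_apply, shift_X, map_add, shift_X, shift_X]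
    have : shift d (MvPolynomial.C (d' o)) = MvPolynomial.C (d' o) := by simp [shift]
    rw [this, Pi.add_apply, map_add, add_assoc]
  rw [← this, AlgHom.comp_apply]

variable (ε : Fin 3 → ℂ) (p : ℂ) (c : Fin n → Fin 3)

theorem act_single (s : VSym n) (a : ℂ) (v : Fock n) :
    act ε p c (AddMonoidAlgebra.single s a) v = a • vertexOp ε p c s v := by
  rw [act, AddMonoidAlgebra.coeff_single, Finsupp.sum_single_index (by simp)]

theorem act_add (F G : NOrd n) (v : Fock n) :
    act ε p c (F + G) v = act ε p c F v + act ε p c G v := by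
  rw [act, AddMonoidAlgebra.coeff_add, Finsupp.sum_add_index' (by simp)
    (by intros; rw [add_smul])]
  rfl

theorem act_sum {ι : Type*} (s : Finset ι) (F : ι → NOrd n) (v : Fock n) :
    act ε p c (∑ i ∈ s, F i) v = ∑ i ∈ s, act ε p c (F i) v := by
  classical
  induction s using Finset.induction_on with
  | empty => simp [act]
  | insert a s ha ih => rw [Finset.sum_insert ha, Finset.sum_insert ha, act_add, ih]

theorem productSeries_eq (F G : NOrd n) (μ : Osc n →₀ ℕ) (v : Fock n) :
    productSeries ε p c F G μ v = levelSeries (ofCoeff fun ν =>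
      MvPowerSeries.coeff μ (act ε p c F (MvPolynomial.monomial ν 1)) *
      MvPowerSeries.coeff ν (act ε p c G v)) := rfl

theorem productSeries_sum {ι κ : Type*} (s : Finset ι) (t : Finset κ) (F : ι → NOrd n)
    (G : κ → NOrd n) (μ : Osc n →₀ ℕ) (v : Fock n) :
    productSeries ε p c (∑ i ∈ s, F i) (∑ j ∈ t, G j) μ v
      = ∑ i ∈ s, ∑ j ∈ t, productSeries ε p c (F i) (G j) μ v := by
  ext N
  simp only [map_sum, productSeries_eq, coeff_levelSeries, coeff_ofCoeff, act_sum,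
    Finset.sum_mul_sum]
  rw [Finset.sum_comm]
  exact Finset.sum_congr rfl fun i _ => Finset.sum_comm

theorem productSeries_single (s s' : VSym n) (a a' : ℂ) (μ : Osc n →₀ ℕ) (v : Fock n) :
    ∃ P : Polynomial ℂ,
      productSeries ε p c (AddMonoidAlgebra.single s a) (AddMonoidAlgebra.single s' a') μ v
        = PowerSeries.C (a * a') *
          (levelSeries (expGen fun o => s.2 o * comm ε p c o * s'.1 o) * P) ∧
      P.eval 1 = MvPowerSeries.coeff μ (vertexOp ε p c (s + s') v) := by
  obtain ⟨P, h1, h2⟩ := pairing_expGen_mul s.1 (fun o => s.2 o * comm ε p c o) s'.1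
    (shift (fun o => s'.2 o * comm ε p c o) v) μ
  refine ⟨P, ?_, ?_⟩
  · have e : levelSeries (expGen fun o => s.2 o * comm ε p c o * s'.1 o) * (P : PowerSeries ℂ)
        = _ := h1.symm
    rw [e, productSeries_eq, pairing, ← levelSeries_smul]
    congr 1
    ext ν
    simp only [coeff_ofCoeff, act_single, map_smul, vertexOp, smul_eq_mul, expCreation_eq]
    ring
  · have e : (fun o => s.2 o * comm ε p c o) + (fun o => s'.2 o * comm ε p c o)
        = fun o => (s + s').2 o * comm ε p c o := by
      funext o
      simp [add_mul]
    rw [h2, shift_shift, vertexOp, expCreation_eq, e, Prod.fst_add]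

end EllipticCorner

end

noncomputable section

namespace EllipticCorner

variable {n : ℕ}

/-! ## Expansion of the currents -/

/-- The partial sums `∑_{j < i} κ_j`. -/
def partialSum (κ : Fin n → ℕ) (i : Fin n) : ℕ := ∑ j ∈ Finset.univ.filter (fun j => j < i), κ j

theorem partialSum_cons_zero (k : ℕ) (κ : Fin n → ℕ) :
    partialSum (Fin.cons k κ : Fin (n + 1) → ℕ) 0 = 0 := by
  simp [partialSum]

theorem partialSum_cons_succ (k : ℕ) (κ : Fin n → ℕ) (i : Fin n) :
    partialSum (Fin.cons k κ : Fin (n + 1) → ℕ) i.succ = k + partialSum κ i := by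
  rw [partialSum, partialSum, Finset.sum_filter, Finset.sum_filter, Fin.sum_univ_succ]
  simp

theorem qPow_add (ε : Fin 3 → ℂ) (i : Fin 3) (s t : ℂ) :
    qPow ε i (s + t) = qPow ε i s * qPow ε i t := by
  rw [qPow, add_mul, Complex.exp_add, qPow, qPow]

theorem qPow_zero (ε : Fin 3 → ℂ) (i : Fin 3) : qPow ε i 0 = 1 := by simp [qPow]

theorem qPow_ne_zero (ε : Fin 3 → ℂ) (i : Fin 3) (s : ℂ) : qPow ε i s ≠ 0 := Complex.exp_ne_zero _

theorem qPow_neg (ε : Fin 3 → ℂ) (i : Fin 3) (s : ℂ) : qPow ε i (-s) = (qPow ε i s)⁻¹ := by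
  rw [qPow, neg_mul, Complex.exp_neg, qPow]

theorem qPow_nat_mul (ε : Fin 3 → ℂ) (i : Fin 3) (k : ℕ) (s : ℂ) :
    qPow ε i (k * s) = qPow ε i s ^ k := by
  rw [qPow, mul_assoc, Complex.exp_nat_mul, qPow]

theorem qPow_nat (ε : Fin 3 → ℂ) (i : Fin 3) (k : ℕ) : qPow ε i k = qPow ε i 1 ^ k := by
  rw [← qPow_nat_mul, mul_one]

theorem foldr_comp (ε : Fin 3 → ℂ) {N : ℕ} (F : Fin N → DiffOp n) (m : ℕ) (z : ℂ) :
    (List.ofFn F).foldr (DiffOp.comp ε) (DiffOp.id n) m z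
      = ∑ κ ∈ Finset.Nat.antidiagonalTuple N m,
        ∏ i, F i (κ i) (qPow ε 2 (-(partialSum κ i : ℂ)) * z) := by
  induction N generalizing m z with
  | zero =>
    rcases m with _ | m
    · simp [DiffOp.id]
    · simp [DiffOp.id, Finset.Nat.antidiagonalTuple_zero_succ]
  | succ N ih =>
    rw [List.ofFn_succ, List.foldr_cons, DiffOp.comp]
    simp only [ih, Finset.mul_sum]
    rw [Finset.sum_sigma']
    refine Finset.sum_bij' (fun a _ => Fin.cons a.1.1 a.2)
      (fun κ _ => ⟨(κ 0, ∑ i : Fin N, κ i.succ), Fin.tail κ⟩) ?_ ?_ ?_ ?_ ?_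
    · rintro ⟨⟨k, l⟩, κ⟩ h
      simp only [Finset.mem_sigma, Finset.HasAntidiagonal.mem_antidiagonal,
        Finset.Nat.mem_antidiagonalTuple] at h
      rw [Finset.Nat.mem_antidiagonalTuple, Fin.sum_univ_succ]
      simp [h.2, h.1]
    · intro κ h
      rw [Finset.Nat.mem_antidiagonalTuple, Fin.sum_univ_succ] at h
      simp [Finset.Nat.mem_antidiagonalTuple, h, Fin.tail]
    · rintro ⟨⟨k, l⟩, κ⟩ h
      simp only [Finset.mem_sigma, Finset.HasAntidiagonal.mem_antidiagonal,
        Finset.Nat.mem_antidiagonalTuple] at h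
      simp [h.2]
    · intro κ _
      simp
    · rintro ⟨⟨k, l⟩, κ⟩ _
      rw [Fin.prod_univ_succ, partialSum_cons_zero]
      simp only [Fin.cons_zero, Fin.cons_succ, partialSum_cons_succ, Nat.cast_zero, neg_zero,
        qPow_zero, one_mul]
      congr 1
      refine Finset.prod_congr rfl fun i _ => ?_
      rw [← mul_assoc, ← qPow_add]
      push_cast
      congr 3
      ring

section

variable (ε : Fin 3 → ℂ) (p : ℂ) (c : Fin n → Fin 3) (u : Fin n → ℂ)

/-- The exponent of `Λ̃_i(z)`. -/
def tildeSym (i : Fin n) (z : ℂ) : VSym n :=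
  alphaSym ε p c z + lambdaSym ε p c i z + betaSym ε p c z

/-- The coefficient of the `k`-th term of `R_i(z)`. -/
def miuraCoeff (i : Fin 3) (k : ℕ) : ℂ :=
  qPow ε 2 ((k : ℂ) ^ 2 / 2) * qPow ε i (-(k / 2)) *
    (thetaFactorial p (qPow ε 2 1) (qPow ε 2 (1 - k) * qPow ε i 1) k /
      thetaFactorial p (qPow ε 2 1) (qPow ε 2 1) k)

/-- The exponent of the term of a current labelled by `κ`. -/
def termSym (κ : Fin n → ℕ) (z : ℂ) : VSym n :=
  ∑ i, ∑ a ∈ Finset.range (κ i), tildeSym ε p c i (qPow ε 2 (-((partialSum κ i + a : ℕ) : ℂ)) * z)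

/-- The coefficient of the term of a current labelled by `κ`. -/
def termCoeff (κ : Fin n → ℕ) : ℂ := ∏ i, miuraCoeff ε p (c i) (κ i) * u i ^ κ i

theorem prod_single {ι : Type*} (s : Finset ι) (f : ι → VSym n) (g : ι → ℂ) :
    ∏ i ∈ s, (AddMonoidAlgebra.single (f i) (g i) : NOrd n)
      = AddMonoidAlgebra.single (∑ i ∈ s, f i) (∏ i ∈ s, g i) := by
  classical
  induction s using Finset.induction_on with
  | empty => simp [AddMonoidAlgebra.one_def]
  | insert a s ha ih =>
    rw [Finset.prod_insert ha, Finset.sum_insert ha, Finset.prod_insert ha, ih,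
      AddMonoidAlgebra.single_mul_single]

theorem current_eq (m : ℕ) (z : ℂ) :
    current ε p c u m z = ∑ κ ∈ Finset.Nat.antidiagonalTuple n m,
      AddMonoidAlgebra.single (termSym ε p c κ z) (termCoeff ε p c u κ) := by
  have h1 : ∀ i w, lambdaTilde ε p c u i w = AddMonoidAlgebra.single (tildeSym ε p c i w) (u i) := by
    intro i w
    simp [lambdaTilde, tildeSym, AddMonoidAlgebra.single_mul_single]
  have h2 : ∀ i k w, miuraFactor ε p c u i k w = AddMonoidAlgebra.single
      (∑ a ∈ Finset.range k, tildeSym ε p c i (qPow ε 2 (-(a : ℂ)) * w))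
      ((-1) ^ k * (miuraCoeff ε p (c i) k * u i ^ k)) := by
    intro i k w
    simp only [miuraFactor, h1, prod_single, Finset.prod_const, Finset.card_range]
    rw [AddMonoidAlgebra.smul_single, miuraCoeff, smul_eq_mul]
    congr 1
    ring
  rw [current, miura, foldr_comp, Finset.smul_sum]
  refine Finset.sum_congr rfl fun κ hκ => ?_
  rw [Finset.Nat.mem_antidiagonalTuple] at hκ
  simp only [h2, prod_single]
  rw [AddMonoidAlgebra.smul_single, termSym, termCoeff, Finset.prod_mul_distrib,
    Finset.prod_pow_eq_pow_sum, hκ, smul_eq_mul, ← mul_assoc, ← mul_pow]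
  congr 1
  · refine Finset.sum_congr rfl fun i _ => Finset.sum_congr rfl fun a _ => ?_
    rw [← mul_assoc, ← qPow_add]
    push_cast
    congr 3
    ring
  · norm_num

/-- The exponent of the contraction of two normally ordered exponentials. -/
def contraction (s s' : VSym n) : PowerSeries ℂ :=
  levelSeries (linForm fun o => s.2 o * comm ε p c o * s'.1 o)

theorem coeff_contraction (s s' : VSym n) (N : ℕ+) :
    PowerSeries.coeff N (contraction ε p c s s')
      = ∑ k : Fin n, s.2 (Sum.inl (k, N)) * comm ε p c (Sum.inl (k, N)) * s'.1 (Sum.inl (k, N))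
        + ∑ k : Fin n, s.2 (Sum.inr (k, N)) * comm ε p c (Sum.inr (k, N)) * s'.1 (Sum.inr (k, N)) :=
  coeff_levelSeries_linForm _ N

theorem coeff_contraction_sum {ι κ : Type*} (a : Finset ι) (b : Finset κ) (s : ι → VSym n)
    (s' : κ → VSym n) (N : ℕ+) :
    PowerSeries.coeff N (contraction ε p c (∑ i ∈ a, s i) (∑ j ∈ b, s' j))
      = ∑ i ∈ a, ∑ j ∈ b, PowerSeries.coeff N (contraction ε p c (s i) (s' j)) := by
  simp only [coeff_contraction, Prod.snd_sum, Prod.fst_sum, Finset.sum_apply, Finset.sum_mul,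
    Finset.mul_sum, Finset.sum_add_distrib]
  have e : ∀ f : Fin n → κ → ι → ℂ, ∑ k, ∑ j ∈ b, ∑ i ∈ a, f k j i
      = ∑ i ∈ a, ∑ j ∈ b, ∑ k, f k j i := by
    intro f
    rw [Finset.sum_comm, Finset.sum_comm (s := a)]
    exact Finset.sum_congr rfl fun j _ => Finset.sum_comm
  rw [e, e]

end

end EllipticCorner

end

noncomputable section

namespace EllipticCorner

variable {n : ℕ}

/-! ## Contractions of the decoupled vertex operators -/

theorem sum_lt_telescope (f : Fin n → ℂ) (j : Fin n) :
    ∑ k, (if k < j then (f k - 1) * ∏ i ∈ Finset.univ.filter (fun i => i < k), f i else 0)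
      = (∏ i ∈ Finset.univ.filter (fun i => i < j), f i) - 1 := by
  rw [← Finset.sum_filter]
  have h := Finset.prod_one_add_ordered (Finset.univ.filter (fun i => i < j)) (fun i => f i - 1)
  simp only [add_sub_cancel] at h
  rw [h, add_sub_cancel_left]
  refine Finset.sum_congr rfl fun k hk => ?_
  congr 1
  refine Finset.prod_congr ?_ fun _ _ => rfl
  ext i
  simp only [Finset.mem_filter, Finset.mem_univ, true_and] at hk ⊢
  exact ⟨fun h => ⟨h.trans hk, h⟩, fun h => h.2⟩

theorem sum_telescope (f : Fin n → ℂ) :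
    ∑ k, (f k - 1) * ∏ i ∈ Finset.univ.filter (fun i => i < k), f i = (∏ i, f i) - 1 := by
  have h := Finset.prod_one_add_ordered Finset.univ (fun i => f i - 1)
  simp only [add_sub_cancel] at h
  rw [h, add_sub_cancel_left]

/-- The structure constant of the contraction of `Λ̃_i` and `Λ̃_j`. -/
def contrConst (X : Fin n → ℂ) (i j : Fin n) : ℂ :=
  (∏ k, X k)⁻¹ / ((∏ k, X k) - (∏ k, X k)⁻¹) +
    if i < j then 1 else if i = j then -(1 / (X i ^ 2 - 1)) else 0

theorem prod_before_mul_after (X : Fin n → ℂ) (k : Fin n) :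
    (∏ j ∈ Finset.univ.filter (fun j => j < k), X j) * X k *
      (∏ j ∈ Finset.univ.filter (fun j => k < j), X j) = ∏ j, X j := by
  rw [← Finset.mul_prod_erase Finset.univ X (Finset.mem_univ k), mul_comm _ (X k), mul_assoc]
  congr 1
  rw [← Finset.prod_union]
  · refine Finset.prod_congr ?_ fun _ _ => rfl
    ext j
    simp only [Finset.mem_union, Finset.mem_filter, Finset.mem_univ, true_and, Finset.mem_erase,
      and_true]
    exact lt_or_lt_iff_ne
  · rw [Finset.disjoint_filter]
    exact fun j _ h => h.asymm

theorem sum_contr (X : Fin n → ℂ) (hX : ∀ k, X k ≠ 0) (hX2 : ∀ k, X k ^ 2 ≠ 1)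
    (hC : (∏ k, X k) ^ 2 ≠ 1) (i j : Fin n) (B A : Fin n → ℂ)
    (hB : ∀ k, B k = ∏ j ∈ Finset.univ.filter (fun j => j < k), X j)
    (hA : ∀ k, A k = ∏ j ∈ Finset.univ.filter (fun j => k < j), X j) :
    ∑ k, (X k - (X k)⁻¹) *
        ((∏ k, X k)⁻¹ * B k / ((∏ k, X k) - (∏ k, X k)⁻¹) -
          if k = i then (B k)⁻¹ / (X k ^ 2 - 1) else 0) *
        (-((A k)⁻¹ / ((∏ k, X k) - (∏ k, X k)⁻¹)) +
          if k < j then -(B k * X k) else if k = j then B k / (X k - (X k)⁻¹) else 0)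
      = contrConst X i j := by
  set C := ∏ k, X k with hCdef
  have hC0 : C ≠ 0 := Finset.prod_ne_zero_iff.mpr fun k _ => hX k
  have hB0 : ∀ k, B k ≠ 0 := fun k => by
    rw [hB]; exact Finset.prod_ne_zero_iff.mpr fun k _ => hX k
  have hA1 : ∀ k, (A k)⁻¹ = B k * X k / C := by
    intro k
    have h1 := prod_before_mul_after X k
    rw [← hB, ← hA, ← hCdef] at h1
    have hA0 : A k ≠ 0 := by rw [hA]; exact Finset.prod_ne_zero_iff.mpr fun k _ => hX k
    rw [← h1]
    have := hX k
    have := hB0 k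
    field_simp
  have hD : C - C⁻¹ ≠ 0 := by
    intro h
    apply hC
    field_simp at h
    linear_combination h
  have hXi : ∀ k, X k - (X k)⁻¹ ≠ 0 := by
    intro k h
    apply hX2 k
    have := hX k
    field_simp at h
    linear_combination h
  have hXs : ∀ k, X k ^ 2 - 1 ≠ 0 := fun k => sub_ne_zero.mpr (hX2 k)
  set D := C - C⁻¹ with hDdef
  have hB2 : ∀ k, B k ^ 2 = ∏ i ∈ Finset.univ.filter (fun i => i < k), X i ^ 2 := by
    intro k
    rw [hB, Finset.prod_pow]
  have t1 := sum_telescope fun k => X k ^ 2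
  have t2 := sum_lt_telescope (fun k => X k ^ 2) j
  simp only [← hB2] at t1 t2
  rw [Finset.prod_pow, ← hCdef] at t1
  have e : ∀ k, (X k - (X k)⁻¹) *
        (C⁻¹ * B k / D - if k = i then (B k)⁻¹ / (X k ^ 2 - 1) else 0) *
        (-((A k)⁻¹ / D) +
          if k < j then -(B k * X k) else if k = j then B k / (X k - (X k)⁻¹) else 0)
      = -(C⁻¹ / D * (C⁻¹ / D)) * ((X k ^ 2 - 1) * B k ^ 2)
        - C⁻¹ / D * (if k < j then (X k ^ 2 - 1) * B k ^ 2 else 0)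
        + C⁻¹ / D * (if k = j then B k ^ 2 else 0)
        + (if k = i then C⁻¹ / D + (if k < j then 1 else if k = j then -(1 / (X k ^ 2 - 1)) else 0)
          else 0) := by
    intro k
    rw [hA1]
    have h1 := hX k
    have h2 := hB0 k
    have h3 := hXi k
    have h4 := hXs k
    have h5 : X k - (X k)⁻¹ = (X k ^ 2 - 1) / X k := by field_simp
    rcases lt_trichotomy k j with h | h | h
    · simp only [h, if_true, h.ne, if_false]
      rw [h5]
      split_ifs
      · field_simp
        ring
      · field_simp
        ring
    · simp only [h, lt_irrefl, if_true, if_false]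
      rw [h] at h1 h2 h3 h4 h5
      rw [h5]
      split_ifs
      · field_simp
        ring
      · field_simp
        ring
    · simp only [h.not_gt, h.ne', if_false]
      rw [h5]
      split_ifs
      · field_simp
        ring
      · field_simp
        ring
  rw [Finset.sum_congr rfl fun k _ => e k, Finset.sum_add_distrib, Finset.sum_add_distrib,
    Finset.sum_sub_distrib, ← Finset.mul_sum, ← Finset.mul_sum, ← Finset.mul_sum, t1, t2,
    Finset.sum_ite_eq' Finset.univ j, Finset.sum_ite_eq' Finset.univ i]
  simp only [Finset.mem_univ, if_true, contrConst, ← hCdef, ← hDdef]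
  have e2 : C⁻¹ / D * (C ^ 2 - 1) = 1 := by
    rw [hDdef]
    rw [hDdef] at hD
    have : C - C⁻¹ = (C ^ 2 - 1) / C := by field_simp
    rw [this] at hD ⊢
    have h6 : C ^ 2 - 1 ≠ 0 := sub_ne_zero.mpr hC
    field_simp
  linear_combination (-(C⁻¹ / D)) * e2

theorem sum_contr_inv (X : Fin n → ℂ) (hX : ∀ k, X k ≠ 0) (hX2 : ∀ k, X k ^ 2 ≠ 1)
    (hC : (∏ k, X k) ^ 2 ≠ 1) (i j : Fin n) (B A : Fin n → ℂ)
    (hB : ∀ k, B k = ∏ j ∈ Finset.univ.filter (fun j => j < k), X j)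
    (hA : ∀ k, A k = ∏ j ∈ Finset.univ.filter (fun j => k < j), X j) :
    ∑ k, (X k - (X k)⁻¹) *
        ((∏ k, X k) * (B k)⁻¹ / ((∏ k, X k) - (∏ k, X k)⁻¹) +
          if k = i then B k / ((X k ^ 2)⁻¹ - 1) else 0) *
        (-(A k / ((∏ k, X k) - (∏ k, X k)⁻¹)) +
          if k < j then (B k * X k)⁻¹ else if k = j then (B k)⁻¹ / (X k - (X k)⁻¹) else 0)
      = -contrConst (fun k => (X k)⁻¹) i j := by
  rw [← sum_contr (fun k => (X k)⁻¹) (fun k => inv_ne_zero (hX k)) (fun k h => hX2 k (by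
    rw [inv_pow] at h; exact inv_eq_one.mp h)) (fun h => hC (by
    rw [Finset.prod_inv_distrib, inv_pow] at h; exact inv_eq_one.mp h)) i j (fun k => (B k)⁻¹)
    (fun k => (A k)⁻¹) (fun k => by rw [hB, Finset.prod_inv_distrib])
    (fun k => by rw [hA, Finset.prod_inv_distrib]), ← Finset.sum_neg_distrib]
  refine Finset.sum_congr rfl fun k _ => ?_
  simp only [Finset.prod_inv_distrib, inv_inv, inv_pow]
  have e1 : ((∏ k, X k)⁻¹ - ∏ k, X k) = -((∏ k, X k) - (∏ k, X k)⁻¹) := by ring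
  have e2 : ((X k)⁻¹ - X k) = -(X k - (X k)⁻¹) := by ring
  rw [e1, e2]
  simp only [div_neg, mul_inv]
  split_ifs <;> ring

section

variable (ε : Fin 3 → ℂ) (p : ℂ) (c : Fin n → Fin 3)

/-- The half powers `q_i ^ (N / 2)`. -/
def halfPow (N : ℕ) (i : Fin 3) : ℂ := qPow ε i (N / 2)

theorem halfPow_ne_zero (N : ℕ) (i : Fin 3) : halfPow ε N i ≠ 0 := qPow_ne_zero _ _ _

theorem halfPow_sq (N : ℕ) (i : Fin 3) : halfPow ε N i ^ 2 = qPow ε i 1 ^ N := by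
  rw [halfPow, sq, ← qPow_add, ← qPow_nat]
  congr 1
  ring

theorem prod_qPow_half (N : ℕ) (s : Finset (Fin n)) :
    (∏ k ∈ s, qPow ε (c k) (1 / 2)) ^ N = ∏ k ∈ s, halfPow ε N (c k) := by
  rw [← Finset.prod_pow]
  refine Finset.prod_congr rfl fun k _ => ?_
  rw [← qPow_nat_mul, halfPow]
  congr 1
  ring

theorem coeff_contraction_tildeSym {p : ℂ} (hp : ‖p‖ < 1) (hp₀ : p ≠ 0) (N : ℕ+)
    (hq : ∀ i, halfPow ε N i ^ 2 ≠ 1) (hC : (∏ k, halfPow ε N (c k)) ^ 2 ≠ 1) (i j : Fin n)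
    {w z : ℂ} :
    PowerSeries.coeff N (contraction ε p c (tildeSym ε p c i w) (tildeSym ε p c j z))
      = aNorm ε p N * contrConst (fun k => halfPow ε N (c k)) i j * (z / w) ^ (N : ℕ)
        - bNorm ε p N * contrConst (fun k => (halfPow ε N (c k))⁻¹) i j * (w / z) ^ (N : ℕ) := by
  set X : Fin n → ℂ := fun k => halfPow ε N (c k) with hX
  have hX0 : ∀ k, X k ≠ 0 := fun k => halfPow_ne_zero ε N _
  have hkap : kappa ε N ≠ 0 := Finset.prod_ne_zero_iff.mpr fun i _ => by
    rw [qPow_nat, ← halfPow_sq]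
    exact sub_ne_zero.mpr (hq i)
  have hpN : 1 - p ^ (N : ℕ) ≠ 0 := one_sub_pow_ne_zero hp N.pos
  have hpN0 : p ^ (N : ℕ) ≠ 0 := pow_ne_zero _ hp₀
  have hN : ((N : ℕ) : ℂ) ≠ 0 := by exact_mod_cast N.pos.ne'
  have hB : ∀ k, cBefore ε c k ^ (N : ℕ) = ∏ j ∈ Finset.univ.filter (fun j => j < k), X j :=
    fun k => prod_qPow_half ε c N _
  have hA : ∀ k, cAfter ε c k ^ (N : ℕ) = ∏ j ∈ Finset.univ.filter (fun j => k < j), X j :=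
    fun k => prod_qPow_half ε c N _
  have hT : qTot ε c (N / 2) = ∏ k, X k := rfl
  have hT' : qTot ε c (-(N / 2)) = (∏ k, X k)⁻¹ := by
    rw [qTot, ← Finset.prod_inv_distrib]
    exact Finset.prod_congr rfl fun k _ => qPow_neg _ _ _
  have h2 : ∀ k, qPow ε (c k) (1 / 2) ^ (N : ℕ) = X k := fun k => by
    rw [← qPow_nat_mul]
    simp only [hX, halfPow]
    congr 1
    ring
  have h3 : ∀ k, qPow ε (c k) (N / 2) = X k := fun k => rfl
  have h4 : ∀ k, qPow ε (c k) (-(N / 2)) = (X k)⁻¹ := fun k => qPow_neg _ _ _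
  have h5 : ∀ k, qPow ε (c k) (-(N / 4)) = (qPow ε (c k) (N / 4))⁻¹ := fun k => qPow_neg _ _ _
  have h6 : ∀ k, qPow ε (c k) N = X k ^ 2 := fun k => by
    rw [qPow_nat, ← halfPow_sq]
  have h7 : ∀ k, qPow ε (c k) (-N) = (X k ^ 2)⁻¹ := fun k => by rw [qPow_neg, h6]
  have hy : ∀ k, qPow ε (c k) (N / 4) ≠ 0 := fun k => qPow_ne_zero _ _ _
  have ha : ∀ k, comm ε p c (Sum.inl (k, N)) * aNorm ε p N = X k - (X k)⁻¹ := by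
    intro k
    rw [comm, aNorm, h3, h4]
    field_simp
  have hb : ∀ k, comm ε p c (Sum.inr (k, N)) * bNorm ε p N = X k - (X k)⁻¹ := by
    intro k
    rw [comm, bNorm, h3, h4]
    field_simp
  rw [coeff_contraction]
  have e1 : ∑ k : Fin n, (tildeSym ε p c i w).2 (Sum.inl (k, N)) * comm ε p c (Sum.inl (k, N)) *
      (tildeSym ε p c j z).1 (Sum.inl (k, N))
      = aNorm ε p N * contrConst X i j * (z / w) ^ (N : ℕ) := by
    rw [← sum_contr X hX0 (fun k => hq _) hC i j _ _ hB hA, Finset.mul_sum, Finset.sum_mul]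
    refine Finset.sum_congr rfl fun k _ => ?_
    have l1 : (tildeSym ε p c i w).2 (Sum.inl (k, N)) = aNorm ε p N * qPow ε (c k) (N / 4) *
        w⁻¹ ^ (N : ℕ) * ((∏ k, X k)⁻¹ * cBefore ε c k ^ (N : ℕ) / ((∏ k, X k) - (∏ k, X k)⁻¹) -
          if k = i then (cBefore ε c k ^ (N : ℕ))⁻¹ / (X k ^ 2 - 1) else 0) := by
      simp only [tildeSym, alphaSym, lambdaSym, betaSym, Prod.snd_add, Pi.add_apply, Sum.elim_inl,
        zero_add, kPlusA, hT, hT', mul_inv, inv_inv, mul_pow]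
      split_ifs with hk
      · subst hk
        simp only [etaAnnA, h6, mul_inv, mul_pow, inv_pow]
        ring
      · ring
    have l2 : (tildeSym ε p c j z).1 (Sum.inl (k, N)) = aNorm ε p N * (qPow ε (c k) (N / 4))⁻¹ *
        z ^ (N : ℕ) * (-((cAfter ε c k ^ (N : ℕ))⁻¹ / ((∏ k, X k) - (∏ k, X k)⁻¹)) +
          if k < j then -(cBefore ε c k ^ (N : ℕ) * X k) else
            if k = j then cBefore ε c k ^ (N : ℕ) / (X k - (X k)⁻¹) else 0) := by
      simp only [tildeSym, alphaSym, lambdaSym, betaSym, Prod.fst_add, Pi.add_apply, Sum.elim_inl,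
        Pi.zero_apply, add_zero, phiA, hT, hT', mul_pow, inv_pow, h5, h2]
      split_ifs with hk hk'
      · ring
      · subst hk'
        simp only [etaCreA, h5, h3, h4, mul_pow]
        ring
      · ring
    rw [l1, l2, ← ha k, div_pow, inv_pow]
    have := hy k
    field_simp
  have e2 : ∑ k : Fin n, (tildeSym ε p c i w).2 (Sum.inr (k, N)) * comm ε p c (Sum.inr (k, N)) *
      (tildeSym ε p c j z).1 (Sum.inr (k, N))
      = -(bNorm ε p N * contrConst (fun k => (X k)⁻¹) i j * (w / z) ^ (N : ℕ)) := by
    rw [← neg_mul, ← mul_neg,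
      ← sum_contr_inv X hX0 (fun k => hq _) hC i j _ _ hB hA, Finset.mul_sum, Finset.sum_mul]
    refine Finset.sum_congr rfl fun k _ => ?_
    have l1 : (tildeSym ε p c i w).2 (Sum.inr (k, N)) = bNorm ε p N * (qPow ε (c k) (N / 4))⁻¹ *
        w ^ (N : ℕ) * ((∏ k, X k) * (cBefore ε c k ^ (N : ℕ))⁻¹ / ((∏ k, X k) - (∏ k, X k)⁻¹) +
          if k = i then cBefore ε c k ^ (N : ℕ) / ((X k ^ 2)⁻¹ - 1) else 0) := by
      simp only [tildeSym, alphaSym, lambdaSym, betaSym, Prod.snd_add, Pi.add_apply, Sum.elim_inr,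
        zero_add, kPlusB, hT, hT', mul_pow, inv_pow, h5]
      split_ifs with hk
      · subst hk
        simp only [etaAnnB, h5, h7, mul_pow]
        ring
      · ring
    have l2 : (tildeSym ε p c j z).1 (Sum.inr (k, N)) = bNorm ε p N * qPow ε (c k) (N / 4) *
        z⁻¹ ^ (N : ℕ) * (-(cAfter ε c k ^ (N : ℕ) / ((∏ k, X k) - (∏ k, X k)⁻¹)) +
          if k < j then (cBefore ε c k ^ (N : ℕ) * X k)⁻¹ else
            if k = j then (cBefore ε c k ^ (N : ℕ))⁻¹ / (X k - (X k)⁻¹) else 0) := by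
      simp only [tildeSym, alphaSym, lambdaSym, betaSym, Prod.fst_add, Pi.add_apply, Sum.elim_inr,
        Pi.zero_apply, add_zero, phiB, hT, hT', mul_inv, inv_inv, mul_pow, inv_pow, h2]
      split_ifs with hk hk'
      · ring
      · subst hk'
        simp only [etaCreB, h3, h4, mul_inv, mul_pow, inv_pow]
        ring
      · ring
    rw [l1, l2, ← hb k, div_pow, inv_pow]
    have := hy k
    field_simp
  rw [e1, e2]
  ring

end

end EllipticCorner

end

noncomputable section

namespace EllipticCorner

variable {n : ℕ}

/-! ## Sums over the positions of a current -/

theorem partialSum_zero (κ : Fin (n + 1) → ℕ) : partialSum κ 0 = 0 := by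
  simp [partialSum]

theorem partialSum_succ (κ : Fin (n + 1) → ℕ) (i : Fin n) :
    partialSum κ i.succ = κ 0 + partialSum (Fin.tail κ) i := by
  rw [← partialSum_cons_succ, Fin.cons_self_tail]

@[to_additive]
theorem prod_partialSum {M : Type*} [CommMonoid M] (κ : Fin n → ℕ) (f : ℕ → M) :
    ∏ i, ∏ a ∈ Finset.range (κ i), f (partialSum κ i + a) = ∏ a ∈ Finset.range (∑ i, κ i), f a := by
  induction n generalizing f with
  | zero => simp
  | succ n ih =>
    rw [Fin.prod_univ_succ, Fin.sum_univ_succ, Finset.prod_range_add]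
    congr 1
    · simp [partialSum_zero]
    · have h := ih (Fin.tail κ) (fun a => f (κ 0 + a))
      simpa only [partialSum_succ, Fin.tail, add_assoc] using h

theorem sum_lt_partialSum (κ : Fin n → ℕ) (f : ℕ → ℂ) (j : Fin n) :
    ∑ i, (if i < j then ∑ a ∈ Finset.range (κ i), f (partialSum κ i + a) else 0)
      = ∑ a ∈ Finset.range (partialSum κ j), f a := by
  have h1 : partialSum κ j = ∑ i, if i < j then κ i else 0 := by
    rw [partialSum, Finset.sum_filter]
  rw [h1, ← sum_partialSum]
  refine Finset.sum_congr rfl fun i _ => ?_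
  split_ifs with h
  · have : partialSum (fun i => if i < j then κ i else 0) i = partialSum κ i := by
      refine Finset.sum_congr rfl fun l hl => ?_
      exact if_pos ((Finset.mem_filter.mp hl).2.trans h)
    rw [this]
  · simp

/-! ## The exponents of the operator product -/

section

variable (c : Fin n → Fin 3)

/-- `∏ (h_i - h_i⁻¹)`. -/
def kapHalf (h : Fin 3 → ℂ) : ℂ := (h 0 - (h 0)⁻¹) * (h 1 - (h 1)⁻¹) * (h 2 - (h 2)⁻¹)

/-- The coefficients `fCoeff` in terms of half powers. -/
def fHalf (h : Fin 3 → ℂ) (C : ℂ) (r m : ℕ) : ℂ :=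
  (h 2 ^ r - (h 2 ^ r)⁻¹) * (C * (h 2 ^ m)⁻¹ - C⁻¹ * h 2 ^ m) *
    (((h 0 - (h 0)⁻¹) * (h 1 - (h 1)⁻¹)) / ((C - C⁻¹) * (h 2 - (h 2)⁻¹)))

/-- The parameter in the numerators of the structure functions. -/
def numIdx (κ : Fin n → ℕ) (j : Fin n) : Fin 3 := if c j = 2 ∧ κ j = 0 then 0 else c j

theorem exponent_identity_aux {h0 h1 H C M P : ℂ} (hh0 : h0 ≠ 0) (hh1 : h1 ≠ 0) (hH : H ≠ 0)
    (hC0 : C ≠ 0) (hM : M ≠ 0) (hH2 : H ^ 2 ≠ 1) (hC : C ^ 2 ≠ 1) (E : ℂ) :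
    H⁻¹ * M * (C * M⁻¹ - C⁻¹ * M) * ((h0 - h0⁻¹) * (h1 - h1⁻¹)) / (C - C⁻¹) +
      (h0 - h0⁻¹) * (h1 - h1⁻¹) * (H - H⁻¹) *
        (C⁻¹ / (C - C⁻¹) * ((M ^ 2 - 1) / (H ^ 2 - 1)) + (P - 1) / (H ^ 2 - 1) - P * E / (H ^ 2 - 1))
      = (h0 - h0⁻¹) * (h1 - h1⁻¹) / H * (P * (1 - E)) := by
  have e1 : C - C⁻¹ = (C ^ 2 - 1) / C := by field_simp
  have e2 : H - H⁻¹ = (H ^ 2 - 1) / H := by field_simp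
  have e3 : H ^ 2 - 1 ≠ 0 := sub_ne_zero.mpr hH2
  have e4 : C ^ 2 - 1 ≠ 0 := sub_ne_zero.mpr hC
  rw [e1, e2]
  field_simp
  ring

theorem exponent_identity_term {h : Fin 3 → ℂ} (hh : ∀ i, h i ≠ 0) (hprod : h 0 * h 1 * h 2 = 1)
    (hh2 : ∀ i, h i ^ 2 ≠ 1) (i : Fin 3) (k : ℕ) (hk : i = 2 → k ≤ 1) (P : ℂ) :
    (h 0 - (h 0)⁻¹) * (h 1 - (h 1)⁻¹) / h 2 * (P * (1 - ((h 2 ^ 2) ^ k - 1) / (h i ^ 2 - 1)))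
      = P * (h 2 ^ 2) ^ k + P / h 2 ^ 2 - h (if i = 2 ∧ k = 0 then 0 else i) ^ 2 * P
        - P * (h 2 ^ 2) ^ k / (h (if i = 2 ∧ k = 0 then 0 else i) ^ 2 * h 2 ^ 2) := by
  have n0 := hh 0
  have n1 := hh 1
  have n2 := hh 2
  have m0 := sub_ne_zero.mpr (hh2 0)
  have m1 := sub_ne_zero.mpr (hh2 1)
  have m2 := sub_ne_zero.mpr (hh2 2)
  have e : h 1 = (h 0 * h 2)⁻¹ := by
    field_simp
    linear_combination hprod
  have e' : h 0 = (h 1 * h 2)⁻¹ := by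
    field_simp
    linear_combination hprod
  generalize hK : (h 2 ^ 2) ^ k = K
  fin_cases i
  · simp only [Fin.zero_eta, Fin.isValue, show ((0 : Fin 3) = 2) = False by simp, false_and,
      if_false]
    rw [e]
    field_simp
    ring
  · simp only [Fin.mk_one, Fin.isValue, show ((1 : Fin 3) = 2) = False by simp, false_and,
      if_false]
    rw [e']
    field_simp
    ring
  · have hk' : k ≤ 1 := hk rfl
    simp only [Fin.reduceFinMk, Fin.isValue, true_and]
    interval_cases k
    · simp only [if_true]
      rw [← hK, e]
      field_simp
      ring
    · simp only [one_ne_zero, if_false]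
      rw [← hK]
      field_simp
      ring

theorem exponent_identity {h : Fin 3 → ℂ} (hh : ∀ i, h i ≠ 0) (hprod : h 0 * h 1 * h 2 = 1)
    (hh2 : ∀ i, h i ^ 2 ≠ 1) (hC : (∏ k, h (c k)) ^ 2 ≠ 1) (κ l : Fin n → ℕ)
    (hκ : ∀ j, c j = 2 → κ j ≤ 1) {m r : ℕ} (hm : ∑ i, κ i = m) (hr : ∑ i, l i = r) :
    h 2 ^ m / h 2 ^ r * fHalf h (∏ k, h (c k)) r m +
      ∑ i, ∑ a ∈ Finset.range (κ i), ∑ j, ∑ b ∈ Finset.range (l j),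
        ((h 2 ^ 2) ^ (partialSum κ i + a) / (h 2 ^ 2) ^ (partialSum l j + b)) *
          (kapHalf h * contrConst (fun k => h (c k)) i j)
      = ∑ j, ∑ b ∈ Finset.range (l j), ((h 2 ^ 2) ^ (partialSum l j + b))⁻¹ *
        ((h 2 ^ 2) ^ (partialSum κ j + κ j) + (h 2 ^ 2) ^ partialSum κ j / h 2 ^ 2
          - h (numIdx c κ j) ^ 2 * (h 2 ^ 2) ^ partialSum κ j
          - (h 2 ^ 2) ^ (partialSum κ j + κ j) / (h (numIdx c κ j) ^ 2 * h 2 ^ 2)) := by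
  set H := h 2 with hHdef
  set C := ∏ k, h (c k) with hCdef
  have hH : H ≠ 0 := hh 2
  have hH2 : H ^ 2 ≠ 1 := hh2 2
  have hH3 : H ^ 2 - 1 ≠ 0 := sub_ne_zero.mpr hH2
  have hT : H ^ 2 ≠ 0 := pow_ne_zero _ hH
  have hC0 : C ≠ 0 := Finset.prod_ne_zero_iff.mpr fun k _ => hh _
  -- the prefactor as a sum over the positions of the second current
  set f0 := H⁻¹ * H ^ m * (C * (H ^ m)⁻¹ - C⁻¹ * H ^ m) * ((h 0 - (h 0)⁻¹) * (h 1 - (h 1)⁻¹))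
    / (C - C⁻¹) with hf0
  have hf : H ^ m / H ^ r * fHalf h C r m
      = ∑ j, ∑ b ∈ Finset.range (l j), ((H ^ 2) ^ (partialSum l j + b))⁻¹ * f0 := by
    rw [sum_partialSum l (fun b => ((H ^ 2) ^ b)⁻¹ * f0), hr, ← Finset.sum_mul]
    have h1 : ∀ b : ℕ, ((H ^ 2) ^ b)⁻¹ = ((H ^ 2)⁻¹) ^ b := fun b => (inv_pow _ _).symm
    simp only [h1]
    have h2 : (H ^ 2)⁻¹ ≠ 1 := fun h => hH2 (inv_eq_one.mp h)
    have e2 : H - H⁻¹ = (H ^ 2 - 1) / H := by field_simp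
    rw [geom_sum_eq h2, hf0, fHalf, ← hHdef, e2]
    have h3 : (H ^ 2)⁻¹ - 1 = -((H ^ 2 - 1) / H ^ 2) := by
      field_simp
      ring
    rw [h3, inv_pow, ← pow_mul, mul_comm 2 r, pow_mul]
    have h4 : H ^ m ≠ 0 := pow_ne_zero _ hH
    have h5 : H ^ r ≠ 0 := pow_ne_zero _ hH
    have h6 : C ^ 2 - 1 ≠ 0 := sub_ne_zero.mpr hC
    have e3 : C - C⁻¹ = (C ^ 2 - 1) / C := by field_simp
    rw [e3]
    field_simp
    ring
  have hs : ∑ i, ∑ a ∈ Finset.range (κ i), ∑ j, ∑ b ∈ Finset.range (l j),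
        ((H ^ 2) ^ (partialSum κ i + a) / (H ^ 2) ^ (partialSum l j + b)) *
          (kapHalf h * contrConst (fun k => h (c k)) i j)
      = ∑ j, ∑ b ∈ Finset.range (l j), ((H ^ 2) ^ (partialSum l j + b))⁻¹ *
        (kapHalf h * ∑ i, ∑ a ∈ Finset.range (κ i), (H ^ 2) ^ (partialSum κ i + a) *
          contrConst (fun k => h (c k)) i j) := by
    simp only [Finset.mul_sum]
    have e : ∀ f : Fin n → ℕ → Fin n → ℕ → ℂ, ∑ i, ∑ a ∈ Finset.range (κ i), ∑ j,
        ∑ b ∈ Finset.range (l j), f i a j b = ∑ j, ∑ b ∈ Finset.range (l j), ∑ i,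
          ∑ a ∈ Finset.range (κ i), f i a j b := by
      intro f
      have e1 : ∀ i, ∑ a ∈ Finset.range (κ i), ∑ j, ∑ b ∈ Finset.range (l j), f i a j b
          = ∑ j, ∑ b ∈ Finset.range (l j), ∑ a ∈ Finset.range (κ i), f i a j b := by
        intro i
        rw [Finset.sum_comm]
        exact Finset.sum_congr rfl fun j _ => Finset.sum_comm
      simp only [e1]
      rw [Finset.sum_comm]
      exact Finset.sum_congr rfl fun j _ => Finset.sum_comm
    rw [e]
    refine Finset.sum_congr rfl fun j _ => Finset.sum_congr rfl fun b _ =>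
      Finset.sum_congr rfl fun i _ => Finset.sum_congr rfl fun a _ => ?_
    ring
  rw [hf, hs, ← Finset.sum_add_distrib]
  refine Finset.sum_congr rfl fun j _ => ?_
  rw [← Finset.sum_add_distrib]
  refine Finset.sum_congr rfl fun b _ => ?_
  rw [← mul_add]
  congr 1
  have hsum : ∑ i, ∑ a ∈ Finset.range (κ i), (H ^ 2) ^ (partialSum κ i + a) *
      contrConst (fun k => h (c k)) i j
      = C⁻¹ / (C - C⁻¹) * (((H ^ m) ^ 2 - 1) / (H ^ 2 - 1))
        + ((H ^ 2) ^ partialSum κ j - 1) / (H ^ 2 - 1)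
        - (H ^ 2) ^ partialSum κ j * (((H ^ 2) ^ κ j - 1) / (h (c j) ^ 2 - 1)) / (H ^ 2 - 1) := by
    have e1 : ∀ i, ∑ a ∈ Finset.range (κ i), (H ^ 2) ^ (partialSum κ i + a) *
        contrConst (fun k => h (c k)) i j
        = C⁻¹ / (C - C⁻¹) * (∑ a ∈ Finset.range (κ i), (H ^ 2) ^ (partialSum κ i + a))
          + (if i < j then ∑ a ∈ Finset.range (κ i), (H ^ 2) ^ (partialSum κ i + a) else 0)
          + (if i = j then -(∑ a ∈ Finset.range (κ j), (H ^ 2) ^ (partialSum κ j + a))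
              / (h (c j) ^ 2 - 1) else 0) := by
      intro i
      rw [← Finset.sum_mul, contrConst, ← hCdef]
      rcases lt_trichotomy i j with hij | hij | hij
      · simp only [hij, hij.ne, if_true, if_false]
        ring
      · subst hij
        simp only [lt_irrefl, if_true, if_false]
        ring
      · simp only [hij.not_gt, hij.ne', if_false]
        ring
    rw [Finset.sum_congr rfl fun i _ => e1 i, Finset.sum_add_distrib, Finset.sum_add_distrib,
      ← Finset.mul_sum, sum_partialSum κ (fun a => (H ^ 2) ^ a), hm,
      sum_lt_partialSum κ (fun a => (H ^ 2) ^ a), Finset.sum_ite_eq' Finset.univ j]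
    simp only [Finset.mem_univ, if_true, pow_add, ← Finset.mul_sum]
    rw [geom_sum_eq hH2, geom_sum_eq hH2, geom_sum_eq hH2,
      ← pow_mul H m 2, mul_comm m 2, pow_mul H 2 m]
    ring
  rw [hsum, hf0]
  have e1 := exponent_identity_aux (h0 := h 0) (h1 := h 1) (H := H) (C := C) (M := H ^ m)
    (P := (H ^ 2) ^ partialSum κ j) (hh 0) (hh 1) hH hC0 (pow_ne_zero _ hH) hH2 hC
    (((H ^ 2) ^ κ j - 1) / (h (c j) ^ 2 - 1))
  have e2 := exponent_identity_term hh hprod hh2 (c j) (κ j) (hκ j) ((H ^ 2) ^ partialSum κ j)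
  rw [kapHalf, ← hHdef]
  rw [← hHdef] at e2
  rw [e1, e2, numIdx, pow_add]

end

end EllipticCorner

end

noncomputable section

namespace EllipticCorner

variable {n : ℕ}

/-! ## Genericity -/

theorem halfPow_sq_ne_one {ε : Fin 3 → ℂ}
    (hgen : ∀ L M N : ℤ, qPow ε 0 1 ^ L * qPow ε 1 1 ^ M * qPow ε 2 1 ^ N = 1 → L = M ∧ M = N)
    {N : ℕ} (hN : 1 ≤ N) (i : Fin 3) : halfPow ε N i ^ 2 ≠ 1 := by
  rw [halfPow_sq]
  intro h
  fin_cases i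
  · have := hgen N 0 0 (by simpa using h)
    omega
  · have := hgen 0 N 0 (by simpa using h)
    omega
  · have := hgen 0 0 N (by simpa using h)
    omega

theorem prod_qPow {ε : Fin 3 → ℂ} (c : Fin n → Fin 3) (N : ℕ) :
    ∏ k, qPow ε (c k) 1 ^ N = ∏ i : Fin 3,
      qPow ε i 1 ^ (((Finset.univ.filter fun k => c k = i).card) * N) := by
  rw [← Finset.prod_fiberwise Finset.univ c]
  refine Finset.prod_congr rfl fun i _ => ?_
  rw [mul_comm, pow_mul, ← Finset.prod_const]
  exact Finset.prod_congr rfl fun k hk => by rw [(Finset.mem_filter.mp hk).2]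

theorem prod_halfPow_sq_ne_one {ε : Fin 3 → ℂ} (hε : ε 0 + ε 1 + ε 2 = 0)
    (hgen : ∀ L M N : ℤ, qPow ε 0 1 ^ L * qPow ε 1 1 ^ M * qPow ε 2 1 ^ N = 1 → L = M ∧ M = N)
    (c : Fin n → Fin 3) (hc : qTot ε c 1 ≠ 1) {N : ℕ} (hN : 1 ≤ N) :
    (∏ k, halfPow ε N (c k)) ^ 2 ≠ 1 := by
  rw [← Finset.prod_pow]
  simp only [halfPow_sq]
  rw [prod_qPow, Fin.prod_univ_three]
  intro h
  have h1 := hgen ((_ : ℕ) : ℤ) ((_ : ℕ) : ℤ) ((_ : ℕ) : ℤ) (by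
    rw [zpow_natCast, zpow_natCast, zpow_natCast]
    exact h)
  apply hc
  have h2 := prod_qPow (ε := ε) c 1
  simp only [pow_one, mul_one] at h2
  rw [qTot, h2, Fin.prod_univ_three]
  have hN' : (N : ℤ) ≠ 0 := by omega
  have e1 : (Finset.univ.filter fun k => c k = 0).card =
      (Finset.univ.filter fun k => c k = 1).card := by
    have := h1.1
    push_cast at this
    exact_mod_cast mul_right_cancel₀ hN' this
  have e2 : (Finset.univ.filter fun k => c k = 1).card =
      (Finset.univ.filter fun k => c k = 2).card := by
    have := h1.2
    push_cast at this
    exact_mod_cast mul_right_cancel₀ hN' this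
  rw [e1, e2, ← mul_pow, ← mul_pow]
  have : qPow ε 0 1 * qPow ε 1 1 * qPow ε 2 1 = 1 := by
    simp only [qPow, one_mul]
    rw [← Complex.exp_add, ← Complex.exp_add, hε, Complex.exp_zero]
  rw [this, one_pow]

theorem halfPow_prod {ε : Fin 3 → ℂ} (hε : ε 0 + ε 1 + ε 2 = 0) (N : ℕ) :
    halfPow ε N 0 * halfPow ε N 1 * halfPow ε N 2 = 1 := by
  simp only [halfPow, qPow]
  rw [← Complex.exp_add, ← Complex.exp_add, ← mul_add, ← mul_add, hε, mul_zero, Complex.exp_zero]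

/-! ## The operator product of two terms -/

section

variable (ε : Fin 3 → ℂ) (c : Fin n → Fin 3) (κ l : Fin n → ℕ)

/-- Arguments of the theta functions in the structure function of two terms: the first two are
those of the numerator, the last two those of the denominator. -/
def numArg₁ (x : ℂ) (j : Fin n) (b : ℕ) : ℂ :=
  qPow ε (numIdx c κ j) 1 * qPow ε 2 1 ^ partialSum κ j / qPow ε 2 1 ^ (partialSum l j + b) * x

/-- The second argument of the theta functions in the numerators. -/
def numArg₂ (x : ℂ) (j : Fin n) (b : ℕ) : ℂ :=
  (qPow ε (numIdx c κ j) 1)⁻¹ * qPow ε 2 1 ^ (partialSum κ j + κ j)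
    / qPow ε 2 1 ^ (partialSum l j + b + 1) * x

/-- The first argument of the theta functions in the denominators. -/
def denArg₁ (x : ℂ) (j : Fin n) (b : ℕ) : ℂ :=
  qPow ε 2 1 ^ (partialSum κ j + κ j) / qPow ε 2 1 ^ (partialSum l j + b) * x

/-- The second argument of the theta functions in the denominators. -/
def denArg₂ (x : ℂ) (j : Fin n) (b : ℕ) : ℂ :=
  qPow ε 2 1 ^ partialSum κ j / qPow ε 2 1 ^ (partialSum l j + b + 1) * x

end

theorem coeff_pochLog_pair {p : ℂ} (hp : ‖p‖ < 1) (y : ℂ) {N : ℕ} (hN : 1 ≤ N) :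
    PowerSeries.coeff N (pochLog p y + pochLog p (p * y⁻¹))
      = -(1 / (N * (1 - p ^ N))) * (y ^ N + p ^ N * (y ^ N)⁻¹) := by
  have h1 := one_sub_pow_ne_zero hp hN
  have h2 : (N : ℂ) ≠ 0 := by exact_mod_cast (by omega : N ≠ 0)
  simp only [pochLog, map_add, PowerSeries.coeff_mk, mul_pow, inv_pow]
  field_simp
  ring

/-- The exponent of `fSeries`. -/
def fLog (ε : Fin 3 → ℂ) (p : ℂ) (c : Fin n → Fin 3) (m r : ℕ) (x : ℂ) : PowerSeries ℂ :=
  (PowerSeries.mk fun k : ℕ => if k = 0 then 0 else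
        x ^ k / k * (1 / (1 - p ^ k)) * fCoeff ε c (min m r) (max m r) k) +
  PowerSeries.mk fun k : ℕ => if k = 0 then 0 else
        x⁻¹ ^ k / k * (p ^ k / (1 - p ^ k)) * fCoeff ε c (min m r) (max m r) k

theorem fSeries_isExp (ε : Fin 3 → ℂ) (p : ℂ) (c : Fin n → Fin 3) (m r : ℕ) (x : ℂ) :
    IsExp (fLog ε p c m r x) (fSeries ε p c m r x) :=
  (isExp_subst (by simp)).mul (isExp_subst (by simp))

theorem fCoeff_eq (ε : Fin 3 → ℂ) (c : Fin n → Fin 3) (r m N : ℕ) :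
    fCoeff ε c r m N = fHalf (halfPow ε N) (∏ k, halfPow ε N (c k)) r m := by
  have h1 : ∀ s : ℕ, qPow ε 2 (s * N / 2) = halfPow ε N 2 ^ s := fun s => by
    rw [halfPow, ← qPow_nat_mul]
    congr 1
    ring
  have h2 : ∀ s : ℕ, qPow ε 2 (-(s * N / 2)) = (halfPow ε N 2 ^ s)⁻¹ := fun s => by
    rw [qPow_neg, h1]
  have h3 : qTot ε c (N / 2) = ∏ k, halfPow ε N (c k) := rfl
  have h4 : qTot ε c (-(N / 2)) = (∏ k, halfPow ε N (c k))⁻¹ := by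
    rw [qTot, ← Finset.prod_inv_distrib]
    exact Finset.prod_congr rfl fun k _ => qPow_neg _ _ _
  have h5 : ∀ i, qPow ε i (N / 2) = halfPow ε N i := fun i => rfl
  have h6 : ∀ i, qPow ε i (-(N / 2)) = (halfPow ε N i)⁻¹ := fun i => qPow_neg _ _ _
  rw [fCoeff, fHalf, h1, h2, h2, h1, h3, h4]
  simp only [h5, h6]

theorem fHalf_inv (h : Fin 3 → ℂ) (C : ℂ) (r m : ℕ) :
    fHalf (fun i => (h i)⁻¹) C⁻¹ r m = fHalf h C r m := by
  simp only [fHalf, inv_inv, inv_pow]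
  have e1 : ∀ a : ℂ, a⁻¹ - a = -(a - a⁻¹) := fun a => by ring
  rw [e1 (h 0), e1 (h 1), e1 (h 2), e1 C, e1 (h 2 ^ r)]
  have e2 : C⁻¹ * h 2 ^ m - C * (h 2 ^ m)⁻¹ = -(C * (h 2 ^ m)⁻¹ - C⁻¹ * h 2 ^ m) := by ring
  rw [e2]
  simp only [neg_mul_neg]

theorem structure_identity {ε : Fin 3 → ℂ} (hε : ε 0 + ε 1 + ε 2 = 0)
    (hgen : ∀ L M N : ℤ, qPow ε 0 1 ^ L * qPow ε 1 1 ^ M * qPow ε 2 1 ^ N = 1 → L = M ∧ M = N)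
    {p : ℂ} (hp₀ : p ≠ 0) (hp : ‖p‖ < 1) (c : Fin n → Fin 3) (hc : qTot ε c 1 ≠ 1)
    {m r : ℕ} (hrm : r ≤ m) (κ l : Fin n → ℕ) (hκ : ∀ j, c j = 2 → κ j ≤ 1)
    (hm : ∑ i, κ i = m) (hr : ∑ i, l i = r) {w z : ℂ} (hw : w ≠ 0) (hz : z ≠ 0) :
    fSeries ε p c m r (qPow ε 2 ((m - r) / 2) * (z / w)) *
      levelSeries (expGen fun o => (termSym ε p c κ w).2 o * comm ε p c o *
        (termSym ε p c l z).1 o) *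
      ∏ j, ∏ b ∈ Finset.range (l j),
        (thetaSeries hp (denArg₁ ε κ l (z / w) j b) * thetaSeries hp (denArg₂ ε κ l (z / w) j b))
      = ∏ j, ∏ b ∈ Finset.range (l j),
        (thetaSeries hp (numArg₁ ε c κ l (z / w) j b) *
          thetaSeries hp (numArg₂ ε c κ l (z / w) j b)) := by
  have hden := IsExp.prod Finset.univ fun j _ => IsExp.prod (Finset.range (l j)) fun b _ =>
    (thetaSeries_isExp hp (denArg₁ ε κ l (z / w) j b)).mul
      (thetaSeries_isExp hp (denArg₂ ε κ l (z / w) j b))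
  have hnum := IsExp.prod Finset.univ fun j _ => IsExp.prod (Finset.range (l j)) fun b _ =>
    (thetaSeries_isExp hp (numArg₁ ε c κ l (z / w) j b)).mul
      (thetaSeries_isExp hp (numArg₂ ε c κ l (z / w) j b))
  have hlhs := ((fSeries_isExp ε p c m r (qPow ε 2 ((m - r) / 2) * (z / w))).mul
    (isExp_levelSeries fun o => (termSym ε p c κ w).2 o * comm ε p c o *
        (termSym ε p c l z).1 o)).mul hden
  refine (hlhs.congr fun N hN => ?_).unique hnum
  obtain ⟨N, rfl⟩ : ∃ N' : ℕ+, N = N' := ⟨⟨N, hN⟩, rfl⟩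
  set x := z / w with hx
  have hx0 : x ≠ 0 := div_ne_zero hz hw
  have hpN := one_sub_pow_ne_zero hp hN
  have hNN : ((N : ℕ) : ℂ) ≠ 0 := by exact_mod_cast N.pos.ne'
  set h : Fin 3 → ℂ := halfPow ε N with hh
  have hh0 : ∀ i, h i ≠ 0 := halfPow_ne_zero ε N
  have hh2 : ∀ i, h i ^ 2 ≠ 1 := halfPow_sq_ne_one hgen hN
  have hhC : (∏ k, h (c k)) ^ 2 ≠ 1 := prod_halfPow_sq_ne_one hε hgen c hc hN
  have hhp : h 0 * h 1 * h 2 = 1 := halfPow_prod hε N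
  have hQ : ∀ i, qPow ε i 1 ^ (N : ℕ) = h i ^ 2 := fun i => (halfPow_sq ε N i).symm
  set h' : Fin 3 → ℂ := fun i => (h i)⁻¹ with hh'
  have id1 := exponent_identity c hh0 hhp hh2 hhC κ l hκ hm hr
  have id2 := exponent_identity c (h := h') (fun i => inv_ne_zero (hh0 i))
    (by simp only [hh', ← mul_inv, hhp, inv_one])
    (fun i h => hh2 i (by simp only [hh', inv_pow] at h; exact inv_eq_one.mp h))
    (fun h => hhC (by
      simp only [hh', Finset.prod_inv_distrib, inv_pow] at h; exact inv_eq_one.mp h))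
    κ l hκ hm hr
  set U := (1 : ℂ) / ((N : ℕ) * (1 - p ^ (N : ℕ))) with hU
  -- the four kinds of exponents
  have hf : PowerSeries.coeff N (fLog ε p c m r (qPow ε 2 ((m - r) / 2) * x))
      = U * (x ^ (N : ℕ) * (h 2 ^ m / h 2 ^ r * fHalf h (∏ k, h (c k)) r m))
        + U * (p ^ (N : ℕ) * (x ^ (N : ℕ))⁻¹ *
          (h' 2 ^ m / h' 2 ^ r * fHalf h' (∏ k, h' (c k)) r m)) := by
    have e1 : qPow ε 2 ((m - r) / 2) ^ (N : ℕ) = h 2 ^ m / h 2 ^ r := by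
      rw [eq_div_iff (pow_ne_zero _ (hh0 2)), hh]
      simp only [halfPow]
      rw [← qPow_nat_mul, ← qPow_nat_mul, ← qPow_nat_mul, ← qPow_add]
      congr 1
      ring
    have e2 : fHalf h' (∏ k, h' (c k)) r m = fHalf h (∏ k, h (c k)) r m := by
      simp only [hh', Finset.prod_inv_distrib]
      exact fHalf_inv _ _ _ _
    rw [e2, fLog, map_add, PowerSeries.coeff_mk, PowerSeries.coeff_mk, if_neg N.pos.ne',
      if_neg N.pos.ne', min_eq_right hrm, max_eq_left hrm, fCoeff_eq, ← hh, mul_inv, mul_pow, mul_pow,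
      inv_pow, e1, hU]
    simp only [hh', inv_pow]
    have h4 := pow_ne_zero m (hh0 2)
    have h5 := pow_ne_zero r (hh0 2)
    field_simp
  have hcon : PowerSeries.coeff N (levelSeries (linForm fun o => (termSym ε p c κ w).2 o *
      comm ε p c o * (termSym ε p c l z).1 o))
      = U * (x ^ (N : ℕ) * ∑ i, ∑ a ∈ Finset.range (κ i), ∑ j, ∑ b ∈ Finset.range (l j),
        ((h 2 ^ 2) ^ (partialSum κ i + a) / (h 2 ^ 2) ^ (partialSum l j + b)) *
          (kapHalf h * contrConst (fun k => h (c k)) i j))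
        + U * (p ^ (N : ℕ) * (x ^ (N : ℕ))⁻¹ *
          ∑ i, ∑ a ∈ Finset.range (κ i), ∑ j, ∑ b ∈ Finset.range (l j),
        ((h' 2 ^ 2) ^ (partialSum κ i + a) / (h' 2 ^ 2) ^ (partialSum l j + b)) *
          (kapHalf h' * contrConst (fun k => h' (c k)) i j)) := by
    have e0 : kapHalf h' = -kapHalf h := by
      simp only [kapHalf, hh', inv_inv]
      ring
    have e1 : kappa ε N = kapHalf h := by
      rw [kappa, Fin.prod_univ_three, kapHalf, qPow_nat, qPow_nat, qPow_nat, hQ, hQ, hQ]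
      have n0 := hh0 0
      have n1 := hh0 1
      have n2 := hh0 2
      field_simp
      linear_combination ((h 0 ^ 2 - 1) * (h 1 ^ 2 - 1) * (h 2 ^ 2 - 1)) * hhp
    have e2 := coeff_contraction_sum ε p c (Finset.univ.sigma fun i => Finset.range (κ i))
      (Finset.univ.sigma fun j => Finset.range (l j))
      (fun ia => tildeSym ε p c ia.1 (qPow ε 2 (-((partialSum κ ia.1 + ia.2 : ℕ) : ℂ)) * w))
      (fun jb => tildeSym ε p c jb.1 (qPow ε 2 (-((partialSum l jb.1 + jb.2 : ℕ) : ℂ)) * z)) N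
    rw [Finset.sum_sigma, Finset.sum_sigma] at e2
    simp only [Finset.sum_sigma] at e2
    refine Eq.trans e2 ?_
    simp only [Finset.mul_sum, ← Finset.sum_add_distrib]
    refine Finset.sum_congr rfl fun i _ => Finset.sum_congr rfl fun a _ =>
      Finset.sum_congr rfl fun j _ => Finset.sum_congr rfl fun b _ => ?_
    rw [coeff_contraction_tildeSym ε c hp hp₀ N hh2 hhC, aNorm, bNorm, e1, e0, hU]
    have e3 : ∀ s : ℕ, qPow ε 2 (-(s : ℂ)) ^ (N : ℕ) = ((h 2 ^ 2) ^ s)⁻¹ := fun s => by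
      rw [qPow_neg, inv_pow, qPow_nat, ← pow_mul, mul_comm, pow_mul, hQ]
    simp only [hh', div_pow, mul_pow, e3, hx, inv_pow]
    have h4 := pow_ne_zero (partialSum κ i + a) (pow_ne_zero 2 (hh0 2))
    have h5 := pow_ne_zero (partialSum l j + b) (pow_ne_zero 2 (hh0 2))
    have h6 := pow_ne_zero N hz
    have h7 := pow_ne_zero N hw
    field_simp
    ring
  have hD : PowerSeries.coeff N (∑ j, ∑ b ∈ Finset.range (l j),
      (pochLog p (denArg₁ ε κ l x j b) + pochLog p (p * (denArg₁ ε κ l x j b)⁻¹) +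
        (pochLog p (denArg₂ ε κ l x j b) + pochLog p (p * (denArg₂ ε κ l x j b)⁻¹))))
      - PowerSeries.coeff N (∑ j, ∑ b ∈ Finset.range (l j),
      (pochLog p (numArg₁ ε c κ l x j b) + pochLog p (p * (numArg₁ ε c κ l x j b)⁻¹) +
        (pochLog p (numArg₂ ε c κ l x j b) + pochLog p (p * (numArg₂ ε c κ l x j b)⁻¹))))
      = -(U * (x ^ (N : ℕ) * ∑ j, ∑ b ∈ Finset.range (l j), ((h 2 ^ 2) ^ (partialSum l j + b))⁻¹ *
        ((h 2 ^ 2) ^ (partialSum κ j + κ j) + (h 2 ^ 2) ^ partialSum κ j / h 2 ^ 2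
          - h (numIdx c κ j) ^ 2 * (h 2 ^ 2) ^ partialSum κ j
          - (h 2 ^ 2) ^ (partialSum κ j + κ j) / (h (numIdx c κ j) ^ 2 * h 2 ^ 2)))
        + U * (p ^ (N : ℕ) * (x ^ (N : ℕ))⁻¹ *
          ∑ j, ∑ b ∈ Finset.range (l j), ((h' 2 ^ 2) ^ (partialSum l j + b))⁻¹ *
        ((h' 2 ^ 2) ^ (partialSum κ j + κ j) + (h' 2 ^ 2) ^ partialSum κ j / h' 2 ^ 2
          - h' (numIdx c κ j) ^ 2 * (h' 2 ^ 2) ^ partialSum κ j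
          - (h' 2 ^ 2) ^ (partialSum κ j + κ j) / (h' (numIdx c κ j) ^ 2 * h' 2 ^ 2)))) := by
    simp only [map_sum, Finset.mul_sum, ← Finset.sum_add_distrib, ← Finset.sum_sub_distrib,
      ← Finset.sum_neg_distrib]
    refine Finset.sum_congr rfl fun j _ => Finset.sum_congr rfl fun b _ => ?_
    have e0 : ∀ y y' : ℂ, PowerSeries.coeff N (pochLog p y + pochLog p (p * y⁻¹) +
        (pochLog p y' + pochLog p (p * y'⁻¹))) = -U * (y ^ (N : ℕ) + p ^ (N : ℕ) *
          (y ^ (N : ℕ))⁻¹) + -U * (y' ^ (N : ℕ) + p ^ (N : ℕ) * (y' ^ (N : ℕ))⁻¹) := by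
      intro y y'
      rw [map_add _ (_ + _) (_ + _), coeff_pochLog_pair hp _ hN, coeff_pochLog_pair hp _ hN]
    rw [e0, e0]
    have e3 : ∀ s : ℕ, (qPow ε 2 1 ^ s) ^ (N : ℕ) = (h 2 ^ 2) ^ s := fun s => by
      rw [← pow_mul, mul_comm, pow_mul, hQ]
    simp only [denArg₁, denArg₂, numArg₁, numArg₂, hh', div_pow, mul_pow, inv_pow, e3, hQ]
    have h3 := hh0 (numIdx c κ j)
    have h4 := pow_ne_zero (partialSum κ j) (pow_ne_zero 2 (hh0 2))
    have h5 := pow_ne_zero (partialSum l j) (pow_ne_zero 2 (hh0 2))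
    have h6 := pow_ne_zero (κ j) (pow_ne_zero 2 (hh0 2))
    have h7 := pow_ne_zero b (pow_ne_zero 2 (hh0 2))
    have h8 := hh0 2
    have h9 := pow_ne_zero N hx0
    simp only [pow_add, pow_one]
    field_simp
    ring
  rw [map_add, map_add, hf, hcon]
  rw [← id1, ← id2] at hD
  linear_combination hD

end EllipticCorner

end

noncomputable section

namespace EllipticCorner

variable {n : ℕ}

/-! ## Continuity of matrix elements -/

theorem continuousAt_coeff_expGen {x : ℂ → Osc n → ℂ} {w₀ : ℂ}
    (hx : ∀ o, ContinuousAt (fun w => x w o) w₀) (ν : Osc n →₀ ℕ) :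
    ContinuousAt (fun w => MvPowerSeries.coeff ν (expGen (x w))) w₀ := by
  simp only [expGen, coeff_ofCoeff, Finsupp.prod]
  have h : ∀ o, ContinuousAt (fun w => ((ν o).factorial : ℂ)⁻¹ * x w o ^ ν o) w₀ := fun o =>
    continuousAt_const.mul ((hx o).pow _)
  exact tendsto_finsetProd _ fun o _ => h o

theorem continuousAt_coeff_shift {d : ℂ → Osc n → ℂ} {w₀ : ℂ}
    (hd : ∀ o, ContinuousAt (fun w => d w o) w₀) (v : Fock n) (ν : Osc n →₀ ℕ) :
    ContinuousAt (fun w => MvPolynomial.coeff ν (shift (d w) v)) w₀ := by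
  induction v using MvPolynomial.induction_on generalizing ν with
  | C a => simp [shift, continuousAt_const]
  | add P Q hP hQ =>
    simp only [map_add, MvPolynomial.coeff_add]
    exact (hP ν).add (hQ ν)
  | mul_X P o hP =>
    have hX : ∀ w, MvPolynomial.coeff ν (shift (d w) (P * MvPolynomial.X o)) =
        (if o ∈ ν.support then MvPolynomial.coeff (ν - Finsupp.single o 1) (shift (d w) P) else 0) +
          d w o * MvPolynomial.coeff ν (shift (d w) P) := fun w => by
      rw [map_mul (shift (d w)), shift_X, mul_add, MvPolynomial.coeff_add,
        MvPolynomial.coeff_mul_X', mul_comm _ (MvPolynomial.C _), MvPolynomial.coeff_C_mul]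
    simp only [hX]
    refine ContinuousAt.add ?_ ((hd o).mul (hP ν))
    split_ifs
    · exact hP _
    · exact continuousAt_const

theorem continuousAt_coeff_vertexOp (ε : Fin 3 → ℂ) (p : ℂ) (c : Fin n → Fin 3) {s : ℂ → VSym n}
    {w₀ : ℂ} (h1 : ∀ o, ContinuousAt (fun w => (s w).1 o) w₀)
    (h2 : ∀ o, ContinuousAt (fun w => (s w).2 o) w₀) (μ : Osc n →₀ ℕ) (v : Fock n) :
    ContinuousAt (fun w => MvPowerSeries.coeff μ (vertexOp ε p c (s w) v)) w₀ := by
  simp only [vertexOp, expCreation_eq, MvPowerSeries.coeff_mul, MvPolynomial.coeff_coe]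
  exact tendsto_finsetSum _ fun στ _ => (continuousAt_coeff_expGen h1 _).mul
    (continuousAt_coeff_shift (fun o => (h2 o).mul continuousAt_const) _ _)

theorem continuousAt_tildeSym (ε : Fin 3 → ℂ) (p : ℂ) (c : Fin n → Fin 3) (i : Fin n) {w₀ : ℂ}
    (hw : w₀ ≠ 0) (o : Osc n) : ContinuousAt (fun w => (tildeSym ε p c i w).1 o) w₀ ∧
      ContinuousAt (fun w => (tildeSym ε p c i w).2 o) w₀ := by
  have hpos : ∀ a A : ℂ, ∀ N : ℕ, ContinuousAt (fun w : ℂ => A * (a * w) ^ N) w₀ := fun a A N => by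
    fun_prop
  have hneg : ∀ a A : ℂ, ∀ N : ℕ, ContinuousAt (fun w : ℂ => A * (a * w)⁻¹ ^ N) w₀ := by
    intro a A N
    simp only [mul_inv]
    exact continuousAt_const.mul ((continuousAt_const.mul (continuousAt_inv₀ hw)).pow N)
  rcases o with ⟨k, N⟩ | ⟨k, N⟩
  · constructor
    · simp only [tildeSym, alphaSym, lambdaSym, betaSym, Prod.fst_add, Pi.add_apply, Sum.elim_inl,
        Pi.zero_apply, add_zero, phiA, etaCreA]
      refine ContinuousAt.add ((hpos _ _ _).neg.div_const _) ?_
      split_ifs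
      · exact (hpos _ _ _).neg
      · exact hpos _ _ _
      · exact continuousAt_const
    · simp only [tildeSym, alphaSym, lambdaSym, betaSym, Prod.snd_add, Pi.add_apply, Sum.elim_inl,
        zero_add, kPlusA, etaAnnA]
      refine ContinuousAt.add ?_ ((continuousAt_const.mul (hneg _ _ _)).div_const _)
      split_ifs
      · exact (hneg _ _ _).neg
      · exact continuousAt_const
  · constructor
    · simp only [tildeSym, alphaSym, lambdaSym, betaSym, Prod.fst_add, Pi.add_apply, Sum.elim_inr,
        Pi.zero_apply, add_zero, phiB, etaCreB]
      refine ContinuousAt.add ((hneg _ _ _).div_const _).neg ?_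
      split_ifs
      · exact hneg _ _ _
      · exact hneg _ _ _
      · exact continuousAt_const
    · simp only [tildeSym, alphaSym, lambdaSym, betaSym, Prod.snd_add, Pi.add_apply, Sum.elim_inr,
        zero_add, kPlusB, etaAnnB]
      refine ContinuousAt.add ?_ ((continuousAt_const.mul (hpos _ _ _).neg).div_const _).neg
      split_ifs
      · exact hpos _ _ _
      · exact continuousAt_const

theorem continuousAt_termSym (ε : Fin 3 → ℂ) (p : ℂ) (c : Fin n → Fin 3) (κ : Fin n → ℕ) {w₀ : ℂ}
    (hw : w₀ ≠ 0) (o : Osc n) : ContinuousAt (fun w => (termSym ε p c κ w).1 o) w₀ ∧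
      ContinuousAt (fun w => (termSym ε p c κ w).2 o) w₀ := by
  have h : ∀ i, ∀ a : ℂ, a ≠ 0 → ContinuousAt (fun w => (tildeSym ε p c i (a * w)).1 o) w₀ ∧
      ContinuousAt (fun w => (tildeSym ε p c i (a * w)).2 o) w₀ := by
    intro i a ha
    have h0 := continuousAt_tildeSym ε p c i (mul_ne_zero ha hw) o
    have hc : ContinuousAt (fun w => a * w) w₀ := by fun_prop
    exact ⟨ContinuousAt.comp (f := fun w => a * w) h0.1 hc,
      ContinuousAt.comp (f := fun w => a * w) h0.2 hc⟩
  simp only [termSym, Prod.fst_sum, Prod.snd_sum, Finset.sum_apply]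
  exact ⟨tendsto_finsetSum _ fun i _ => tendsto_finsetSum _ fun a _ =>
    (h i _ (qPow_ne_zero _ _ _)).1, tendsto_finsetSum _ fun i _ => tendsto_finsetSum _ fun a _ =>
    (h i _ (qPow_ne_zero _ _ _)).2⟩

/-! ## Continued sums of operator products -/

theorem HasContinuedSum.sum {ι : Type*} (s : Finset ι) {A : ι → PowerSeries ℂ} {a : ι → ℂ}
    (h : ∀ i ∈ s, HasContinuedSum (A i) (a i)) :
    HasContinuedSum (∑ i ∈ s, A i) (∑ i ∈ s, a i) := by
  choose! g hg using h
  refine ⟨fun t => ∑ i ∈ s, g i t, ?_, ?_, ?_, ?_⟩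
  · exact (Continues.sum s fun i hi => ⟨(hg i hi).1, (hg i hi).2.1⟩).1
  · exact (Continues.sum s fun i hi => ⟨(hg i hi).1, (hg i hi).2.1⟩).2
  · exact Finset.analyticAt_fun_sum s fun i hi => (hg i hi).2.2.1
  · exact Finset.sum_congr rfl fun i hi => (hg i hi).2.2.2

theorem HasContinuedSum.zero : HasContinuedSum 0 0 :=
  Continues.zero.hasContinuedSum analyticAt_const

section

variable (ε : Fin 3 → ℂ) (p : ℂ) (c : Fin n → Fin 3) (κ l : Fin n → ℕ)

/-- One factor of the structure function of two terms. -/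
def structFactor (x : ℂ) (j : Fin n) (b : ℕ) : ℂ :=
  theta p (numArg₁ ε c κ l x j b) * theta p (numArg₂ ε c κ l x j b) /
    (theta p (denArg₁ ε κ l x j b) * theta p (denArg₂ ε κ l x j b))

/-- The structure function of two terms. -/
def structFun (x : ℂ) : ℂ := ∏ j, ∏ b ∈ Finset.range (l j), structFactor ε p c κ l x j b

end

theorem hasContinuedSum_term {ε : Fin 3 → ℂ} (hε : ε 0 + ε 1 + ε 2 = 0)
    (hgen : ∀ L M N : ℤ, qPow ε 0 1 ^ L * qPow ε 1 1 ^ M * qPow ε 2 1 ^ N = 1 → L = M ∧ M = N)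
    {p : ℂ} (hp₀ : p ≠ 0) (hp : ‖p‖ < 1) (c : Fin n → Fin 3) (hc : qTot ε c 1 ≠ 1)
    {m r : ℕ} (hrm : r ≤ m) (κ l : Fin n → ℕ) (a a' : ℂ) (hκ : a ≠ 0 → ∀ j, c j = 2 → κ j ≤ 1)
    (hm : ∑ i, κ i = m) (hr : ∑ i, l i = r) {w z : ℂ} (hw : w ≠ 0) (hz : z ≠ 0)
    (hden : ∀ j, ∀ b ∈ Finset.range (l j), theta p (denArg₁ ε κ l (z / w) j b) ≠ 0 ∧
      theta p (denArg₂ ε κ l (z / w) j b) ≠ 0) (μ : Osc n →₀ ℕ) (v : Fock n) :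
    HasContinuedSum (fSeries ε p c m r (qPow ε 2 ((m - r) / 2) * (z / w)) *
        productSeries ε p c (AddMonoidAlgebra.single (termSym ε p c κ w) a)
          (AddMonoidAlgebra.single (termSym ε p c l z) a') μ v)
      (a * a' * structFun ε p c κ l (z / w) *
        MvPowerSeries.coeff μ (vertexOp ε p c (termSym ε p c κ w + termSym ε p c l z) v)) := by
  obtain ⟨P, hP, hP1⟩ := productSeries_single ε p c (termSym ε p c κ w) (termSym ε p c l z) a a' μ v
  rcases eq_or_ne a 0 with ha | ha
  · rw [hP, ha]
    simpa using HasContinuedSum.zero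
  have hid := structure_identity hε hgen hp₀ hp c hc hrm κ l (hκ ha) hm hr hw hz
  have hA := Continues.prod Finset.univ fun j _ => Continues.prod (Finset.range (l j)) fun b _ =>
    (thetaSeries_continues hp (numArg₁ ε c κ l (z / w) j b)).mul
      (thetaSeries_continues hp (numArg₂ ε c κ l (z / w) j b))
  have hD := Continues.prod Finset.univ fun j _ => Continues.prod (Finset.range (l j)) fun b _ =>
    (thetaSeries_continues hp (denArg₁ ε κ l (z / w) j b)).mul
      (thetaSeries_continues hp (denArg₂ ε κ l (z / w) j b))
  have hdiff : ∀ f g : Fin n → ℕ → ℂ, Differentiable ℂ fun t => ∏ j, ∏ b ∈ Finset.range (l j),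
      (thetaDef p (f j b) t * thetaDef p (g j b) t) := by
    intro f g
    refine Differentiable.fun_finsetProd fun j _ => Differentiable.fun_finsetProd fun b _ => ?_
    exact (thetaDef_differentiable hp _).mul (thetaDef_differentiable hp _)
  have hD0 := (hdiff (denArg₁ ε κ l (z / w)) (denArg₂ ε κ l (z / w)))
  have hB := hA.div hD (hD0.analyticAt 0) (by simp [thetaDef_zero]) hid
  have hall := (Continues.polynomial (Polynomial.C (a * a') * P)).mul hB
  have hne : ∏ j, ∏ b ∈ Finset.range (l j), (thetaDef p (denArg₁ ε κ l (z / w) j b) 1 *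
      thetaDef p (denArg₂ ε κ l (z / w) j b) 1) ≠ 0 := by
    refine Finset.prod_ne_zero_iff.mpr fun j _ => Finset.prod_ne_zero_iff.mpr fun b hb => ?_
    rw [thetaDef_one, thetaDef_one]
    exact mul_ne_zero (hden j b hb).1 (hden j b hb).2
  have hfin := hall.hasContinuedSum ?_
  · convert hfin using 1
    · rw [hP, Polynomial.coe_mul, Polynomial.coe_C]
      ring
    · rw [Polynomial.eval_mul, Polynomial.eval_C, hP1, structFun]
      simp only [structFactor, thetaDef_one, Finset.prod_div_distrib]
      ring
  · refine AnalyticAt.fun_mul ?_ (AnalyticAt.fun_div ((hdiff _ _).analyticAt 1)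
      (hD0.analyticAt 1) hne)
    exact (by fun_prop : Differentiable ℂ fun t => (Polynomial.C (a * a') * P).eval t).analyticAt 1

end EllipticCorner

end

noncomputable section

namespace EllipticCorner

variable {n : ℕ}

/-! ## The coefficients of the Miura factors -/

section

variable (ε : Fin 3 → ℂ) (p : ℂ)

/-- The ratio of consecutive coefficients of a Miura factor. -/
def miuraRatio (i : Fin 3) (s : ℕ) : ℂ :=
  -(qPow ε 2 (1 / 2) * qPow ε i (1 / 2)) * theta p (qPow ε 2 1 ^ s / qPow ε i 1) /
    theta p (qPow ε 2 1 ^ (s + 1))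

variable {p}

theorem miuraCoeff_eq_prod (hp : ‖p‖ < 1) (i : Fin 3) (k : ℕ) :
    miuraCoeff ε p i k = ∏ s ∈ Finset.range k, miuraRatio ε p i s := by
  have hscal : qPow ε 2 ((k : ℂ) ^ 2 / 2) * qPow ε i (-(k / 2)) *
      ∏ s ∈ Finset.range k, (-(qPow ε i 1 / qPow ε 2 1 ^ s)) =
      (-(qPow ε 2 (1 / 2) * qPow ε i (1 / 2))) ^ k := by
    induction k with
    | zero => simp [qPow_zero]
    | succ k ih =>
      have e1 : qPow ε 2 (((k + 1 : ℕ) : ℂ) ^ 2 / 2) =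
          qPow ε 2 ((k : ℂ) ^ 2 / 2) * (qPow ε 2 1 ^ k * qPow ε 2 (1 / 2)) := by
        rw [← qPow_nat, ← qPow_add, ← qPow_add]
        push_cast
        congr 1
        ring
      have e2 : qPow ε i (-(((k + 1 : ℕ) : ℂ) / 2)) * qPow ε i 1 =
          qPow ε i (-(k / 2)) * qPow ε i (1 / 2) := by
        rw [← qPow_add, ← qPow_add]
        push_cast
        congr 1
        ring
      have e3 : qPow ε 2 1 ^ k ≠ 0 := pow_ne_zero _ (qPow_ne_zero _ _ _)
      rw [Finset.prod_range_succ, pow_succ (-(qPow ε 2 (1 / 2) * qPow ε i (1 / 2))), ← ih, e1]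
      calc _ = qPow ε 2 ((k : ℂ) ^ 2 / 2) * (qPow ε 2 1 ^ k / qPow ε 2 1 ^ k) * qPow ε 2 (1 / 2) *
            (qPow ε i (-(((k + 1 : ℕ) : ℂ) / 2)) * qPow ε i 1) *
            (∏ s ∈ Finset.range k, (-(qPow ε i 1 / qPow ε 2 1 ^ s))) * (-1) := by ring
        _ = _ := by
          rw [e2, div_self e3]
          ring
  have hnum : thetaFactorial p (qPow ε 2 1) (qPow ε 2 (1 - k) * qPow ε i 1) k =
      ∏ s ∈ Finset.range k, (-(qPow ε i 1 / qPow ε 2 1 ^ s) *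
        theta p (qPow ε 2 1 ^ s / qPow ε i 1)) := by
    rw [thetaFactorial, ← Finset.prod_range_reflect]
    refine Finset.prod_congr rfl fun s hs => ?_
    have hs' := Finset.mem_range.mp hs
    have e : qPow ε 2 1 ^ (k - 1 - s) * (qPow ε 2 (1 - k) * qPow ε i 1) =
        qPow ε i 1 / qPow ε 2 1 ^ s := by
      rw [eq_div_iff (pow_ne_zero _ (qPow_ne_zero _ _ _)), ← qPow_nat, ← qPow_nat]
      have : qPow ε 2 ((k - 1 - s : ℕ) : ℂ) * qPow ε 2 (1 - k) * qPow ε 2 (s : ℂ) = 1 := by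
        rw [← qPow_add, ← qPow_add]
        convert qPow_zero ε 2 using 2
        rw [Nat.cast_sub (by omega), Nat.cast_sub (by omega)]
        push_cast
        ring
      linear_combination qPow ε i 1 * this
    rw [e, theta_inv hp (div_ne_zero (qPow_ne_zero _ _ _) (pow_ne_zero _ (qPow_ne_zero _ _ _))),
      inv_div]
  rw [miuraCoeff, hnum, Finset.prod_mul_distrib, thetaFactorial]
  simp only [miuraRatio, Finset.prod_div_distrib, Finset.prod_mul_distrib, Finset.prod_const,
    Finset.card_range]
  rw [← hscal]
  simp only [pow_succ]
  ring

theorem miuraCoeff_two_eq_zero (hp : ‖p‖ < 1) {k : ℕ} (hk : 2 ≤ k) : miuraCoeff ε p 2 k = 0 := by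
  rw [miuraCoeff_eq_prod ε hp]
  refine Finset.prod_eq_zero (Finset.mem_range.mpr hk) ?_
  rw [miuraRatio, pow_one, div_self (qPow_ne_zero _ _ _), theta_one hp]
  simp

end

/-! ## Pairs of compositions -/

theorem le_partialSum (κ : Fin n → ℕ) {i j : Fin n} (hij : i < j) : κ i ≤ partialSum κ j :=
  Finset.single_le_sum (f := κ) (fun _ _ => Nat.zero_le _) (by simpa using hij)

theorem partialSum_add_le (κ : Fin n → ℕ) {i j : Fin n} (hij : i < j) :
    partialSum κ i + κ i ≤ partialSum κ j := by
  have h : insert i (Finset.univ.filter fun k => k < i) ⊆ Finset.univ.filter fun k => k < j := by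
    intro k hk
    simp only [Finset.mem_insert, Finset.mem_filter, Finset.mem_univ, true_and] at hk ⊢
    rcases hk with rfl | hk
    · exact hij
    · exact hk.trans hij
  have h1 := Finset.sum_le_sum_of_subset (f := κ) h
  rw [Finset.sum_insert (by simp)] at h1
  rw [partialSum, partialSum]
  omega

theorem sum_eq_partialSum_add (κ : Fin n → ℕ) (j : Fin n) :
    ∑ i, κ i = partialSum κ j + κ j + ∑ i ∈ Finset.univ.filter (fun i => j < i), κ i := by
  have h : (Finset.univ.filter fun i => ¬ i < j) = insert j (Finset.univ.filter fun i => j < i) := by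
    ext i
    simp [le_iff_eq_or_lt, eq_comm]
  rw [← Finset.sum_filter_add_sum_filter_not Finset.univ (fun i => i < j), h,
    Finset.sum_insert (by simp), partialSum, add_assoc]

theorem partialSum_add_le_sum (κ : Fin n → ℕ) (j : Fin n) : partialSum κ j + κ j ≤ ∑ i, κ i := by
  rw [sum_eq_partialSum_add κ j]
  omega

theorem partialSum_add (κ l : Fin n → ℕ) (i : Fin n) :
    partialSum (κ + l) i = partialSum κ i + partialSum l i := Finset.sum_add_distrib

/-- The pairs of compositions that occur in the fusion of two currents. -/
def Fusible (κ l : Fin n → ℕ) : Prop := ∀ i j, i < j → κ i = 0 ∨ l j = 0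

theorem Fusible.partialSum_eq_zero {κ l : Fin n → ℕ} (h : Fusible κ l) {j : Fin n} (hj : l j ≠ 0) :
    partialSum κ j = 0 :=
  Finset.sum_eq_zero fun i hi => (h i j (Finset.mem_filter.mp hi).2).resolve_right hj

theorem Fusible.partialSum_add_eq {κ l : Fin n → ℕ} (h : Fusible κ l) {j : Fin n} (hj : κ j ≠ 0) :
    partialSum l j + l j = ∑ i, l i := by
  rw [sum_eq_partialSum_add l j, Finset.sum_eq_zero, add_zero]
  exact fun i hi => (h j i (Finset.mem_filter.mp hi).2).resolve_left hj

theorem exists_of_not_fusible {κ l : Fin n → ℕ} (h : ¬ Fusible κ l) :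
    ∃ j, ∃ b ∈ Finset.range (l j), partialSum l j + b + 1 = ∑ i, l i ∧ partialSum κ j ≠ 0 := by
  simp only [Fusible, not_forall, not_or] at h
  obtain ⟨i, j, hij, hi, hj⟩ := h
  have hne : (Finset.univ.filter fun k => l k ≠ 0).Nonempty := ⟨j, by simpa using hj⟩
  have hmem := Finset.max'_mem _ hne
  have hmax := Finset.le_max' (Finset.univ.filter fun k => l k ≠ 0)
  set J := (Finset.univ.filter fun k => l k ≠ 0).max' hne
  have hJ : l J ≠ 0 := (Finset.mem_filter.mp hmem).2
  have hjJ : j ≤ J := hmax j (by simpa using hj)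
  refine ⟨J, l J - 1, Finset.mem_range.mpr (by omega), ?_, ?_⟩
  · rw [sum_eq_partialSum_add l J, Finset.sum_eq_zero]
    · omega
    · intro k hk
      by_contra hk0
      exact absurd (hmax k (by simpa using hk0)) (not_le.mpr (Finset.mem_filter.mp hk).2)
  · have := le_partialSum κ (hij.trans_le hjJ)
    omega

/-- The part of a composition lying in the first `r` units. -/
def initialPart (r : ℕ) (ν : Fin n → ℕ) (i : Fin n) : ℕ := min (ν i) (r - partialSum ν i)

theorem sum_initialPart (r : ℕ) (ν : Fin n → ℕ) : ∑ i, initialPart r ν i = min (∑ i, ν i) r := by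
  induction n generalizing r with
  | zero => simp
  | succ n ih =>
    have h := ih (r - ν 0) (Fin.tail ν)
    simp only [initialPart] at h ⊢
    rw [Fin.sum_univ_succ, Fin.sum_univ_succ]
    simp only [partialSum_succ, partialSum_zero, ← Nat.sub_sub]
    simp only [Fin.tail] at h ⊢
    rw [h]
    omega

theorem Fusible.initialPart_add {κ l : Fin n → ℕ} (h : Fusible κ l) {r : ℕ} (hr : ∑ i, l i = r) :
    initialPart r (κ + l) = l := by
  ext i
  rw [initialPart, partialSum_add, Pi.add_apply]
  have h1 := partialSum_add_le_sum l i
  rcases eq_or_ne (l i) 0 with hl | hl <;> rcases eq_or_ne (κ i) 0 with hk | hk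
  · omega
  · have h2 := h.partialSum_add_eq hk
    omega
  · have h3 := h.partialSum_eq_zero hl
    omega
  · have h2 := h.partialSum_add_eq hk
    have h3 := h.partialSum_eq_zero hl
    omega

theorem fusible_initialPart (r : ℕ) (ν : Fin n → ℕ) :
    Fusible (ν - initialPart r ν) (initialPart r ν) := by
  intro i j hij
  have := partialSum_add_le ν hij
  simp only [Pi.sub_apply, initialPart]
  omega

/-- A sum over fusible pairs of compositions is a sum over compositions. -/
theorem sum_fusible {M : Type*} [AddCommMonoid M] (m r : ℕ) (F : (Fin n → ℕ) → (Fin n → ℕ) → M)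
    (H : (Fin n → ℕ) → M)
    (hF : ∀ κ l, ∑ i, κ i = m → ∑ i, l i = r → Fusible κ l → F κ l = H (κ + l))
    (h0 : ∀ κ l, ∑ i, κ i = m → ∑ i, l i = r → ¬ Fusible κ l → F κ l = 0) :
    ∑ κ ∈ Finset.Nat.antidiagonalTuple n m, ∑ l ∈ Finset.Nat.antidiagonalTuple n r, F κ l =
      ∑ ν ∈ Finset.Nat.antidiagonalTuple n (m + r), H ν := by
  classical
  rw [← Finset.sum_product', ← Finset.sum_filter_of_ne (p := fun x => Fusible x.1 x.2)]
  · refine Finset.sum_bij' (fun x _ => x.1 + x.2)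
      (fun ν _ => (ν - initialPart r ν, initialPart r ν)) ?_ ?_ ?_ ?_ ?_
    · rintro ⟨κ, l⟩ hx
      simp only [Finset.mem_filter, Finset.mem_product, Finset.Nat.mem_antidiagonalTuple] at hx ⊢
      simp [Finset.sum_add_distrib, hx.1.1, hx.1.2]
    · intro ν hν
      simp only [Finset.mem_filter, Finset.mem_product, Finset.Nat.mem_antidiagonalTuple] at hν ⊢
      have h1 := sum_initialPart r ν
      have h2 : ∑ i, (ν - initialPart r ν) i + ∑ i, initialPart r ν i = ∑ i, ν i := by
        rw [← Finset.sum_add_distrib]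
        refine Finset.sum_congr rfl fun i _ => ?_
        simp only [Pi.sub_apply, initialPart]
        omega
      exact ⟨⟨by omega, by omega⟩, fusible_initialPart r ν⟩
    · rintro ⟨κ, l⟩ hx
      simp only [Finset.mem_filter, Finset.mem_product, Finset.Nat.mem_antidiagonalTuple] at hx
      simp [hx.2.initialPart_add hx.1.2]
    · intro ν _
      ext i
      simp only [Pi.add_apply, Pi.sub_apply, initialPart]
      omega
    · rintro ⟨κ, l⟩ hx
      simp only [Finset.mem_filter, Finset.mem_product, Finset.Nat.mem_antidiagonalTuple] at hx
      exact hF κ l hx.1.1 hx.1.2 hx.2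
  · rintro ⟨κ, l⟩ hx hne
    simp only [Finset.mem_product, Finset.Nat.mem_antidiagonalTuple] at hx
    by_contra h
    exact hne (h0 κ l hx.1 hx.2 h)

theorem Fusible.termSym_add {κ l : Fin n → ℕ} (h : Fusible κ l) (ε : Fin 3 → ℂ) (p : ℂ)
    (c : Fin n → Fin 3) {r : ℕ} (hr : ∑ i, l i = r) (z : ℂ) :
    termSym ε p c κ (qPow ε 2 (-r) * z) + termSym ε p c l z = termSym ε p c (κ + l) z := by
  rw [termSym, termSym, termSym, ← Finset.sum_add_distrib]
  refine Finset.sum_congr rfl fun i _ => ?_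
  rw [Pi.add_apply, add_comm (κ i), Finset.sum_range_add, add_comm]
  congr 1
  · refine Finset.sum_congr rfl fun a ha => ?_
    have hl : l i ≠ 0 := by
      have := Finset.mem_range.mp ha
      omega
    rw [partialSum_add, h.partialSum_eq_zero hl, zero_add]
  · refine Finset.sum_congr rfl fun a ha => ?_
    have hk : κ i ≠ 0 := by
      have := Finset.mem_range.mp ha
      omega
    have h1 := h.partialSum_add_eq hk
    rw [← mul_assoc, ← qPow_add, partialSum_add,
      show partialSum κ i + partialSum l i + (l i + a) = partialSum κ i + a + r by omega]
    push_cast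
    congr 3
    ring

end EllipticCorner

end

noncomputable section

namespace EllipticCorner

variable {n : ℕ}

/-! ## The residues of the structure functions -/

section

variable (ε : Fin 3 → ℂ) (p : ℂ) (c : Fin n → Fin 3) (κ l : Fin n → ℕ) (r : ℕ)

/-- The value at `x = q₃ ^ r` of a factor of the structure function, multiplied with
`θ_p(q₃ ^ (-r) x)` if its label is the last one. -/
def residueFactor (j : Fin n) (b : ℕ) : ℂ :=
  if partialSum l j + b + 1 = r then
    if partialSum κ j = 0 then
      theta p (numArg₁ ε c κ l (qPow ε 2 1 ^ r) j b) *
        theta p (numArg₂ ε c κ l (qPow ε 2 1 ^ r) j b) /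
          theta p (denArg₁ ε κ l (qPow ε 2 1 ^ r) j b)
    else 0
  else structFactor ε p c κ l (qPow ε 2 1 ^ r) j b

/-- The factors of the structure constants of the fusion. -/
def fusionFactor (s : ℕ) : ℂ :=
  theta p (qPow ε 0 1 * qPow ε 2 1 ^ (s + 1)) * theta p (qPow ε 1 1 * qPow ε 2 1 ^ (s + 1)) /
    (theta p (qPow ε 2 1 ^ (s + 1)) * if s = 0 then 1 else theta p (qPow ε 2 1 ^ s))

end

theorem continuousAt_theta_mul {p : ℂ} (hp : ‖p‖ < 1) {a x₀ : ℂ} (ha : a ≠ 0) (hx : x₀ ≠ 0) :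
    ContinuousAt (fun x => theta p (a * x)) x₀ :=
  ContinuousAt.comp (f := fun x => a * x) (theta_continuousAt hp (mul_ne_zero ha hx)) (by fun_prop)

section

variable {ε : Fin 3 → ℂ} {p : ℂ} (c : Fin n → Fin 3) {κ l : Fin n → ℕ} {m r : ℕ}

theorem theta_denArg₁_ne_zero (hθ : ∀ k : ℕ, 1 ≤ k → k ≤ m + r → theta p (qPow ε 2 k) ≠ 0)
    (hm : ∑ i, κ i = m) (hr : ∑ i, l i = r) {j : Fin n} {b : ℕ} (hb : b < l j) :
    theta p (denArg₁ ε κ l (qPow ε 2 1 ^ r) j b) ≠ 0 := by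
  have h1 := partialSum_add_le_sum κ j
  have h2 := partialSum_add_le_sum l j
  obtain ⟨s, hs⟩ := Nat.exists_eq_add_of_lt (show partialSum l j + b < r by omega)
  have h3 := hθ (partialSum κ j + κ j + (s + 1)) (by omega) (by omega)
  rw [qPow_nat] at h3
  convert h3 using 2
  have h0 := pow_ne_zero (partialSum l j + b) (qPow_ne_zero ε 2 1)
  rw [denArg₁, hs, add_assoc (partialSum l j + b), pow_add _ (partialSum l j + b),
    div_mul_eq_mul_div, div_eq_iff h0]
  ring

theorem theta_denArg₂_ne_zero (hθ : ∀ k : ℕ, 1 ≤ k → k ≤ m + r → theta p (qPow ε 2 k) ≠ 0)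
    (hm : ∑ i, κ i = m) (hr : ∑ i, l i = r) {j : Fin n} {b : ℕ} (hb : b < l j)
    (h : ¬ (partialSum l j + b + 1 = r ∧ partialSum κ j = 0)) :
    theta p (denArg₂ ε κ l (qPow ε 2 1 ^ r) j b) ≠ 0 := by
  have h1 := partialSum_add_le_sum κ j
  have h2 := partialSum_add_le_sum l j
  obtain ⟨s, hs⟩ := Nat.exists_eq_add_of_le (show partialSum l j + b + 1 ≤ r by omega)
  have h3 := hθ (partialSum κ j + s) (by omega) (by omega)
  rw [qPow_nat] at h3
  convert h3 using 2
  have h0 := pow_ne_zero (partialSum l j + b + 1) (qPow_ne_zero ε 2 1)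
  rw [denArg₂, hs, pow_add _ (partialSum l j + b + 1), div_mul_eq_mul_div, div_eq_iff h0]
  ring

theorem denArg₂_last {j : Fin n} {b : ℕ} (h : partialSum l j + b + 1 = r)
    (h' : partialSum κ j = 0) (x : ℂ) : denArg₂ ε κ l x j b = qPow ε 2 (-r) * x := by
  rw [denArg₂, h, h', pow_zero, one_div, qPow_neg, qPow_nat]

theorem theta_shift_eventually_ne_zero (hp : ‖p‖ < 1) :
    ∀ᶠ x in 𝓝[≠] (qPow ε 2 1 ^ r), theta p (qPow ε 2 (-r) * x) ≠ 0 := by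
  have h0 := pow_ne_zero r (qPow_ne_zero ε 2 1)
  have h1 : qPow ε 2 (-r) * qPow ε 2 1 ^ r = 1 := by
    rw [qPow_neg, qPow_nat, inv_mul_cancel₀ h0]
  have ht : Filter.Tendsto (fun x => qPow ε 2 (-r) * x) (𝓝[≠] (qPow ε 2 1 ^ r)) (𝓝[≠] 1) := by
    refine tendsto_nhdsWithin_iff.mpr ⟨?_, ?_⟩
    · have h2 : ContinuousAt (fun x => qPow ε 2 (-r) * x) (qPow ε 2 1 ^ r) := by fun_prop
      have h3 := h2.tendsto.mono_left (nhdsWithin_le_nhds (s := {qPow ε 2 1 ^ r}ᶜ))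
      rwa [h1] at h3
    · filter_upwards [self_mem_nhdsWithin] with x hx hx'
      refine hx (mul_left_cancel₀ (qPow_ne_zero ε 2 (-r)) ?_)
      rw [h1]
      exact hx'
  exact ht.eventually (theta_eventually_ne_zero hp)

theorem continuousAt_args (hp : ‖p‖ < 1) (j : Fin n) (b : ℕ) {x₀ : ℂ} (hx : x₀ ≠ 0) :
    ContinuousAt (fun x => theta p (numArg₁ ε c κ l x j b)) x₀ ∧
      ContinuousAt (fun x => theta p (numArg₂ ε c κ l x j b)) x₀ ∧
      ContinuousAt (fun x => theta p (denArg₁ ε κ l x j b)) x₀ ∧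
      ContinuousAt (fun x => theta p (denArg₂ ε κ l x j b)) x₀ := by
  have h : ∀ i k, qPow ε i 1 ^ k ≠ 0 := fun i k => pow_ne_zero _ (qPow_ne_zero _ _ _)
  exact ⟨continuousAt_theta_mul hp (div_ne_zero (mul_ne_zero (qPow_ne_zero _ _ _) (h _ _)) (h _ _)) hx,
    continuousAt_theta_mul hp (div_ne_zero (mul_ne_zero (inv_ne_zero (qPow_ne_zero _ _ _)) (h _ _))
      (h _ _)) hx, continuousAt_theta_mul hp (div_ne_zero (h _ _) (h _ _)) hx,
    continuousAt_theta_mul hp (div_ne_zero (h _ _) (h _ _)) hx⟩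

theorem theta_den_eventually_ne_zero (hp : ‖p‖ < 1)
    (hθ : ∀ k : ℕ, 1 ≤ k → k ≤ m + r → theta p (qPow ε 2 k) ≠ 0)
    (hm : ∑ i, κ i = m) (hr : ∑ i, l i = r) {j : Fin n} {b : ℕ} (hb : b < l j) :
    ∀ᶠ x in 𝓝[≠] (qPow ε 2 1 ^ r), theta p (denArg₁ ε κ l x j b) ≠ 0 ∧
      theta p (denArg₂ ε κ l x j b) ≠ 0 := by
  have hQ := pow_ne_zero r (qPow_ne_zero ε 2 1)
  have hc := continuousAt_args (ε := ε) (fun _ => 0) (κ := κ) (l := l) hp j b hQ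
  have h1 := (hc.2.2.1.eventually_ne (theta_denArg₁_ne_zero hθ hm hr hb)).filter_mono
    (nhdsWithin_le_nhds (s := {qPow ε 2 1 ^ r}ᶜ))
  by_cases h : partialSum l j + b + 1 = r ∧ partialSum κ j = 0
  · filter_upwards [h1, theta_shift_eventually_ne_zero (ε := ε) (r := r) hp] with x hx hx'
    exact ⟨hx, by rwa [denArg₂_last h.1 h.2]⟩
  · have h2 := (hc.2.2.2.eventually_ne (theta_denArg₂_ne_zero hθ hm hr hb h)).filter_mono
      (nhdsWithin_le_nhds (s := {qPow ε 2 1 ^ r}ᶜ))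
    exact h1.and h2

theorem tendsto_structFactor (hp : ‖p‖ < 1)
    (hθ : ∀ k : ℕ, 1 ≤ k → k ≤ m + r → theta p (qPow ε 2 k) ≠ 0)
    (hm : ∑ i, κ i = m) (hr : ∑ i, l i = r) {j : Fin n} {b : ℕ} (hb : b < l j) :
    Filter.Tendsto (fun x => (if partialSum l j + b + 1 = r then theta p (qPow ε 2 (-r) * x) else 1) *
      structFactor ε p c κ l x j b) (𝓝[≠] (qPow ε 2 1 ^ r)) (𝓝 (residueFactor ε p c κ l r j b)) := by
  have hQ := pow_ne_zero r (qPow_ne_zero ε 2 1)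
  obtain ⟨n1, n2, d1, d2⟩ := continuousAt_args (ε := ε) c (κ := κ) (l := l) hp j b hQ
  have hd1 := theta_denArg₁_ne_zero hθ hm hr hb
  have hcont : ¬ (partialSum l j + b + 1 = r ∧ partialSum κ j = 0) →
      ContinuousAt (fun x => structFactor ε p c κ l x j b) (qPow ε 2 1 ^ r) := fun h =>
    (n1.mul n2).div (d1.mul d2) (mul_ne_zero hd1 (theta_denArg₂_ne_zero hθ hm hr hb h))
  by_cases h : partialSum l j + b + 1 = r
  · by_cases h' : partialSum κ j = 0
    · rw [residueFactor, if_pos h, if_pos h']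
      have hlim : Filter.Tendsto (fun x => theta p (numArg₁ ε c κ l x j b) *
          theta p (numArg₂ ε c κ l x j b) / theta p (denArg₁ ε κ l x j b)) (𝓝[≠] (qPow ε 2 1 ^ r)) _ :=
        ((n1.mul n2).div d1 hd1).tendsto.mono_left nhdsWithin_le_nhds
      refine hlim.congr' ?_
      filter_upwards [theta_shift_eventually_ne_zero (ε := ε) (r := r) hp] with x hx
      rw [if_pos h, structFactor, denArg₂_last h h']
      field_simp
    · rw [residueFactor, if_pos h, if_neg h']
      simp only [if_pos h]
      have h1 := (continuousAt_theta_mul hp (qPow_ne_zero ε 2 (-r)) hQ).fun_mul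
        (hcont fun hh => h' hh.2)
      have h2 : theta p (qPow ε 2 (-r) * qPow ε 2 1 ^ r) = 0 := by
        rw [qPow_neg, qPow_nat, inv_mul_cancel₀ hQ, theta_one hp]
      have h3 := h1.tendsto.mono_left (nhdsWithin_le_nhds (s := {qPow ε 2 1 ^ r}ᶜ))
      rwa [h2, zero_mul] at h3
  · rw [residueFactor, if_neg h]
    simp only [if_neg h, one_mul]
    exact (hcont fun hh => h hh.1).tendsto.mono_left nhdsWithin_le_nhds

theorem tendsto_structFun (hp : ‖p‖ < 1)
    (hθ : ∀ k : ℕ, 1 ≤ k → k ≤ m + r → theta p (qPow ε 2 k) ≠ 0) (hr1 : 1 ≤ r)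
    (hm : ∑ i, κ i = m) (hr : ∑ i, l i = r) :
    Filter.Tendsto (fun x => theta p (qPow ε 2 (-r) * x) * structFun ε p c κ l x)
      (𝓝[≠] (qPow ε 2 1 ^ r))
      (𝓝 (∏ j, ∏ b ∈ Finset.range (l j), residueFactor ε p c κ l r j b)) := by
  have h : ∀ x, theta p (qPow ε 2 (-r) * x) * structFun ε p c κ l x =
      ∏ j, ∏ b ∈ Finset.range (l j), (if partialSum l j + b + 1 = r then
        theta p (qPow ε 2 (-r) * x) else 1) * structFactor ε p c κ l x j b := by
    intro x
    simp only [Finset.prod_mul_distrib, structFun]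
    rw [prod_partialSum l fun a => if a + 1 = r then theta p (qPow ε 2 (-r) * x) else 1, hr,
      Finset.prod_eq_single (r - 1), if_pos (by omega)]
    · intro a _ ha
      rw [if_neg (by omega)]
    · intro hn
      exact absurd (Finset.mem_range.mpr (by omega)) hn
  simp only [h]
  exact tendsto_finsetProd _ fun j _ => tendsto_finsetProd _ fun b hb =>
    tendsto_structFactor c hp hθ hm hr (Finset.mem_range.mp hb)

theorem prod_residueFactor_eq_zero (hr : ∑ i, l i = r) (h : ¬ Fusible κ l) :
    ∏ j, ∏ b ∈ Finset.range (l j), residueFactor ε p c κ l r j b = 0 := by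
  obtain ⟨j, b, hb, h1, h2⟩ := exists_of_not_fusible h
  refine Finset.prod_eq_zero (Finset.mem_univ j) (Finset.prod_eq_zero hb ?_)
  rw [residueFactor, if_pos (by omega), if_neg h2]

theorem residueFactor_eq {j : Fin n} (hK : partialSum κ j = 0) {b s : ℕ}
    (hs : partialSum l j + b + 1 + s = r) :
    residueFactor ε p c κ l r j b =
      theta p (qPow ε (numIdx c κ j) 1 * qPow ε 2 1 ^ (s + 1)) *
        theta p (qPow ε 2 1 ^ (κ j + s) / qPow ε (numIdx c κ j) 1) /
        (theta p (qPow ε 2 1 ^ (κ j + s + 1)) * if s = 0 then 1 else theta p (qPow ε 2 1 ^ s)) := by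
  have h0 := pow_ne_zero (partialSum l j + b) (qPow_ne_zero ε 2 1)
  have hQ := qPow_ne_zero ε 2 1
  have hg := qPow_ne_zero ε (numIdx c κ j) 1
  have e1 : numArg₁ ε c κ l (qPow ε 2 1 ^ r) j b =
      qPow ε (numIdx c κ j) 1 * qPow ε 2 1 ^ (s + 1) := by
    rw [numArg₁, hK, ← hs, add_assoc _ 1 s, pow_add _ (partialSum l j + b), div_mul_eq_mul_div,
      div_eq_iff h0]
    ring
  have e2 : numArg₂ ε c κ l (qPow ε 2 1 ^ r) j b =
      qPow ε 2 1 ^ (κ j + s) / qPow ε (numIdx c κ j) 1 := by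
    rw [numArg₂, hK, ← hs, pow_add _ (partialSum l j + b + 1), div_mul_eq_mul_div,
      div_eq_iff (pow_ne_zero _ hQ)]
    ring
  have e3 : denArg₁ ε κ l (qPow ε 2 1 ^ r) j b = qPow ε 2 1 ^ (κ j + s + 1) := by
    rw [denArg₁, hK, ← hs, add_assoc _ 1 s, pow_add _ (partialSum l j + b), div_mul_eq_mul_div,
      div_eq_iff h0]
    ring
  have e4 : denArg₂ ε κ l (qPow ε 2 1 ^ r) j b = qPow ε 2 1 ^ s := by
    rw [denArg₂, hK, ← hs, pow_add _ (partialSum l j + b + 1), div_mul_eq_mul_div,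
      div_eq_iff (pow_ne_zero _ hQ)]
    ring
  rw [residueFactor, structFactor, e1, e2, e3, e4]
  rcases eq_or_ne s 0 with h | h
  · rw [if_pos (by omega), if_pos hK, if_pos h, mul_one]
  · rw [if_neg (by omega), if_neg h]

theorem theta_pair_eq (hε : ε 0 + ε 1 + ε 2 = 0) {i : Fin 3} (hi : i ≠ 2) (s : ℕ) :
    theta p (qPow ε i 1 * qPow ε 2 1 ^ (s + 1)) * theta p (qPow ε 2 1 ^ s / qPow ε i 1) =
      theta p (qPow ε 0 1 * qPow ε 2 1 ^ (s + 1)) *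
        theta p (qPow ε 1 1 * qPow ε 2 1 ^ (s + 1)) := by
  have h : qPow ε 0 1 * qPow ε 1 1 * qPow ε 2 1 = 1 := by
    simp only [qPow, one_mul, ← Complex.exp_add, hε, Complex.exp_zero]
  have e0 : qPow ε 2 1 ^ s / qPow ε 0 1 = qPow ε 1 1 * qPow ε 2 1 ^ (s + 1) := by
    rw [div_eq_iff (qPow_ne_zero _ _ _)]
    linear_combination (-(qPow ε 2 1 ^ s)) * h
  have e1 : qPow ε 2 1 ^ s / qPow ε 1 1 = qPow ε 0 1 * qPow ε 2 1 ^ (s + 1) := by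
    rw [div_eq_iff (qPow_ne_zero _ _ _)]
    linear_combination (-(qPow ε 2 1 ^ s)) * h
  fin_cases i
  · simp only [Fin.zero_eta, e0]
  · simp only [Fin.mk_one, e1]
    ring
  · exact absurd rfl hi

theorem miuraCoeff_mul_residue (hε : ε 0 + ε 1 + ε 2 = 0) (hp : ‖p‖ < 1) (h : Fusible κ l)
    (hr : ∑ i, l i = r) (j : Fin n) :
    miuraCoeff ε p (c j) (κ j) * miuraCoeff ε p (c j) (l j) *
        ∏ b ∈ Finset.range (l j), residueFactor ε p c κ l r j b =
      miuraCoeff ε p (c j) (κ j + l j) *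
        ∏ b ∈ Finset.range (l j), fusionFactor ε p (r - 1 - (partialSum l j + b)) := by
  rcases eq_or_ne (l j) 0 with hl | hl
  · simp [hl, miuraCoeff_eq_prod ε hp]
  have hK := h.partialSum_eq_zero hl
  have hle := partialSum_add_le_sum l j
  rcases eq_or_ne (κ j) 0 with hk | hk
  · rw [hk, zero_add]
    have h1 : miuraCoeff ε p (c j) 0 = 1 := by simp [miuraCoeff_eq_prod ε hp]
    rw [h1, one_mul]
    congr 1
    refine Finset.prod_congr rfl fun b hb => ?_
    have hb' := Finset.mem_range.mp hb
    have hi : numIdx c κ j ≠ 2 := by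
      rw [numIdx]
      split_ifs with h2
      · decide
      · exact fun h3 => h2 ⟨h3, hk⟩
    rw [residueFactor_eq c hK (s := r - 1 - (partialSum l j + b)) (by omega), hk, zero_add,
      theta_pair_eq hε hi, fusionFactor]
  · have hL := h.partialSum_add_eq hk
    have hi : numIdx c κ j = c j := if_neg fun h2 => hk h2.2
    have e1 : ∏ b ∈ Finset.range (l j), residueFactor ε p c κ l r j b =
        ∏ s ∈ Finset.range (l j), (theta p (qPow ε (c j) 1 * qPow ε 2 1 ^ (s + 1)) *
        theta p (qPow ε 2 1 ^ (κ j + s) / qPow ε (c j) 1) /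
        (theta p (qPow ε 2 1 ^ (κ j + s + 1)) * if s = 0 then 1 else theta p (qPow ε 2 1 ^ s))) := by
      rw [← Finset.prod_range_reflect]
      refine Finset.prod_congr rfl fun s hs => ?_
      have hs' := Finset.mem_range.mp hs
      rw [residueFactor_eq c hK (s := s) (by omega), hi]
    have e2 : ∏ b ∈ Finset.range (l j), fusionFactor ε p (r - 1 - (partialSum l j + b)) =
        ∏ s ∈ Finset.range (l j), fusionFactor ε p s := by
      rw [← Finset.prod_range_reflect]
      refine Finset.prod_congr rfl fun s hs => ?_
      have hs' := Finset.mem_range.mp hs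
      congr 1
      omega
    have e3 : miuraCoeff ε p (c j) (κ j + l j) = miuraCoeff ε p (c j) (κ j) *
        ∏ s ∈ Finset.range (l j), miuraRatio ε p (c j) (κ j + s) := by
      rw [miuraCoeff_eq_prod ε hp, Finset.prod_range_add, miuraCoeff_eq_prod ε hp]
    have e4 : miuraCoeff ε p (c j) (κ j) * miuraCoeff ε p (c j) (l j) *
        ∏ b ∈ Finset.range (l j), residueFactor ε p c κ l r j b =
        miuraCoeff ε p (c j) (κ j + l j) * ∏ s ∈ Finset.range (l j),
          (theta p (qPow ε (c j) 1 * qPow ε 2 1 ^ (s + 1)) *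
            theta p (qPow ε 2 1 ^ s / qPow ε (c j) 1) /
          (theta p (qPow ε 2 1 ^ (s + 1)) * if s = 0 then 1 else theta p (qPow ε 2 1 ^ s))) := by
      rw [e3, e1, miuraCoeff_eq_prod ε hp (c j) (l j), mul_assoc, mul_assoc,
        ← Finset.prod_mul_distrib, ← Finset.prod_mul_distrib]
      congr 1
      refine Finset.prod_congr rfl fun s _ => ?_
      simp only [miuraRatio, div_eq_mul_inv, mul_inv]
      ring
    rw [e4, e2]
    rcases eq_or_ne (c j) 2 with hc | hc
    · rw [hc, miuraCoeff_two_eq_zero ε hp (by omega), zero_mul, zero_mul]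
    · congr 1
      refine Finset.prod_congr rfl fun s _ => ?_
      rw [theta_pair_eq hε hc, fusionFactor]

theorem Fusible.termCoeff_mul (hε : ε 0 + ε 1 + ε 2 = 0) (hp : ‖p‖ < 1) (u : Fin n → ℂ)
    (h : Fusible κ l) (hr : ∑ i, l i = r) :
    termCoeff ε p c u κ * termCoeff ε p c u l *
        ∏ j, ∏ b ∈ Finset.range (l j), residueFactor ε p c κ l r j b =
      (∏ s ∈ Finset.range r, fusionFactor ε p s) * termCoeff ε p c u (κ + l) := by
  have h1 := prod_partialSum l fun a => fusionFactor ε p (r - 1 - a)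
  rw [hr, Finset.prod_range_reflect] at h1
  rw [← h1, termCoeff, termCoeff, termCoeff, ← Finset.prod_mul_distrib, ← Finset.prod_mul_distrib,
    ← Finset.prod_mul_distrib]
  refine Finset.prod_congr rfl fun j _ => ?_
  have h2 := miuraCoeff_mul_residue c hε hp h hr j
  rw [Pi.add_apply, pow_add]
  linear_combination (u j ^ κ j * u j ^ l j) * h2

theorem prod_fusionFactor (hε : ε 0 + ε 1 + ε 2 = 0) (hp : ‖p‖ < 1) (hr : 1 ≤ r) :
    ∏ s ∈ Finset.range r, fusionFactor ε p s =
      theta p (qPow ε 0 (-1)) * theta p (qPow ε 1 (-1)) / theta p (qPow ε 2 1) *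
        ∏ s ∈ Finset.Icc 1 (r - 1), theta p (qPow ε 1 1 * qPow ε 2 (-s)) *
          theta p (qPow ε 0 1 * qPow ε 2 (-s)) /
            (theta p (qPow ε 2 (-s - 1)) * theta p (qPow ε 2 (-s))) := by
  have h : qPow ε 0 1 * qPow ε 1 1 * qPow ε 2 1 = 1 := by
    simp only [qPow, one_mul, ← Complex.exp_add, hε, Complex.exp_zero]
  have n0 := qPow_ne_zero ε 0 1
  have n1 := qPow_ne_zero ε 1 1
  have n2 := qPow_ne_zero ε 2 1
  obtain ⟨r, rfl⟩ := Nat.exists_eq_add_of_le' hr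
  rw [Finset.prod_range_succ', mul_comm]
  congr 1
  · rw [fusionFactor, if_pos rfl, mul_one, zero_add, pow_one, qPow_neg, qPow_neg,
      show (qPow ε 0 1)⁻¹ = qPow ε 1 1 * qPow ε 2 1 from inv_eq_of_mul_eq_one_right (by linear_combination h),
      show (qPow ε 1 1)⁻¹ = qPow ε 0 1 * qPow ε 2 1 from inv_eq_of_mul_eq_one_right (by linear_combination h)]
    ring
  · rw [Nat.add_sub_cancel, Finset.range_eq_Ico, Finset.prod_Ico_add' (fun s => fusionFactor ε p s) 0 r 1]
    refine Finset.prod_congr (by ext; simp) fun s hs => ?_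
    have hs0 : s ≠ 0 := by
      have := (Finset.mem_Icc.mp hs).1
      omega
    have hQ : qPow ε 2 1 ^ s ≠ 0 := pow_ne_zero _ n2
    have e1 : theta p (qPow ε 1 1 * qPow ε 2 (-s)) = -(qPow ε 1 1 / qPow ε 2 1 ^ s) *
        theta p (qPow ε 0 1 * qPow ε 2 1 ^ (s + 1)) := by
      rw [qPow_neg, qPow_nat, ← div_eq_mul_inv, theta_inv hp (div_ne_zero n1 hQ), inv_div]
      congr 2
      rw [div_eq_iff n1]
      linear_combination (-(qPow ε 2 1 ^ s)) * h
    have e2 : theta p (qPow ε 0 1 * qPow ε 2 (-s)) = -(qPow ε 0 1 / qPow ε 2 1 ^ s) *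
        theta p (qPow ε 1 1 * qPow ε 2 1 ^ (s + 1)) := by
      rw [qPow_neg, qPow_nat, ← div_eq_mul_inv, theta_inv hp (div_ne_zero n0 hQ), inv_div]
      congr 2
      rw [div_eq_iff n0]
      linear_combination (-(qPow ε 2 1 ^ s)) * h
    have e3 : theta p (qPow ε 2 (-s - 1)) = -(qPow ε 2 1 ^ (s + 1))⁻¹ *
        theta p (qPow ε 2 1 ^ (s + 1)) := by
      rw [show (-(s : ℂ) - 1) = -((s + 1 : ℕ) : ℂ) by push_cast; ring, qPow_neg, qPow_nat,
        theta_inv hp (inv_ne_zero (pow_ne_zero _ n2)), inv_inv]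
    have e4 : theta p (qPow ε 2 (-s)) = -(qPow ε 2 1 ^ s)⁻¹ * theta p (qPow ε 2 1 ^ s) := by
      rw [qPow_neg, qPow_nat, theta_inv hp (inv_ne_zero hQ), inv_inv]
    have e5 : -(qPow ε 1 1 / qPow ε 2 1 ^ s) * -(qPow ε 0 1 / qPow ε 2 1 ^ s) =
        -(qPow ε 2 1 ^ (s + 1))⁻¹ * -(qPow ε 2 1 ^ s)⁻¹ := by
      rw [pow_succ]
      field_simp
      linear_combination h
    rw [fusionFactor, if_neg hs0, e1, e2, e3, e4, mul_mul_mul_comm, e5,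
      mul_mul_mul_comm (-(qPow ε 2 1 ^ (s + 1))⁻¹) (theta p _), mul_div_mul_left]
    exact mul_ne_zero (neg_ne_zero.mpr (inv_ne_zero (pow_ne_zero _ n2)))
      (neg_ne_zero.mpr (inv_ne_zero hQ))

end

end EllipticCorner

end

noncomputable section

namespace EllipticCorner

variable {n : ℕ}

theorem le_one_of_termCoeff_ne_zero {ε : Fin 3 → ℂ} {p : ℂ} (hp : ‖p‖ < 1) {c : Fin n → Fin 3}
    {u : Fin n → ℂ} {κ : Fin n → ℕ} (h : termCoeff ε p c u κ ≠ 0) (j : Fin n) (hj : c j = 2) :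
    κ j ≤ 1 := by
  by_contra hk
  refine h (Finset.prod_eq_zero (Finset.mem_univ j) ?_)
  rw [hj, miuraCoeff_two_eq_zero ε hp (by omega), zero_mul]

theorem tendsto_div_punctured (ε : Fin 3 → ℂ) (r : ℕ) {z : ℂ} (hz : z ≠ 0) :
    Filter.Tendsto (fun w => z / w) (𝓝[≠] (qPow ε 2 (-r) * z)) (𝓝[≠] (qPow ε 2 1 ^ r)) := by
  have h0 := mul_ne_zero (qPow_ne_zero ε 2 (-r)) hz
  have h1 : z / (qPow ε 2 (-r) * z) = qPow ε 2 1 ^ r := by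
    rw [qPow_neg, qPow_nat]
    field_simp
  rw [← h1]
  refine tendsto_nhdsWithin_iff.mpr ⟨?_, ?_⟩
  · exact ((continuousAt_const.div continuousAt_id h0).tendsto).mono_left nhdsWithin_le_nhds
  · filter_upwards [self_mem_nhdsWithin] with w hw hw'
    exact hw (inv_injective (mul_left_cancel₀ hz (by simpa only [div_eq_mul_inv] using Set.mem_singleton_iff.mp hw')))

end EllipticCorner

end

theorem mainTheorem2 (ε : Fin 3 → ℂ) (hε : ε 0 + ε 1 + ε 2 = 0)
    (hgen : ∀ L M N : ℤ, qPow ε 0 1 ^ L * qPow ε 1 1 ^ M * qPow ε 2 1 ^ N = 1 → L = M ∧ M = N)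
    (p : ℂ) (hp₀ : p ≠ 0) (hp₁ : ‖p‖ < 1)
    (n : ℕ) (c : Fin n → Fin 3) (hc : qTot ε c 1 ≠ 1) (u : Fin n → ℂ)
    (m r : ℕ) (hr : 1 ≤ r) (hrm : r ≤ m)
    (hθ : ∀ k : ℕ, 1 ≤ k → k ≤ m + r → theta p (qPow ε 2 k) ≠ 0)
    (z : ℂ) (hz : z ≠ 0) (v : Fock n) (μ : Osc n →₀ ℕ) :
    ∃ G : ℂ → ℂ,
      (∀ᶠ w in 𝓝[≠] (qPow ε 2 (-r) * z),
        HasContinuedSum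
          (fSeries ε p c m r (qPow ε 2 ((m - r) / 2) * (z / w)) *
            productSeries ε p c (current ε p c u m w) (current ε p c u r z) μ v)
          (G w)) ∧
      Filter.Tendsto (fun w => theta p (qPow ε 2 (-r) * (z / w)) * G w)
        (𝓝[≠] (qPow ε 2 (-r) * z))
        (𝓝 (theta p (qPow ε 0 (-1)) * theta p (qPow ε 1 (-1)) / theta p (qPow ε 2 1) *
          (∏ l ∈ Finset.Icc 1 (r - 1),
            theta p (qPow ε 1 1 * qPow ε 2 (-l)) * theta p (qPow ε 0 1 * qPow ε 2 (-l)) /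
              (theta p (qPow ε 2 (-l - 1)) * theta p (qPow ε 2 (-l)))) *
          MvPowerSeries.coeff μ (act ε p c (current ε p c u (m + r) z) v))) := by
  have hw₀ : qPow ε 2 (-r) * z ≠ 0 := mul_ne_zero (qPow_ne_zero ε 2 (-r)) hz
  have hdiv := tendsto_div_punctured ε r hz
  let M : (Fin n → ℕ) → (Fin n → ℕ) → ℂ → ℂ := fun κ l w =>
    MvPowerSeries.coeff μ (vertexOp ε p c (termSym ε p c κ w + termSym ε p c l z) v)
  refine ⟨fun w => ∑ κ ∈ Finset.Nat.antidiagonalTuple n m, ∑ l ∈ Finset.Nat.antidiagonalTuple n r,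
    termCoeff ε p c u κ * termCoeff ε p c u l * structFun ε p c κ l (z / w) * M κ l w, ?_, ?_⟩
  · have hden : ∀ᶠ w in 𝓝[≠] (qPow ε 2 (-r) * z), ∀ κ ∈ Finset.Nat.antidiagonalTuple n m,
        ∀ l ∈ Finset.Nat.antidiagonalTuple n r, ∀ j ∈ Finset.univ, ∀ b ∈ Finset.range (l j),
        theta p (denArg₁ ε κ l (z / w) j b) ≠ 0 ∧ theta p (denArg₂ ε κ l (z / w) j b) ≠ 0 := by
      simp only [Filter.eventually_all_finset]
      intro κ hκ l hl j _ b hb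
      exact hdiv.eventually (theta_den_eventually_ne_zero hp₁ hθ
        (Finset.Nat.mem_antidiagonalTuple.mp hκ) (Finset.Nat.mem_antidiagonalTuple.mp hl)
        (Finset.mem_range.mp hb))
    have hne : ∀ᶠ w in 𝓝[≠] (qPow ε 2 (-r) * z), w ≠ 0 :=
      (continuousAt_id.eventually_ne hw₀).filter_mono nhdsWithin_le_nhds
    filter_upwards [hden, hne] with w hw hw0
    rw [current_eq, current_eq, productSeries_sum, Finset.mul_sum]
    refine HasContinuedSum.sum _ fun κ hκ => ?_
    rw [Finset.mul_sum]
    refine HasContinuedSum.sum _ fun l hl => ?_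
    exact hasContinuedSum_term hε hgen hp₀ hp₁ c hc hrm κ l _ _
      (fun h => le_one_of_termCoeff_ne_zero hp₁ h) (Finset.Nat.mem_antidiagonalTuple.mp hκ)
      (Finset.Nat.mem_antidiagonalTuple.mp hl) hw0 hz
      (fun j b hb => hw κ hκ l hl j (Finset.mem_univ j) b hb) μ v
  · have hM : ∀ κ l, Filter.Tendsto (M κ l) (𝓝[≠] (qPow ε 2 (-r) * z))
        (𝓝 (M κ l (qPow ε 2 (-r) * z))) := fun κ l =>
      (continuousAt_coeff_vertexOp ε p c
        (fun o => (continuousAt_termSym ε p c κ hw₀ o).1.add continuousAt_const)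
        (fun o => (continuousAt_termSym ε p c κ hw₀ o).2.add continuousAt_const)
        μ v).tendsto.mono_left nhdsWithin_le_nhds
    have hlim : Filter.Tendsto (fun w => ∑ κ ∈ Finset.Nat.antidiagonalTuple n m,
        ∑ l ∈ Finset.Nat.antidiagonalTuple n r, termCoeff ε p c u κ * termCoeff ε p c u l *
          (theta p (qPow ε 2 (-r) * (z / w)) * structFun ε p c κ l (z / w)) * M κ l w)
        (𝓝[≠] (qPow ε 2 (-r) * z)) (𝓝 (∑ κ ∈ Finset.Nat.antidiagonalTuple n m,
          ∑ l ∈ Finset.Nat.antidiagonalTuple n r, termCoeff ε p c u κ * termCoeff ε p c u l *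
            (∏ j, ∏ b ∈ Finset.range (l j), residueFactor ε p c κ l r j b) *
              M κ l (qPow ε 2 (-r) * z))) := by
      refine tendsto_finsetSum _ fun κ hκ => tendsto_finsetSum _ fun l hl => ?_
      exact (((tendsto_structFun c hp₁ hθ hr (Finset.Nat.mem_antidiagonalTuple.mp hκ)
        (Finset.Nat.mem_antidiagonalTuple.mp hl)).comp hdiv).const_mul _).mul (hM κ l)
    rw [sum_fusible m r _ (fun ν => (∏ s ∈ Finset.range r, fusionFactor ε p s) *
      termCoeff ε p c u ν * MvPowerSeries.coeff μ (vertexOp ε p c (termSym ε p c ν z) v))] at hlim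
    · rw [← prod_fusionFactor hε hp₁ hr, current_eq, act_sum, map_sum, Finset.mul_sum]
      simp only [act_single, map_smul, smul_eq_mul, ← mul_assoc]
      refine hlim.congr fun w => ?_
      rw [Finset.mul_sum]
      refine Finset.sum_congr rfl fun κ _ => ?_
      rw [Finset.mul_sum]
      refine Finset.sum_congr rfl fun l _ => ?_
      ring
    · intro κ l _ hl h
      rw [h.termCoeff_mul c hε hp₁ u hl]
      simp only [M]
      rw [h.termSym_add ε p c hl]
    · intro κ l _ hl h
      rw [prod_residueFactor_eq_zero c hl h, mul_zero, zero_mul]
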